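/- **Setting.** Let $d\ge 1$ and let $\Omega\subset\mathbb R^d$ be an open set with a partition $\mathcal T_h$ into finitely many bounded open convex polytopes $K$: the elements are nonempty, contained in $\Omega$, pairwise disjoint, and $\bar\Omega=\bigcup_{K}\bar K$. The skeleton $\bigcup_K\partial K$ is divided, up to a set of $(d-1)$-dimensional measure zero, into finitely many pairwise disjoint flat faces $e\in\mathcal E_h$ (hanging nodes are allowed). Each face is either interior ($e\subset\Omega\cap\partial K^+\cap\partial K^-$ with two different elements $K^\pm$, whose outward unit normals on $e$ are $n^\pm$, $n^-=-n^+$) or a boundary face ($e\in\mathcal E_h^\partial$, $e\subset\partial\Omega\cap\partial K$, with outward unit normal $n$). The boundary of each element is filled, up to measure zero, by the faces that belong to it. Let $h_K=\operatorname{diam}K$, let $h_e>0$ be the size assigned to the face $e$ (any positive numbers, for instance $h_e=\operatorname{diam}e$ when $d\ge2$), and let $\eta=\eta_e h_e^{-1}$ on $e$ with penalty parameters $\eta_e>0$. On an interior face let $\llbracket v\rrbracket=v^+n^++v^-n^-$ and $\{q\}=\tfrac12(q^++q^-)$; on a boundary face let $\llbracket v\rrbracket=vn$ and $\{q\}=q$,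 all values on faces being traces. With $\nabla_h$ the elementwise gradient, put $$a_h(u,v)=\int_\Omega\nabla_hu\cdot\nabla_hv\,dx-\int_{\mathcal E_h}\{\nabla_hu\}\cdot\llbracket v\rrbracket\,ds-\int_{\mathcal E_h}\llbracket u\rrbracket\cdot\{\nabla_hv\}\,ds+\int_{\mathcal E_h}\eta\,\llbracket u\rrbracket\cdot\llbracket v\rrbracket\,ds,$$ $$l(v)=\int_\Omega fv\,dx-\int_{\mathcal E_h^\partial}g\,n\cdot\nabla_hv\,ds+\int_{\mathcal E_h^\partial}\eta\,g\,v\,ds.$$ For every $K$ let $\phi^K(\theta^K_1,\cdot),\dots,\phi^K(\theta^K_M,\cdot)\in H^2(K)$ be the outputs of the last hidden layer of a randomized neural network with fixed hidden parameters $\theta^K_j$, let $\mathcal M_{RNN}(K)=\{\sum_{j=1}^M\alpha_j\phi^K(\theta^K_j,\cdot):\alpha_j\in\mathbb R\}$, and set $$V_h=\{v\in L^2(\Omega):v|_K\in\mathcal M_{RNN}(K)\ \ \forall K\in\mathcal T_h\},\qquad V(h)=V_h+H^2(\Omega).$$ On $V(h)$ define $$\|v\|_*^2=\sum_K|v|_{1,K}^2+\sum_{e}h_e^{-1}\|\llbracket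 v\rrbracket\|_{0,e}^2+\sum_Kh_K^2|v|_{2,K}^2 .$$ A number $C_b$ is called a *boundedness constant* of $a_h$ if $a_h(u,v)\le C_b\|u\|_*\|v\|_*$ for all $u,v\in V(h)$, and $C_s>0$ a *stability constant* of $a_h$ if $a_h(v,v)\ge C_s\|v\|_*^2$ for all $v\in V_h$. **Theorem.** 1. For all penalty parameters $\eta_e>0$, $a_h$ has a boundedness constant. 2. There is $\eta_0>0$ (depending on the partition, the $h_e$ and $V_h$) such that $a_h$ has a stability constant whenever $\eta_e\ge\eta_0$ for all $e$. 3. (Céa-type inequality.) Let $\eta_e>0$, and let $C_b$ and $C_s$ be any boundedness and stability constants of $a_h$. Let $f\in L^2(\Omega)$ and let $u\in H^2(\Omega)$ solve the weak Poisson problem with Dirichlet data $g$, that is, $u=g$ on $\partial\Omega$ in the sense of traces and $\int_\Omega\nabla u\cdot\nabla v\,dx=\int_\Omega fv\,dx$ for all $v\in H^1_0(\Omega)$. Let $u_h\in V_h$ solve the LRNN-DG scheme $a_h(u_h,v_h)=l(v_h)$ for all $v_h\in V_h$. Then $$\|u-u_h\|_*\le\Bigl(1+\frac{C_b}{C_s}\Bigr)\inf_{v_h\in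 V_h}\|u-v_h\|_* .$$ -/

import Mathlib

open MeasureTheory Filter Topology Set
open scoped ContDiff ENNReal

noncomputable section

/-- Euclidean space of dimension `d`. -/
abbrev Rd (d : ℕ) : Type := EuclideanSpace ℝ (Fin d)

/-- The `(d-1)`-dimensional surface measure: Hausdorff measure, normalised so that it agrees with
Lebesgue measure on hyperplanes (and is the counting measure when `d = 1`). -/
def surf (d : ℕ) : Measure (Rd d) := Measure.euclideanHausdorffMeasure (d - 1)

/-- The classical partial derivative of `φ` in the `i`-th coordinate direction. -/
def partialDeriv {d : ℕ} (i : Fin d) (φ : Rd d → ℝ) (x : Rd d) : ℝ :=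
  fderiv ℝ φ x (EuclideanSpace.single i 1)

/-! ### Sobolev spaces -/

/-- `g` is the `i`-th weak partial derivative of `v` on the open set `D`. -/
def HasWeakPartial {d : ℕ} (D : Set (Rd d)) (i : Fin d) (v g : Rd d → ℝ) : Prop :=
  LocallyIntegrableOn v D ∧ LocallyIntegrableOn g D ∧
    ∀ φ : Rd d → ℝ, ContDiff ℝ ∞ φ → HasCompactSupport φ → tsupport φ ⊆ D →
      ∫ x in D, v x * partialDeriv i φ x = - ∫ x in D, g x * φ x

open Classical in
/-- The `i`-th weak partial derivative of `v` on `D` (a representative of it; `0` if there is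
none). -/
def weakPartial {d : ℕ} (D : Set (Rd d)) (i : Fin d) (v : Rd d → ℝ) : Rd d → ℝ :=
  if h : ∃ g, HasWeakPartial D i v g then h.choose else 0

/-- The weak gradient of `v` on `D`. -/
def weakGrad {d : ℕ} (D : Set (Rd d)) (v : Rd d → ℝ) (x : Rd d) : Rd d :=
  WithLp.toLp 2 fun i => weakPartial D i v x

/-- `v ∈ H¹(D)`. -/
def MemH1 {d : ℕ} (D : Set (Rd d)) (v : Rd d → ℝ) : Prop :=
  MemLp v 2 (volume.restrict D) ∧
    ∀ i, ∃ g, HasWeakPartial D i v g ∧ MemLp g 2 (volume.restrict D)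

/-- `v ∈ H²(D)`. -/
def MemH2 {d : ℕ} (D : Set (Rd d)) (v : Rd d → ℝ) : Prop :=
  MemH1 D v ∧ ∀ i, MemH1 D (weakPartial D i v)

/-- `T ∈ L²(∂D)` is the trace on `∂D` of the function `v` of `H¹(D)`: some sequence of smooth
functions (restricted to the closure of `D`) converges to `v` in `H¹(D)`, while its boundary values
converge to `T` in `L²(∂D)`. -/
def IsTrace {d : ℕ} (D : Set (Rd d)) (v T : Rd d → ℝ) : Prop :=
  MemLp T 2 ((surf d).restrict (frontier D)) ∧
    ∃ w : ℕ → Rd d → ℝ, (∀ n, ContDiff ℝ ∞ (w n)) ∧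
      Tendsto (fun n => eLpNorm (fun x => w n x - v x) 2 (volume.restrict D)) atTop (𝓝 0) ∧
      (∀ i, Tendsto (fun n => eLpNorm (fun x => partialDeriv i (w n) x - weakPartial D i v x) 2
        (volume.restrict D)) atTop (𝓝 0)) ∧
      Tendsto (fun n => eLpNorm (fun x => w n x - T x) 2 ((surf d).restrict (frontier D)))
        atTop (𝓝 0)

open Classical in
/-- The trace of `v` on `∂D` (a representative of it; `0` if there is none). -/
def trace {d : ℕ} (D : Set (Rd d)) (v : Rd d → ℝ) : Rd d → ℝ :=
  if h : ∃ T, IsTrace D v T then h.choose else 0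

/-- The trace of the weak gradient of `v` on `∂D`. -/
def traceGrad {d : ℕ} (D : Set (Rd d)) (v : Rd d → ℝ) (x : Rd d) : Rd d :=
  WithLp.toLp 2 fun i => trace D (weakPartial D i v) x

/-! ### The Poisson problem -/

/-- `v ∈ H¹_g(Ω)`: `v ∈ H¹(Ω)` and `v = g` on `∂Ω` in the sense of traces. -/
def MemH1g {d : ℕ} (Ω : Set (Rd d)) (g v : Rd d → ℝ) : Prop :=
  MemH1 Ω v ∧ IsTrace Ω v g

/-- `u` is a weak solution of `-Δu = f` in `Ω`, `u = g` on `∂Ω`. -/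
def IsWeakSolution {d : ℕ} (Ω : Set (Rd d)) (f g u : Rd d → ℝ) : Prop :=
  MemH1g Ω g u ∧
    ∀ v, MemH1g Ω 0 v →
      ∫ x in Ω, inner ℝ (weakGrad Ω u x) (weakGrad Ω v x) = ∫ x in Ω, f x * v x

/-! ### Partitions of the domain -/

/-- A nonempty bounded open convex polytope. -/
def IsOpenPolytope {d : ℕ} (K : Set (Rd d)) : Prop :=
  K.Nonempty ∧ Bornology.IsBounded K ∧
    ∃ (m : ℕ) (a : Fin m → Rd d) (b : Fin m → ℝ), K = {x | ∀ k, inner ℝ (a k) x < b k}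

/-- A partition `𝒯_h` of `Ω` into finitely many convex polytopes, with the faces ("edges") of the
elements. Hanging nodes are allowed: an interior face is a piece of the common boundary of two
elements. -/
structure Mesh (d : ℕ) (Ω : Set (Rd d)) where
  /-- the number of elements -/
  numElems : ℕ
  /-- the (open) elements -/
  elem : Fin numElems → Set (Rd d)
  elem_polytope : ∀ i, IsOpenPolytope (elem i)
  elem_subset : ∀ i, elem i ⊆ Ω
  elem_disjoint : Pairwise fun i j => Disjoint (elem i) (elem j)
  elem_cover : ⋃ i, closure (elem i) = closure Ω
  /-- the number of faces -/
  numFaces : ℕ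
  /-- the faces, taken without their relative boundaries -/
  face : Fin numFaces → Set (Rd d)
  /-- the element `K⁺` on the first side of a face -/
  plus : Fin numFaces → Fin numElems
  /-- the element `K⁻` on the other side of an interior face; `none` for a boundary face -/
  minus : Fin numFaces → Option (Fin numElems)
  /-- the unit normal `n⁺`, outward from `K⁺` -/
  normal : Fin numFaces → Rd d
  face_measurable : ∀ e, MeasurableSet (face e)
  face_disjoint : Pairwise fun e e' => Disjoint (face e) (face e')
  face_plus : ∀ e, face e ⊆ frontier (elem (plus e))
  face_interior : ∀ e j, minus e = some j →
    j ≠ plus e ∧ face e ⊆ frontier (elem j) ∧ face e ⊆ Ω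
  face_boundary : ∀ e, minus e = none → face e ⊆ frontier Ω
  /-- the faces of each element fill its boundary, up to a set of surface measure zero -/
  face_cover : ∀ i,
    surf d (frontier (elem i) \ ⋃ e ∈ {e | plus e = i ∨ minus e = some i}, face e) = 0
  normal_unit : ∀ e, ‖normal e‖ = 1
  normal_plus : ∀ e, ∀ x ∈ face e, ∀ y ∈ elem (plus e), inner ℝ (normal e) (y - x) ≤ 0
  normal_minus : ∀ e j, minus e = some j →
    ∀ x ∈ face e, ∀ y ∈ elem j, 0 ≤ inner ℝ (normal e) (y - x)

namespace Mesh

variable {d : ℕ} {Ω : Set (Rd d)} (T : Mesh d Ω)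

/-- The set of boundary faces. -/
def boundaryFaces : Finset (Fin T.numFaces) :=
  Finset.univ.filter fun e => T.minus e = none

/-- The average `{∇_h v}` on the face `e`. -/
def avgGrad (e : Fin T.numFaces) (v : Rd d → ℝ) (x : Rd d) : Rd d :=
  match T.minus e with
  | none => traceGrad (T.elem (T.plus e)) v x
  | some j => (1 / 2 : ℝ) • (traceGrad (T.elem (T.plus e)) v x + traceGrad (T.elem j) v x)

/-- The jump `⟦v⟧ = v⁺ n⁺ + v⁻ n⁻` (with `n⁻ = -n⁺`) on an interior face `e`, and `⟦v⟧ = v n` on a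
boundary face. -/
def jump (e : Fin T.numFaces) (v : Rd d → ℝ) (x : Rd d) : Rd d :=
  match T.minus e with
  | none => trace (T.elem (T.plus e)) v x • T.normal e
  | some j => trace (T.elem (T.plus e)) v x • T.normal e + trace (T.elem j) v x • (-T.normal e)

/-! ### The interior penalty scheme; the penalty function is `η_e / h_e` on the face `e` -/

/-- The interior penalty bilinear form `a_h`. -/
def ah (hE ηE : Fin T.numFaces → ℝ) (u v : Rd d → ℝ) : ℝ :=
  (∑ i, ∫ x in T.elem i, inner ℝ (weakGrad (T.elem i) u x) (weakGrad (T.elem i) v x))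
    - (∑ e, ∫ x in T.face e, inner ℝ (T.avgGrad e u x) (T.jump e v x) ∂(surf d))
    - (∑ e, ∫ x in T.face e, inner ℝ (T.jump e u x) (T.avgGrad e v x) ∂(surf d))
    + ∑ e, ∫ x in T.face e, ηE e * (hE e)⁻¹ * inner ℝ (T.jump e u x) (T.jump e v x) ∂(surf d)

/-- The linear form `l`. -/
def lh (hE ηE : Fin T.numFaces → ℝ) (f g : Rd d → ℝ) (v : Rd d → ℝ) : ℝ :=
  (∫ x in Ω, f x * v x)
    - (∑ e ∈ T.boundaryFaces, ∫ x in T.face e,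
        g x * inner ℝ (T.normal e) (traceGrad (T.elem (T.plus e)) v x) ∂(surf d))
    + ∑ e ∈ T.boundaryFaces, ∫ x in T.face e,
        ηE e * (hE e)⁻¹ * (g x * trace (T.elem (T.plus e)) v x) ∂(surf d)

/-- `|v|²_{1,h}`. -/
def h1Sq (v : Rd d → ℝ) : ℝ :=
  ∑ i, ∑ k, ∫ x in T.elem i, (weakPartial (T.elem i) k v x) ^ 2

/-- `|v|²_{1,*}`. -/
def jumpSq (hE : Fin T.numFaces → ℝ) (v : Rd d → ℝ) : ℝ :=
  ∑ e, (hE e)⁻¹ * ∫ x in T.face e, ‖T.jump e v x‖ ^ 2 ∂(surf d)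

/-- `∑_K h_K² |v|²_{2,K}`, where `h_K = diam K` and `|v|²_{2,K}` is the sum of `‖∂^α v‖²_{0,K}` over
the multi-indices `α` of order two (that is, over the pairs `k ≤ m`). -/
def h2Sq (v : Rd d → ℝ) : ℝ :=
  ∑ i, Metric.diam (T.elem i) ^ 2 * ∑ k, ∑ m ∈ Finset.univ.filter (fun m => k ≤ m),
    ∫ x in T.elem i, (weakPartial (T.elem i) m (weakPartial (T.elem i) k v) x) ^ 2

/-- The norm `‖v‖_*`. -/
def normStar (hE : Fin T.numFaces → ℝ) (v : Rd d → ℝ) : ℝ :=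
  Real.sqrt (T.h1Sq v + T.jumpSq hE v + T.h2Sq v)

end Mesh

/-! ### The local randomized neural network space -/

/-- The randomized neural network functions
`𝓜_RNN = {∑_{j<M} α_j φ(θ_j, ·) : α_j ∈ ℝ}`, where `φ(θ_j, ·)` are the outputs of the last hidden
layer with frozen hidden parameters `θ_j`; only the output weights `α_j` vary. -/
def rnnSpace {d M : ℕ} {Θ : Type*} (φ : Θ → Rd d → ℝ) (θ : Fin M → Θ) : Set (Rd d → ℝ) :=
  {U | ∃ α : Fin M → ℝ, U = fun x => ∑ j, α j * φ (θ j) x}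

namespace Mesh

variable {d : ℕ} {Ω : Set (Rd d)} (T : Mesh d Ω)

/-- `V_h`: the functions of `L²(Ω)` whose restriction to each element `K` belongs to
`𝓜_RNN(K)`. -/
def lrnnSpace {M : ℕ} {Θ : Type*} (φ : Fin T.numElems → Θ → Rd d → ℝ)
    (θ : Fin T.numElems → Fin M → Θ) : Set (Rd d → ℝ) :=
  {v | MemLp v 2 (volume.restrict Ω) ∧
    ∀ i, ∃ U ∈ rnnSpace (φ i) (θ i), v =ᵐ[volume.restrict (T.elem i)] U}

/-- `V(h) = V_h + H²(Ω)`. -/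
def sumSpace (Ω : Set (Rd d)) (V : Set (Rd d → ℝ)) : Set (Rd d → ℝ) :=
  {v | ∃ w ∈ V, ∃ z, MemH2 Ω z ∧ v = w + z}

/-- `u_h` solves the scheme: `u_h ∈ V_h` and `a_h(u_h, v_h) = l(v_h)` for all `v_h ∈ V_h`. -/
def IsDiscreteSolution (hE ηE : Fin T.numFaces → ℝ) (V : Set (Rd d → ℝ)) (f g uh : Rd d → ℝ) :
    Prop :=
  uh ∈ V ∧ ∀ v ∈ V, T.ah hE ηE uh v = T.lh hE ηE f g v

/-- `C` is a boundedness constant of `a_h` on `V(h)` for the norm `‖·‖_*`. -/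
def IsBoundednessConst (hE ηE : Fin T.numFaces → ℝ) (V : Set (Rd d → ℝ)) (C : ℝ) : Prop :=
  ∀ u ∈ sumSpace Ω V, ∀ v ∈ sumSpace Ω V,
    T.ah hE ηE u v ≤ C * T.normStar hE u * T.normStar hE v

/-- `C > 0` is a stability constant of `a_h` on `V_h` for the norm `‖·‖_*`. -/
def IsStabilityConst (hE ηE : Fin T.numFaces → ℝ) (V : Set (Rd d → ℝ)) (C : ℝ) : Prop :=
  0 < C ∧ ∀ v ∈ V, C * T.normStar hE v ^ 2 ≤ T.ah hE ηE v v

end Mesh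

end

/-! ### Surface measure on hyperplanes and radial cones -/

/-! The Céa inequality rests on consistency: `ah_eq_lh` gives $a_h(u,v)=l(v)$ for $v\in V_h$. For
$\xi=u_h-v_h$, stability, Galerkin orthogonality and boundedness yield $C_s\|\xi\|_*^2\le
a_h(\xi,\xi)=a_h(u-v_h,\xi)\le C_b\|u-v_h\|_*\|\xi\|_*$, and the triangle inequality finishes.

Consistency is Green's formula (`green`) on each element, with $-\Delta u=f$ almost everywhere. The
boundary terms assemble to averaged flux times jump, because on an interior face the traces of $u$
and $\nabla u$ from the two sides agree (`trace_eq_of_interior`); on a boundary face the jump of $u$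
is $gn$ (`trace_eq_of_boundary`).

Boundedness is Cauchy-Schwarz once the averaged flux is controlled. That control is the trace
inequality applied to $\partial_kv$, which is why the norm contains second derivatives. For
stability, the second derivatives are bounded by the first ones on the finite dimensional local
spaces: a function with vanishing gradient has vanishing Hessian, and an inclusion of kernels
suffices in finite dimension. Young's inequality then costs half of the gradient term and some
jumps, which a large penalty absorbs.

The trace theory comes from polar coordinates about an interior point $x_0$. Up to a null set the
polytope is the disjoint union of the cones over its faces, and along a ray $t^{d-1}$ times the
divergence of $\varphi(y)(y-x_0)$ is the derivative of $t^d\varphi$. This is a divergence theorem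
for radial fields. Comparing two centres gives the usual one; taking $\varphi=w^2$ gives the trace
inequality, since $\langle n_j,x-x_0\rangle$ is a positive constant on each face. Traces then exist
because smooth functions are dense in $H^1$ of an open convex set: shrink towards an interior point
and mollify.

Weak derivatives and traces are chosen representatives, hence linear only almost everywhere.
`IsL2Linear` turns them into honest linear maps to $L^2$, so that the algebra of $a_h$ is that of
inner products. -/

theorem sFinite_surf_restrict_of_subset_hyperplane {d : ℕ} (hd : 1 ≤ d) {n : Rd d} (hn : n ≠ 0)
    {c : ℝ} {e : Set (Rd d)} (he : ∀ x ∈ e, inner ℝ n x = c) :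
    SFinite ((surf d).restrict e) := by
  set p : Rd d := (c / ‖n‖ ^ 2) • n with hp
  have hpn : inner ℝ n p = c := by
    rw [hp, inner_smul_right, real_inner_self_eq_norm_sq]
    have : ‖n‖ ^ 2 ≠ 0 := by simpa using hn
    field_simp
  let f : (Submodule.span ℝ {n})ᗮ → Rd d := fun y => (y : Rd d) + p
  have hf : Isometry f := (isometry_add_right p).comp isometry_subtype_coe
  have hrank : Module.finrank ℝ (Submodule.span ℝ {n})ᗮ = d - 1 := by
    have : Fact (Module.finrank ℝ (Rd d) = (d - 1) + 1) := ⟨by simp; omega⟩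
    exact Submodule.finrank_orthogonal_span_singleton hn
  have hsub : e ⊆ range f := by
    intro x hx
    refine ⟨⟨x - p, ?_⟩, by simp [f]⟩
    rw [Submodule.mem_orthogonal_singleton_iff_inner_right, inner_sub_right, he x hx, hpn, sub_self]
  -- The surface measure of the whole space is not s-finite, so Fubini is unavailable there. On the
  -- hyperplane it is the isometric image of Lebesgue measure on the orthogonal complement of `n`.
  have hmap := hf.map_euclideanHausdorffMeasure (d := d - 1)
  rw [← hrank, InnerProductSpace.euclideanHausdorffMeasure_eq_volume, hrank] at hmap
  have : SFinite ((surf d).restrict (range f)) := by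
    rw [surf, ← hmap]; infer_instance
  rw [← Measure.restrict_restrict_of_subset hsub]
  infer_instance

/-- The open cone with vertex `x₀` over the set `e`, without its vertex. -/
def radialCone {d : ℕ} (x₀ : Rd d) (e : Set (Rd d)) : Set (Rd d) :=
  {y | ∃ t ∈ Ioo (0 : ℝ) 1, ∃ x ∈ e, y = x₀ + t • (x - x₀)}

/-- The measure on `(0, 1)` which describes the volume in the direction of the rays of a cone of
height `δ`. -/
noncomputable def rayMeasure (d : ℕ) (δ : ℝ) : Measure ℝ :=
  (volume.restrict (Ioo (0 : ℝ) 1)).withDensity fun t => ENNReal.ofReal (δ * t ^ (d - 1))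

theorem surf_preimage_homothety {d : ℕ} (x₀ : Rd d) {t : ℝ} (ht : 0 < t) (s : Set (Rd d)) :
    surf d s = ENNReal.ofReal (t ^ (d - 1)) * surf d ((fun x => x₀ + t • (x - x₀)) ⁻¹' s) := by
  have h1 : (fun x : Rd d => x₀ + t • (x - x₀)) = AffineMap.homothety x₀ t := by
    ext1 x; simp [AffineMap.homothety_apply, add_comm]
  have h2 := euclideanHausdorffMeasure_homothety_preimage (d - 1) x₀ ht.ne' s
  rw [h1, surf, h2, ENNReal.smul_def, smul_eq_mul, ← mul_assoc]
  have : ENNReal.ofReal (t ^ (d - 1)) = ((‖t‖₊ ^ (d - 1) : NNReal) : ℝ≥0∞) := by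
    rw [ENNReal.ofReal, ENNReal.coe_inj]
    ext; simp [abs_of_pos ht, ht.le]
  rw [this, ← ENNReal.coe_mul]
  have h3 : ‖t‖₊ ^ (d - 1) * ‖t‖₊⁻¹ ^ (d - 1) = 1 := by
    rw [← mul_pow, mul_inv_cancel₀ (by simpa using ht.ne'), one_pow]
  rw [h3]
  simp

theorem volume_eq_lintegral_slices {d : ℕ} (x₀ : Rd d) {n : Rd d} (hn : ‖n‖ = 1)
    {s : Set (Rd d)} (hs : MeasurableSet s) :
    volume s = ∫⁻ r : ℝ, surf d (s ∩ {y | inner ℝ n (y - x₀) = r}) := by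
  have hn0 : n ≠ 0 := by rintro rfl; simp at hn
  have h := EuclideanGeometry.euclideanHausdorffMeasure_eq_lintegral x₀ hn0 hs
  rw [InnerProductSpace.euclideanHausdorffMeasure_eq_volume] at h
  rw [h, ← ofReal_norm, hn, ENNReal.ofReal_one, one_mul]
  congr 1 with r
  rw [finrank_euclideanSpace_fin, surf]
  congr 2
  ext y
  simp only [SetLike.mem_coe, AffineSubspace.mem_mk', vsub_eq_sub, vadd_eq_add, mem_ofPred_eq,
    Submodule.mem_orthogonal_singleton_iff_inner_right]
  rw [← sub_sub, sub_right_comm, inner_sub_right, inner_smul_right, real_inner_self_eq_norm_sq, hn]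
  constructor <;> intro h <;> linarith

section cone

variable {d : ℕ} {n x₀ : Rd d} {c : ℝ} {e : Set (Rd d)}

/-- All of `e` lies at height `c`, so the ray parameter of a point is its height divided by `c`.
This makes the cone a preimage of `e`, hence measurable. -/
theorem mem_radialCone_iff (he : ∀ x ∈ e, inner ℝ n (x - x₀) = c) (hc : 0 < c) {y : Rd d} :
    y ∈ radialCone x₀ e ↔ inner ℝ n (y - x₀) / c ∈ Ioo (0 : ℝ) 1 ∧
      x₀ + (inner ℝ n (y - x₀) / c)⁻¹ • (y - x₀) ∈ e := by
  constructor
  · rintro ⟨t, ht, x, hx, rfl⟩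
    have : inner ℝ n (x₀ + t • (x - x₀) - x₀) / c = t := by
      rw [add_sub_cancel_left, inner_smul_right, he x hx]; field_simp
    rw [this]
    refine ⟨ht, ?_⟩
    rw [add_sub_cancel_left, smul_smul, inv_mul_cancel₀ ht.1.ne', one_smul, add_sub_cancel]
    exact hx
  · rintro ⟨ht, hx⟩
    refine ⟨_, ht, _, hx, ?_⟩
    rw [add_sub_cancel_left, smul_smul, mul_inv_cancel₀ ht.1.ne', one_smul, add_sub_cancel]

theorem measurableSet_radialCone (hem : MeasurableSet e)
    (he : ∀ x ∈ e, inner ℝ n (x - x₀) = c) (hc : 0 < c) : MeasurableSet (radialCone x₀ e) := by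
  have : radialCone x₀ e = {y | inner ℝ n (y - x₀) / c ∈ Ioo (0 : ℝ) 1} ∩
      {y | x₀ + (inner ℝ n (y - x₀) / c)⁻¹ • (y - x₀) ∈ e} := by
    ext y; exact mem_radialCone_iff he hc
  rw [this]
  have hm : Measurable fun y : Rd d => inner ℝ n (y - x₀) / c := by fun_prop
  refine (hm measurableSet_Ioo).inter ?_
  have hm2 : Measurable fun y : Rd d => x₀ + (inner ℝ n (y - x₀) / c)⁻¹ • (y - x₀) := by fun_prop
  exact hm2 hem

/-- Polar coordinates on a cone over a flat piece of surface. -/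
theorem volume_restrict_radialCone (hd : 1 ≤ d) (hn : ‖n‖ = 1) (hem : MeasurableSet e)
    (he : ∀ x ∈ e, inner ℝ n (x - x₀) = c) (hc : 0 < c) :
    volume.restrict (radialCone x₀ e) =
      ((rayMeasure d c).prod ((surf d).restrict e)).map fun p => x₀ + p.1 • (p.2 - x₀) := by
  have hn0 : n ≠ 0 := by rintro rfl; simp at hn
  have : SFinite ((surf d).restrict e) :=
    sFinite_surf_restrict_of_subset_hyperplane hd hn0 (c := c + inner ℝ n x₀) fun x hx => by
      rw [← he x hx, inner_sub_right]; ring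
  have hm : Measurable fun p : ℝ × Rd d => x₀ + p.1 • (p.2 - x₀) := by fun_prop
  have : SFinite (rayMeasure d c) := by unfold rayMeasure; infer_instance
  ext B hB
  rw [Measure.map_apply hm hB, Measure.prod_apply (hm hB), rayMeasure,
    lintegral_withDensity_eq_lintegral_mul₀ (by fun_prop)
      (measurable_measure_prodMk_left (hm hB)).aemeasurable,
    Measure.restrict_apply hB, volume_eq_lintegral_slices x₀ hn
      (hB.inter (measurableSet_radialCone hem he hc))]
  -- The slice at height `r` is the homothetic image of a part of `e` with ratio `r / c`; scaling
  -- produces the power `d - 1`. The substitution `r = c t` later supplies the factor `c` in the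
  -- density of `rayMeasure`.
  have key : ∀ r : ℝ, surf d (B ∩ radialCone x₀ e ∩ {y | inner ℝ n (y - x₀) = r}) =
      (Ioo (0 : ℝ) 1).indicator (fun t => ENNReal.ofReal (t ^ (d - 1)) *
        surf d ({x | x₀ + t • (x - x₀) ∈ B} ∩ e)) (c⁻¹ * r) := by
    intro r
    by_cases hr : c⁻¹ * r ∈ Ioo (0 : ℝ) 1
    · rw [indicator_of_mem hr, surf_preimage_homothety x₀ hr.1]
      congr 2
      ext x
      have e1 : ∀ z : Rd d, inner ℝ n (x₀ + (c⁻¹ * r) • (x - x₀) - x₀) =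
        (c⁻¹ * r) * inner ℝ n (x - x₀) := by
          intro z; rw [add_sub_cancel_left, inner_smul_right]
      simp only [mem_preimage, mem_inter_iff, mem_ofPred_eq, mem_radialCone_iff he hc, e1 0]
      have hr0 := hr.1.ne'
      constructor
      · rintro ⟨⟨h1, h2, h3⟩, h4⟩
        refine ⟨h1, ?_⟩
        rw [h4, add_sub_cancel_left, smul_smul, div_eq_inv_mul, inv_mul_cancel₀ hr0, one_smul,
          add_sub_cancel] at h3
        exact h3
      · rintro ⟨h1, h2⟩
        have h4 : c⁻¹ * r * inner ℝ n (x - x₀) = r := by rw [he x h2]; field_simp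
        refine ⟨⟨h1, ?_, ?_⟩, h4⟩
        · rw [h4, div_eq_inv_mul]; exact hr
        · rw [h4, add_sub_cancel_left, smul_smul, div_eq_inv_mul, inv_mul_cancel₀ hr0, one_smul,
            add_sub_cancel]
          exact h2
    · rw [indicator_of_notMem hr]
      convert measure_empty (μ := surf d)
      rw [eq_empty_iff_forall_notMem]
      rintro y ⟨⟨-, h1⟩, h2⟩
      rw [mem_radialCone_iff he hc, h2, div_eq_inv_mul] at h1
      exact hr h1.1
  simp_rw [key]
  have hmeas : Measurable fun t : ℝ => surf d ({x | x₀ + t • (x - x₀) ∈ B} ∩ e) := by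
    have := measurable_measure_prodMk_left (ν := (surf d).restrict e) (hm hB)
    convert this using 2 with t
    rw [Measure.restrict_apply]
    · rfl
    · exact (hm.comp measurable_prodMk_left) hB
  rw [← setLIntegral_congr_fun (f := fun t : ℝ => ENNReal.ofReal c * (ENNReal.ofReal (t ^ (d - 1)) *
        surf d ({x | x₀ + t • (x - x₀) ∈ B} ∩ e))) measurableSet_Ioo]
  · rw [lintegral_const_mul _ (by fun_prop), ← lintegral_indicator measurableSet_Ioo]
    set G := (Ioo (0 : ℝ) 1).indicator (fun t => ENNReal.ofReal (t ^ (d - 1)) *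
        surf d ({x | x₀ + t • (x - x₀) ∈ B} ∩ e))
    have hG : Measurable G := (by fun_prop : Measurable _).indicator measurableSet_Ioo
    have := Real.map_volume_mul_left (a := c⁻¹) (inv_pos.2 hc).ne'
    rw [← lintegral_map (f := G) (g := fun r => c⁻¹ * r) hG (by fun_prop), this,
      lintegral_smul_measure, inv_inv, abs_of_pos hc, smul_eq_mul]
  · intro t ht
    simp only [Pi.mul_apply]
    rw [ENNReal.ofReal_mul hc.le, mul_assoc]
    congr 2
    rw [Measure.restrict_apply]
    · rfl
    · exact (hm.comp measurable_prodMk_left) hB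

end cone

/-! ### Convex polytopes with flat faces, and the divergence theorem -/

/-- `K` is a bounded open convex set whose boundary lies in finitely many hyperplanes and is filled,
up to a null set, by the pairwise disjoint faces `e j` with outward unit normals `n j`. -/
structure IsFaceted {d : ℕ} {ι : Type*} (K : Set (Rd d)) (e : ι → Set (Rd d))
    (n : ι → Rd d) : Prop where
  isOpen : IsOpen K
  convex : Convex ℝ K
  isBounded : Bornology.IsBounded K
  nonempty : K.Nonempty
  flat : ∃ (m : ℕ) (a : Fin m → Rd d) (b : Fin m → ℝ), (∀ k, ∀ y ∈ K, inner ℝ (a k) y < b k) ∧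
    ∀ x ∈ frontier K, ∃ k, inner ℝ (a k) x = b k
  face_measurable : ∀ j, MeasurableSet (e j)
  face_disjoint : Pairwise fun i j => Disjoint (e i) (e j)
  face_subset : ∀ j, e j ⊆ frontier K
  normal_unit : ∀ j, ‖n j‖ = 1
  normal_outward : ∀ j, ∀ x ∈ e j, ∀ y ∈ K, inner ℝ (n j) (y - x) ≤ 0
  face_cover : surf d (frontier K \ ⋃ j, e j) = 0

/-- A nonconstant linear functional has no maximum on an open set: a small step in the direction `n`
increases it. -/
theorem IsOpen.inner_lt_of_forall_le {d : ℕ} {K : Set (Rd d)} (hK : IsOpen K) {n : Rd d}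
    (hn : n ≠ 0) {c : ℝ} (h : ∀ y ∈ K, inner ℝ n y ≤ c) {y : Rd d} (hy : y ∈ K) :
    inner ℝ n y < c := by
  have hcont : Tendsto (fun t : ℝ => y + t • n) (𝓝[>] 0) (𝓝 y) := by
    have : Continuous fun t : ℝ => y + t • n := by fun_prop
    have h := this.tendsto 0
    simp only [zero_smul, add_zero] at h
    exact h.mono_left nhdsWithin_le_nhds
  obtain ⟨t, ht, htpos⟩ := ((hcont.eventually (hK.mem_nhds hy)).and self_mem_nhdsWithin).exists
  have h1 := h _ ht
  rw [inner_add_right, inner_smul_right, real_inner_self_eq_norm_sq] at h1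
  have : 0 < t * ‖n‖ ^ 2 := mul_pos htpos (by positivity)
  linarith

theorem IsOpen.convex_radial_mem {d : ℕ} {K : Set (Rd d)} (hK : IsOpen K) (hc : Convex ℝ K)
    {x₀ x : Rd d} (h₀ : x₀ ∈ K) (hx : x ∈ closure K) {t : ℝ} (ht : t ∈ Ioo (0 : ℝ) 1) :
    x₀ + t • (x - x₀) ∈ K := by
  have h := hc.combo_interior_closure_mem_interior (a := 1 - t) (b := t)
    (by rwa [hK.interior_eq] : x₀ ∈ interior K) hx (by linarith [ht.2]) ht.1.le (by ring)
  rw [hK.interior_eq] at h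
  convert h using 1
  rw [smul_sub, sub_smul, one_smul]; abel

/-- Every point of a bounded open set, except the vertex, lies in the cone over the boundary. -/
theorem exists_frontier_radial {d : ℕ} {K : Set (Rd d)} (hK : IsOpen K)
    (hb : Bornology.IsBounded K) {x₀ y : Rd d} (hy : y ∈ K) (hne : y ≠ x₀) :
    ∃ t ∈ Ioo (0 : ℝ) 1, ∃ x ∈ frontier K, y = x₀ + t • (x - x₀) := by
  let γ : ℝ → Rd d := fun s => x₀ + s • (y - x₀)
  have hγ : Continuous γ := by fun_prop
  -- The ray beyond `y` is connected, starts in `K` and leaves it by boundedness, so it meets the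
  -- frontier.
  have hpre : IsPreconnected (γ '' Ici 1) := isPreconnected_Ici.image _ hγ.continuousOn
  have hout : ∃ s ∈ Ici (1 : ℝ), γ s ∉ K := by
    obtain ⟨R, hR⟩ := hb.subset_closedBall x₀
    have hpos : 0 < ‖y - x₀‖ := norm_pos_iff.2 (sub_ne_zero.2 hne)
    refine ⟨max 1 ((|R| + 1) / ‖y - x₀‖), mem_Ici.2 (le_max_left _ _), fun h => ?_⟩
    have h1 := hR h
    rw [Metric.mem_closedBall, dist_eq_norm] at h1
    simp only [γ, add_sub_cancel_left, norm_smul, Real.norm_eq_abs] at h1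
    have h2 : (|R| + 1) / ‖y - x₀‖ ≤ |max 1 ((|R| + 1) / ‖y - x₀‖)| :=
      (le_max_right _ _).trans (le_abs_self _)
    have h3 : |R| + 1 ≤ |max 1 ((|R| + 1) / ‖y - x₀‖)| * ‖y - x₀‖ := by
      rwa [div_le_iff₀ hpos] at h2
    linarith [le_abs_self R]
  obtain ⟨s, hs, hsK⟩ := hout
  obtain ⟨_, ⟨r, hr, rfl⟩, hfr⟩ : (γ '' Ici 1 ∩ frontier K).Nonempty := by
    by_contra hemp
    have h1 : γ '' Ici 1 ⊆ K := by
      refine hpre.subset_left_of_subset_union hK isClosed_closure.isOpen_compl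
        (v := (closure K)ᶜ) ?_ ?_ ⟨γ 1, mem_image_of_mem _ (mem_Ici.2 le_rfl), by simpa [γ] using hy⟩
      · exact disjoint_compl_right.mono_left subset_closure
      · intro z hz
        by_contra hzn
        simp only [mem_union, mem_compl_iff, not_or, not_not] at hzn
        exact hemp ⟨z, hz, by rw [hK.frontier_eq]; exact ⟨hzn.2, hzn.1⟩⟩
    exact hsK (h1 (mem_image_of_mem _ hs))
  have hr1 : 1 < r := by
    refine lt_of_le_of_ne hr ?_
    rintro rfl
    rw [hK.frontier_eq] at hfr
    exact hfr.2 (by simpa [γ] using hy)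
  refine ⟨r⁻¹, ⟨by positivity, inv_lt_one_of_one_lt₀ hr1⟩, _, hfr, ?_⟩
  simp only [γ, add_sub_cancel_left, smul_smul]
  rw [inv_mul_cancel₀ (by positivity), one_smul, add_sub_cancel]

/-- A ray from an interior point of a convex set meets the boundary at most once, because every
point strictly before a boundary point is interior. Points of disjoint boundary pieces therefore lie
on different rays. -/
theorem radialCone_frontier_disjoint {d : ℕ} {K e e' : Set (Rd d)} (hK : IsOpen K)
    (hc : Convex ℝ K) {x₀ : Rd d} (h₀ : x₀ ∈ K) (he : e ⊆ frontier K) (he' : e' ⊆ frontier K)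
    (h : Disjoint e e') : Disjoint (radialCone x₀ e) (radialCone x₀ e') := by
  rw [disjoint_left]
  rintro y ⟨t, ht, x, hx, rfl⟩ ⟨t', ht', x', hx', heq⟩
  have key : ∀ {t t' : ℝ} {x x' : Rd d}, t ∈ Ioo (0 : ℝ) 1 → t' ∈ Ioo (0 : ℝ) 1 →
      x ∈ frontier K → x' ∈ frontier K → x₀ + t • (x - x₀) = x₀ + t' • (x' - x₀) → t < t' →
      False := by
    intro t t' x x' ht ht' hx hx' heq hlt
    have h1 : x' = x₀ + (t'⁻¹ * t) • (x - x₀) := by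
      rw [mul_smul, add_left_cancel heq, smul_smul, inv_mul_cancel₀ ht'.1.ne', one_smul,
        add_sub_cancel]
    have h2 : t'⁻¹ * t ∈ Ioo (0 : ℝ) 1 := by
      refine ⟨mul_pos (inv_pos.2 ht'.1) ht.1, ?_⟩
      rw [inv_mul_eq_div, div_lt_one ht'.1]; exact hlt
    have h3 := hK.convex_radial_mem hc h₀ (frontier_subset_closure hx) h2
    rw [← h1] at h3
    rw [hK.frontier_eq] at hx'
    exact hx'.2 h3
  rcases lt_trichotomy t t' with h1 | rfl | h1
  · exact key ht ht' (he hx) (he' hx') heq h1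
  · have : x = x' := by
      have := smul_right_injective _ ht.1.ne' (add_left_cancel heq)
      exact sub_left_injective this
    exact disjoint_left.1 h hx (this ▸ hx')
  · exact key ht' ht (he' hx') (he hx) heq.symm h1

/-! ### Decomposition of a polytope into cones over its faces. -/

namespace IsFaceted

variable {d : ℕ} {ι : Type*} {K : Set (Rd d)} {e : ι → Set (Rd d)} {n : ι → Rd d}

theorem normal_ne_zero (h : IsFaceted K e n) (j : ι) : n j ≠ 0 := by
  intro h0; have := h.normal_unit j; simp [h0] at this

/-- The support number of the face `e j`. -/
theorem exists_support (h : IsFaceted K e n) (j : ι) :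
    ∃ s : ℝ, (∀ x ∈ e j, inner ℝ (n j) x = s) ∧ ∀ y ∈ K, inner ℝ (n j) y < s := by
  -- Empty faces do occur: for an element of a mesh the index runs over all faces of the mesh. Then
  -- only the strict upper bound matters, and any number above the radius of `K` serves.
  rcases (e j).eq_empty_or_nonempty with he | ⟨x₁, hx₁⟩
  · obtain ⟨R, hR⟩ := h.isBounded.exists_norm_le
    refine ⟨R + 1, by simp [he], fun y hy => ?_⟩
    have := real_inner_le_norm (n j) y
    rw [h.normal_unit, one_mul] at this
    linarith [hR y hy]
  · have hle : ∀ x ∈ e j, ∀ y ∈ closure K, inner ℝ (n j) y ≤ inner ℝ (n j) x := by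
      intro x hx y hy
      have hcl : IsClosed {y : Rd d | inner ℝ (n j) y ≤ inner ℝ (n j) x} :=
        isClosed_le (by fun_prop) (by fun_prop)
      refine closure_minimal (fun y hy => ?_) hcl hy
      have := h.normal_outward j x hx y hy
      rw [inner_sub_right] at this
      simpa using this
    refine ⟨inner ℝ (n j) x₁, fun x hx => le_antisymm ?_ ?_, fun y hy => ?_⟩
    · exact hle _ hx₁ _ (frontier_subset_closure (h.face_subset j hx))
    · exact hle _ hx _ (frontier_subset_closure (h.face_subset j hx₁))
    · exact h.isOpen.inner_lt_of_forall_le (h.normal_ne_zero j)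
        (fun y hy => hle _ hx₁ _ (subset_closure hy)) hy

/-- Polar coordinates need a flat base, and the uncovered part of the boundary need not lie in one
hyperplane. It is cut along the finitely many hyperplanes of `flat`; over each null piece the
product measure vanishes. -/
theorem volume_radialCone_compl (h : IsFaceted K e n) (hd : 1 ≤ d) [Countable ι] {x₀ : Rd d}
    (h₀ : x₀ ∈ K) : volume (radialCone x₀ (frontier K \ ⋃ j, e j)) = 0 := by
  obtain ⟨m, a, b, hab, hfr⟩ := h.flat
  set N := frontier K \ ⋃ j, e j with hN
  have hNm : MeasurableSet N :=
    isClosed_frontier.measurableSet.diff (MeasurableSet.iUnion h.face_measurable)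
  have hsub : radialCone x₀ N ⊆ ⋃ k, radialCone x₀ (N ∩ {x | inner ℝ (a k) x = b k}) := by
    rintro y ⟨t, ht, x, hx, rfl⟩
    obtain ⟨k, hk⟩ := hfr x hx.1
    exact mem_iUnion.2 ⟨k, t, ht, x, ⟨hx, hk⟩, rfl⟩
  refine measure_mono_null hsub (measure_iUnion_null fun k => ?_)
  -- A zero normal describes no hyperplane; its piece is empty, since the strict inequality at `x₀`
  -- gives `0 < b k`.
  by_cases hak : a k = 0
  · have hb : 0 < b k := by simpa [hak] using hab k _ h₀
    have : N ∩ {x | inner ℝ (a k) x = b k} = ∅ := by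
      ext x; simp [hak, hb.ne]
    rw [this]
    simp [radialCone]
  have hpos : 0 < ‖a k‖ := norm_pos_iff.2 hak
  have hm : MeasurableSet (N ∩ {x | inner ℝ (a k) x = b k}) :=
    hNm.inter (measurableSet_eq_fun (by fun_prop) (by fun_prop))
  have hcone := volume_restrict_radialCone (x₀ := x₀) (n := ‖a k‖⁻¹ • a k)
    (c := ‖a k‖⁻¹ * (b k - inner ℝ (a k) x₀)) hd
    (by rw [norm_smul, norm_inv, norm_norm, inv_mul_cancel₀ hpos.ne']) hm
    (fun x hx => by
      have : inner ℝ (a k) x = b k := hx.2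
      rw [real_inner_smul_left, inner_sub_right, this])
    (mul_pos (inv_pos.2 hpos) (sub_pos.2 (hab k _ h₀)))
  have h0 : (surf d).restrict (N ∩ {x | inner ℝ (a k) x = b k}) = 0 :=
    Measure.restrict_eq_zero.2 (measure_mono_null inter_subset_left h.face_cover)
  rw [h0, Measure.prod_zero, Measure.map_zero, Measure.restrict_eq_zero] at hcone
  exact hcone

/-- The cones are disjoint and contained in `K`. What they miss is the vertex, a null set since `d ≥
1`, and the cone over the part of the boundary outside the faces. -/
theorem volume_restrict_eq_sum [Fintype ι] (h : IsFaceted K e n) (hd : 1 ≤ d) {x₀ : Rd d}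
    (h₀ : x₀ ∈ K) : volume.restrict K = ∑ j, volume.restrict (radialCone x₀ (e j)) := by
  have : Nonempty (Fin d) := ⟨⟨0, hd⟩⟩
  choose s hs hsK using h.exists_support
  have hmeas : ∀ j, MeasurableSet (radialCone x₀ (e j)) := fun j =>
    measurableSet_radialCone (n := n j) (c := s j - inner ℝ (n j) x₀) (h.face_measurable j)
      (fun x hx => by rw [inner_sub_right, hs j x hx]) (sub_pos.2 (hsK j _ h₀))
  have hdisj : Pairwise (Function.onFun Disjoint fun j => radialCone x₀ (e j)) := fun i j hij =>
    radialCone_frontier_disjoint h.isOpen h.convex h₀ (h.face_subset i) (h.face_subset j)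
      (h.face_disjoint hij)
  have hsub : (⋃ j, radialCone x₀ (e j)) ⊆ K := by
    refine iUnion_subset fun j => ?_
    rintro y ⟨t, ht, x, hx, rfl⟩
    exact h.isOpen.convex_radial_mem h.convex h₀ (frontier_subset_closure (h.face_subset j hx)) ht
  have hnull : volume (K \ ⋃ j, radialCone x₀ (e j)) = 0 := by
    refine measure_mono_null (t := {x₀} ∪ radialCone x₀ (frontier K \ ⋃ j, e j)) ?_
      (measure_union_null (measure_singleton _) (h.volume_radialCone_compl hd h₀))
    rintro y ⟨hy, hyn⟩
    by_cases hyx : y = x₀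
    · exact Or.inl hyx
    right
    obtain ⟨t, ht, x, hx, rfl⟩ := exists_frontier_radial h.isOpen h.isBounded hy hyx
    refine ⟨t, ht, x, ⟨hx, fun hxe => ?_⟩, rfl⟩
    obtain ⟨j, hj⟩ := mem_iUnion.1 hxe
    exact hyn (mem_iUnion.2 ⟨j, t, ht, x, hj, rfl⟩)
  have hae : (⋃ j, radialCone x₀ (e j)) =ᵐ[volume] K :=
    (LE.le.eventuallyLE hsub).antisymm (ae_le_set.2 hnull)
  rw [← Measure.restrict_congr_set hae, Measure.restrict_iUnion hdisj hmeas, Measure.sum_fintype]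

theorem surf_restrict_frontier [Fintype ι] (h : IsFaceted K e n) :
    (surf d).restrict (frontier K) = ∑ j, (surf d).restrict (e j) := by
  have hae : (⋃ j, e j) =ᵐ[surf d] frontier K :=
    (LE.le.eventuallyLE (iUnion_subset h.face_subset)).antisymm
      (ae_le_set.2 h.face_cover)
  rw [← Measure.restrict_congr_set hae, Measure.restrict_iUnion h.face_disjoint h.face_measurable,
    Measure.sum_fintype]

/-- The cone over the face has finite volume, being inside a bounded set, and this volume is the
area of the face times a positive constant. -/
theorem surf_face_lt_top [Fintype ι] (h : IsFaceted K e n) (hd : 1 ≤ d) (j : ι) :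
    surf d (e j) < ⊤ := by
  obtain ⟨x₀, h₀⟩ := h.nonempty
  obtain ⟨s, hs, hsK⟩ := h.exists_support j
  have hc : 0 < s - inner ℝ (n j) x₀ := sub_pos.2 (hsK _ h₀)
  have hcone := volume_restrict_radialCone (x₀ := x₀) (c := s - inner ℝ (n j) x₀) hd
    (h.normal_unit j) (h.face_measurable j) (fun x hx => by rw [inner_sub_right, hs x hx]) hc
  have : SFinite ((surf d).restrict (e j)) :=
    sFinite_surf_restrict_of_subset_hyperplane hd (h.normal_ne_zero j) hs
  have h1 : volume (radialCone x₀ (e j)) =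
      rayMeasure d (s - inner ℝ (n j) x₀) univ * surf d (e j) := by
    rw [← Measure.restrict_apply_univ (μ := volume), hcone,
      Measure.map_apply (by fun_prop) MeasurableSet.univ, preimage_univ, ← univ_prod_univ,
      Measure.prod_prod, Measure.restrict_apply_univ]
  have h2 : volume (radialCone x₀ (e j)) < ⊤ := by
    refine lt_of_le_of_lt (measure_mono ?_) h.isBounded.measure_lt_top
    rintro y ⟨t, ht, x, hx, rfl⟩
    exact h.isOpen.convex_radial_mem h.convex h₀ (frontier_subset_closure (h.face_subset j hx)) ht
  have h3 : rayMeasure d (s - inner ℝ (n j) x₀) univ ≠ 0 := by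
    rw [rayMeasure, withDensity_apply _ MeasurableSet.univ, Measure.restrict_univ]
    have := (setLIntegral_pos_iff (μ := volume) (s := Ioo (0 : ℝ) 1)
      (f := fun t => ENNReal.ofReal ((s - inner ℝ (n j) x₀) * t ^ (d - 1))) (by fun_prop)).2 ?_
    · exact this.ne'
    · have : Ioo (0 : ℝ) 1 ⊆ Function.support (fun t : ℝ =>
          ENNReal.ofReal ((s - inner ℝ (n j) x₀) * t ^ (d - 1))) ∩ Ioo 0 1 := by
        intro t ht
        refine ⟨?_, ht⟩
        rw [Function.mem_support]
        exact (ENNReal.ofReal_pos.2 (mul_pos hc (pow_pos ht.1 _))).ne'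
      exact lt_of_lt_of_le (by simp) (measure_mono this)
  rw [h1] at h2
  by_contra htop
  rw [not_lt, top_le_iff] at htop
  rw [htop, ENNReal.mul_top h3] at h2
  exact lt_irrefl _ h2

theorem surf_frontier_lt_top [Fintype ι] (h : IsFaceted K e n) (hd : 1 ≤ d) :
    surf d (frontier K) < ⊤ := by
  rw [← Measure.restrict_apply_univ, h.surf_restrict_frontier, Measure.finsetSum_apply]
  exact ENNReal.sum_lt_top.2 fun j _ => by
    rw [Measure.restrict_apply_univ]; exact h.surf_face_lt_top hd j

end IsFaceted

/-! ### The divergence theorem, first for radial fields. -/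

theorem integral_radialCone {d : ℕ} {n x₀ : Rd d} {c : ℝ} {e : Set (Rd d)} (hd : 1 ≤ d)
    (hn : ‖n‖ = 1) (hem : MeasurableSet e) (he : ∀ x ∈ e, inner ℝ n (x - x₀) = c) (hc : 0 < c)
    {g : Rd d → ℝ} (hg : IntegrableOn g (radialCone x₀ e)) :
    ∫ y in radialCone x₀ e, g y =
      ∫ x in e, (∫ t in Ioo (0 : ℝ) 1, c * t ^ (d - 1) * g (x₀ + t • (x - x₀))) ∂(surf d) := by
  have hn0 : n ≠ 0 := by rintro rfl; simp at hn
  have : SFinite ((surf d).restrict e) :=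
    sFinite_surf_restrict_of_subset_hyperplane hd hn0 (c := c + inner ℝ n x₀) fun x hx => by
      rw [← he x hx, inner_sub_right]; ring
  have : SFinite (rayMeasure d c) := by unfold rayMeasure; infer_instance
  have hm : Measurable fun p : ℝ × Rd d => x₀ + p.1 • (p.2 - x₀) := by fun_prop
  rw [IntegrableOn, volume_restrict_radialCone hd hn hem he hc] at hg
  rw [volume_restrict_radialCone hd hn hem he hc, integral_map hm.aemeasurable hg.1,
    integral_prod_symm (fun p : ℝ × Rd d => g (x₀ + p.1 • (p.2 - x₀))) (hg.comp_measurable hm)]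
  congr 1 with x
  rw [rayMeasure, integral_withDensity_eq_integral_toReal_smul (by fun_prop) (by simp)]
  refine setIntegral_congr_fun measurableSet_Ioo fun t ht => ?_
  have : 0 ≤ c * t ^ (d - 1) := mul_nonneg hc.le (pow_nonneg ht.1.le _)
  simp only [ENNReal.toReal_ofReal this, smul_eq_mul]

/-- The integrand is the derivative of $c\,t^d\varphi(x_0+t(x-x_0))$, and the value at `t = 0`
vanishes because `d ≥ 1`. -/
theorem integral_ray_divergence {d : ℕ} (hd : 1 ≤ d) {φ : Rd d → ℝ} (hφ : ContDiff ℝ 1 φ)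
    (x₀ x : Rd d) (c : ℝ) :
    ∫ t in Ioo (0 : ℝ) 1, c * t ^ (d - 1) * (d * φ (x₀ + t • (x - x₀)) +
      fderiv ℝ φ (x₀ + t • (x - x₀)) (x₀ + t • (x - x₀) - x₀)) = c * φ x := by
  have hφ' : Continuous (fderiv ℝ φ) := hφ.continuous_fderiv one_ne_zero
  have hder : ∀ t : ℝ, HasDerivAt (fun t : ℝ => c * (t ^ d * φ (x₀ + t • (x - x₀))))
      (c * t ^ (d - 1) * (d * φ (x₀ + t • (x - x₀)) +
        fderiv ℝ φ (x₀ + t • (x - x₀)) (x₀ + t • (x - x₀) - x₀))) t := by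
    intro t
    have h1 : HasDerivAt (fun t : ℝ => x₀ + t • (x - x₀)) (x - x₀) t := by
      simpa using ((hasDerivAt_id t).smul_const (x - x₀)).const_add x₀
    have h2 := ((hφ.differentiable one_ne_zero) (x₀ + t • (x - x₀))).hasFDerivAt.comp_hasDerivAt t h1
    have h3 := ((hasDerivAt_pow d t).mul h2).const_mul c
    refine HasDerivAt.congr_deriv h3 ?_
    obtain ⟨k, rfl⟩ : ∃ k, d = k + 1 := ⟨d - 1, by omega⟩
    simp only [add_tsub_cancel_right, add_sub_cancel_left, map_smul, smul_eq_mul, pow_succ,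
      Function.comp]
    ring
  rw [← integral_Ioc_eq_integral_Ioo, ← intervalIntegral.integral_of_le zero_le_one,
    intervalIntegral.integral_eq_sub_of_hasDerivAt (fun t _ => hder t)]
  · have : d ≠ 0 := by omega
    simp [this]
  · refine Continuous.intervalIntegrable ?_ _ _
    have hγ : Continuous fun t : ℝ => x₀ + t • (x - x₀) := by fun_prop
    have h1 : Continuous fun t : ℝ => φ (x₀ + t • (x - x₀)) := hφ.continuous.comp hγ
    have h2 : Continuous fun t : ℝ => fderiv ℝ φ (x₀ + t • (x - x₀)) := hφ'.comp hγ
    fun_prop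

theorem Continuous.integrableOn_of_isBounded {d : ℕ} {g : Rd d → ℝ} (hg : Continuous g)
    {s : Set (Rd d)} (hs : Bornology.IsBounded s) {μ : Measure (Rd d)} (hμ : μ s < ⊤) :
    IntegrableOn g s μ := by
  obtain ⟨C, hC⟩ := (hs.isCompact_closure.image hg).isBounded.exists_norm_le
  refine Measure.integrableOn_of_bounded (M := C) hμ.ne hg.aestronglyMeasurable ?_
  have : ∀ᵐ x ∂(μ.restrict s), x ∈ closure s := by
    rw [ae_iff]
    have h0 := Measure.restrict_apply (μ := μ) (s := s) (t := (closure s)ᶜ)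
      isClosed_closure.measurableSet.compl
    change (μ.restrict s) (closure s)ᶜ = 0
    rw [h0]
    convert measure_empty (μ := μ)
    ext x
    simp only [mem_inter_iff, mem_compl_iff, mem_empty_iff_false, iff_false, not_and]
    exact fun h hx => h (subset_closure hx)
  filter_upwards [this] with x hx
  exact hC _ (mem_image_of_mem g hx)

namespace IsFaceted

variable {d : ℕ} {ι : Type*} [Fintype ι] {K : Set (Rd d)} {e : ι → Set (Rd d)} {n : ι → Rd d}

theorem integrableOn_face (h : IsFaceted K e n) (hd : 1 ≤ d) (j : ι) {g : Rd d → ℝ}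
    (hg : Continuous g) : IntegrableOn g (e j) (surf d) := by
  refine hg.integrableOn_of_isBounded ?_ (h.surf_face_lt_top hd j)
  exact (h.isBounded.closure.subset frontier_subset_closure).subset (h.face_subset j)

omit [Fintype ι] in
theorem integrableOn_of_continuous (h : IsFaceted K e n) {g : Rd d → ℝ}
    (hg : Continuous g) : IntegrableOn g K :=
  hg.integrableOn_of_isBounded h.isBounded h.isBounded.measure_lt_top

/-- The integrand is the divergence of $\varphi(y)(y-x_0)$. On each cone it is integrated along the
rays, so the lateral sides of the cones never appear and only the base contributes. The weight on
the base is the distance from `x₀` to the plane of the face. -/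
theorem radial_divergence (h : IsFaceted K e n) (hd : 1 ≤ d) {φ : Rd d → ℝ}
    (hφ : ContDiff ℝ 1 φ) {x₀ : Rd d} (h₀ : x₀ ∈ K) :
    ∫ y in K, (d * φ y + fderiv ℝ φ y (y - x₀)) =
      ∑ j, ∫ x in e j, inner ℝ (n j) (x - x₀) * φ x ∂(surf d) := by
  have hφ' : Continuous (fderiv ℝ φ) := hφ.continuous_fderiv one_ne_zero
  have hg : Continuous fun y => (d * φ y + fderiv ℝ φ y (y - x₀)) := by
    have := hφ.continuous
    fun_prop
  have hsub : ∀ j, radialCone x₀ (e j) ⊆ K := by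
    rintro j y ⟨t, ht, x, hx, rfl⟩
    exact h.isOpen.convex_radial_mem h.convex h₀ (frontier_subset_closure (h.face_subset j hx)) ht
  rw [h.volume_restrict_eq_sum hd h₀, integral_finsetSum_measure fun j _ =>
    ((h.integrableOn_of_continuous hg).mono_set (hsub j))]
  refine Finset.sum_congr rfl fun j _ => ?_
  obtain ⟨s, hs, hsK⟩ := h.exists_support j
  rw [integral_radialCone hd (h.normal_unit j) (c := s - inner ℝ (n j) x₀) (h.face_measurable j)
    (fun x hx => by rw [inner_sub_right, hs x hx]) (sub_pos.2 (hsK _ h₀))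
    ((h.integrableOn_of_continuous hg).mono_set (hsub j))]
  refine setIntegral_congr_fun (h.face_measurable j) fun x hx => ?_
  rw [integral_ray_divergence hd hφ, inner_sub_right, hs x hx]

/-- The divergence theorem on a polytope. -/
theorem divergence (h : IsFaceted K e n) (hd : 1 ≤ d) {φ : Rd d → ℝ}
    (hφ : ContDiff ℝ 1 φ) (v : Rd d) :
    ∫ y in K, fderiv ℝ φ y v = ∑ j, inner ℝ (n j) v * ∫ x in e j, φ x ∂(surf d) := by
  have hφ' : Continuous (fderiv ℝ φ) := hφ.continuous_fderiv one_ne_zero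
  have hφc := hφ.continuous
  obtain ⟨x₀, h₀⟩ := h.nonempty
  -- The radial fields about the two centres `x₀` and `x₀ + t • v` differ by the field `t φ v` of
  -- constant direction. Subtracting the two radial formulas and dividing by `t` gives the claim.
  obtain ⟨t, ht, htK⟩ : ∃ t : ℝ, 0 < t ∧ x₀ + t • v ∈ K := by
    have hcont : Tendsto (fun t : ℝ => x₀ + t • v) (𝓝[>] 0) (𝓝 x₀) := by
      have : Continuous fun t : ℝ => x₀ + t • v := by fun_prop
      have h := this.tendsto 0
      simp only [zero_smul, add_zero] at h
      exact h.mono_left nhdsWithin_le_nhds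
    obtain ⟨t, ht, htpos⟩ :=
      ((hcont.eventually (h.isOpen.mem_nhds h₀)).and self_mem_nhdsWithin).exists
    exact ⟨t, htpos, ht⟩
  have h1 := h.radial_divergence hd hφ h₀
  have h2 := h.radial_divergence hd hφ htK
  have hi : ∀ z : Rd d, IntegrableOn (fun y => d * φ y + fderiv ℝ φ y (y - z)) K := fun z =>
    h.integrableOn_of_continuous (by fun_prop)
  have h3 := integral_sub (hi x₀) (hi (x₀ + t • v))
  rw [h1, h2, ← Finset.sum_sub_distrib] at h3
  have hL : ∀ y, (d * φ y + fderiv ℝ φ y (y - x₀)) - (d * φ y + fderiv ℝ φ y (y - (x₀ + t • v))) =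
      t * fderiv ℝ φ y v := by
    intro y
    rw [← sub_sub y, map_sub (fderiv ℝ φ y) (y - x₀), map_smul, smul_eq_mul]; ring
  simp_rw [hL] at h3
  rw [integral_const_mul] at h3
  have hR : ∀ j, (∫ x in e j, inner ℝ (n j) (x - x₀) * φ x ∂(surf d)) -
      ∫ x in e j, inner ℝ (n j) (x - (x₀ + t • v)) * φ x ∂(surf d) =
      t * (inner ℝ (n j) v * ∫ x in e j, φ x ∂(surf d)) := by
    intro j
    rw [← integral_sub (h.integrableOn_face hd j (by fun_prop))
      (h.integrableOn_face hd j (by fun_prop)), ← integral_const_mul, ← integral_const_mul]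
    congr 1 with x
    rw [← sub_sub x, inner_sub_right (n j) (x - x₀), inner_smul_right]
    ring
  simp_rw [hR] at h3
  rw [← Finset.mul_sum] at h3
  exact mul_left_cancel₀ ht.ne' h3

end IsFaceted

/-! ### Square integrable functions -/

section L2

variable {α : Type*} [MeasurableSpace α] {μ : Measure α}

theorem eLpNorm_two_sq {f : α → ℝ} (hf : MemLp f 2 μ) :
    eLpNorm f 2 μ ^ 2 = ENNReal.ofReal (∫ x, f x ^ 2 ∂μ) := by
  have h0 : 0 ≤ ∫ x, f x ^ 2 ∂μ := integral_nonneg fun x => sq_nonneg _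
  rw [hf.eLpNorm_eq_integral_rpow_norm two_ne_zero ENNReal.ofNat_ne_top,
    ← ENNReal.ofReal_pow (by positivity)]
  congr 1
  simp only [ENNReal.toReal_ofNat, Real.rpow_ofNat, Real.norm_eq_abs, sq_abs]
  rw [← Real.rpow_natCast, ← Real.rpow_mul h0]
  norm_num

theorem integral_mul_eq_inner_toLp {f g : α → ℝ} (hf : MemLp f 2 μ) (hg : MemLp g 2 μ) :
    ∫ x, f x * g x ∂μ = inner ℝ (hg.toLp g) (hf.toLp f) := by
  rw [L2.inner_def]
  refine integral_congr_ae ?_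
  filter_upwards [hf.coeFn_toLp, hg.coeFn_toLp] with x h1 h2
  rw [h1, h2]; rfl

theorem norm_toLp_two_sq {f : α → ℝ} (hf : MemLp f 2 μ) :
    ‖hf.toLp f‖ ^ 2 = ∫ x, f x ^ 2 ∂μ := by
  rw [← real_inner_self_eq_norm_sq, ← integral_mul_eq_inner_toLp]
  simp_rw [sq]

theorem tendsto_integral_mul {f g : α → ℝ} {F G : ℕ → α → ℝ} (hf : MemLp f 2 μ) (hg : MemLp g 2 μ)
    (hF : ∀ k, MemLp (F k) 2 μ) (hG : ∀ k, MemLp (G k) 2 μ)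
    (hFf : Tendsto (fun k => eLpNorm (fun x => F k x - f x) 2 μ) atTop (𝓝 0))
    (hGg : Tendsto (fun k => eLpNorm (fun x => G k x - g x) 2 μ) atTop (𝓝 0)) :
    Tendsto (fun k => ∫ x, F k x * G k x ∂μ) atTop (𝓝 (∫ x, f x * g x ∂μ)) := by
  have h1 := (Lp.tendsto_Lp_iff_tendsto_eLpNorm'' F hF f hf).2 hFf
  have h2 := (Lp.tendsto_Lp_iff_tendsto_eLpNorm'' G hG g hg).2 hGg
  rw [integral_mul_eq_inner_toLp hf hg]
  simp_rw [fun k => integral_mul_eq_inner_toLp (hF k) (hG k)]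
  exact h2.inner h1

end L2

theorem Continuous.memLp_two_of_isBounded {d : ℕ} {g : Rd d → ℝ} (hg : Continuous g)
    {s : Set (Rd d)} (hs : Bornology.IsBounded s) {μ : Measure (Rd d)} (hμ : μ s < ⊤) :
    MemLp g 2 (μ.restrict s) := by
  rw [memLp_two_iff_integrable_sq hg.aestronglyMeasurable]
  exact Continuous.integrableOn_of_isBounded (by fun_prop : Continuous fun x => g x ^ 2) hs hμ

theorem fderiv_eq_sum_partialDeriv {d : ℕ} (φ : Rd d → ℝ) (x v : Rd d) :
    fderiv ℝ φ x v = ∑ i, v i * partialDeriv i φ x := by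
  conv_lhs => rw [← (EuclideanSpace.basisFun (Fin d) ℝ).sum_repr v]
  simp [partialDeriv]

theorem continuous_partialDeriv {d : ℕ} {φ : Rd d → ℝ} (hφ : ContDiff ℝ 1 φ) (i : Fin d) :
    Continuous (partialDeriv i φ) :=
  (hφ.continuous_fderiv one_ne_zero).clm_apply continuous_const

/-! ### The trace inequality for smooth functions. -/

namespace IsFaceted

variable {d : ℕ} {ι : Type*} [Fintype ι] {K : Set (Rd d)} {e : ι → Set (Rd d)} {n : ι → Rd d}

omit [Fintype ι] in
theorem memLp_of_continuous (h : IsFaceted K e n) {g : Rd d → ℝ}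
    (hg : Continuous g) : MemLp g 2 (volume.restrict K) :=
  hg.memLp_two_of_isBounded h.isBounded h.isBounded.measure_lt_top

theorem memLp_frontier_of_continuous (h : IsFaceted K e n) (hd : 1 ≤ d) {g : Rd d → ℝ}
    (hg : Continuous g) : MemLp g 2 ((surf d).restrict (frontier K)) :=
  hg.memLp_two_of_isBounded (h.isBounded.closure.subset frontier_subset_closure)
    (h.surf_frontier_lt_top hd)

/-- The radial divergence theorem is applied to `w ^ 2`. On each face the weight is a positive
constant, the distance from `x₀` to the plane of the face, so the boundary integral is bounded by
the volume integral of $d\,w^2+2w\,Dw(y-x_0)$. -/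
theorem exists_trace_inequality_sq (h : IsFaceted K e n) (hd : 1 ≤ d) :
    ∃ C : ℝ, 0 ≤ C ∧ ∀ w : Rd d → ℝ, ContDiff ℝ 1 w →
      ∫ x in frontier K, w x ^ 2 ∂(surf d) ≤
        C * ((∫ x in K, w x ^ 2) + ∑ i, ∫ x in K, partialDeriv i w x ^ 2) := by
  obtain ⟨x₀, h₀⟩ := h.nonempty
  choose s hs hsK using h.exists_support
  obtain ⟨R, hR⟩ := (h.isBounded.sub (Bornology.isBounded_singleton (x := x₀))).exists_norm_le
  have hR' : ∀ y ∈ K, ‖y - x₀‖ ≤ R := fun y hy => hR _ (Set.sub_mem_sub hy rfl)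
  have hR0 : 0 ≤ R := (norm_nonneg _).trans (hR' x₀ h₀)
  have hδ : ∀ j, 0 < s j - inner ℝ (n j) x₀ := fun j => sub_pos.2 (hsK j _ h₀)
  -- The inverse distances remove the weights on the faces. The second factor is the `d` of the
  -- divergence plus the result of $2|w||y_i-x_{0,i}||\partial_iw|\le R(w^2+(\partial_iw)^2)$,
  -- summed over the `d` coordinates.
  refine ⟨(∑ j, (s j - inner ℝ (n j) x₀)⁻¹) * (d + R * d + R), mul_nonneg
    (Finset.sum_nonneg fun j _ => (inv_pos.2 (hδ j)).le) (by positivity), fun w hw => ?_⟩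
  have hwc := hw.continuous
  have hpc := fun i => continuous_partialDeriv hw i
  set Q := (∫ x in K, w x ^ 2) + ∑ i, ∫ x in K, partialDeriv i w x ^ 2 with hQ
  have hrad := h.radial_divergence hd (hw.pow 2) h₀
  have hterm : ∀ j, ∫ x in e j, inner ℝ (n j) (x - x₀) * w x ^ 2 ∂(surf d) =
      (s j - inner ℝ (n j) x₀) * ∫ x in e j, w x ^ 2 ∂(surf d) := by
    intro j
    rw [← integral_const_mul]
    refine setIntegral_congr_fun (h.face_measurable j) fun x hx => ?_
    simp only [inner_sub_right, hs j x hx]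
  have hnn : ∀ j, 0 ≤ ∫ x in e j, w x ^ 2 ∂(surf d) := fun j => integral_nonneg fun x => sq_nonneg _
  have hI1 : IntegrableOn (fun x => w x ^ 2) K := h.integrableOn_of_continuous (by fun_prop)
  have hI2 : ∀ i, IntegrableOn (fun x => partialDeriv i w x ^ 2) K := fun i =>
    h.integrableOn_of_continuous ((hpc i).pow 2)
  have hbound : ∫ y in K, (d * w y ^ 2 + fderiv ℝ (fun x => w x ^ 2) y (y - x₀)) ≤
      (d + R * d + R) * Q := by
    have h1 : ∀ y ∈ K, d * w y ^ 2 + fderiv ℝ (fun x => w x ^ 2) y (y - x₀) ≤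
        (d + R * d) * w y ^ 2 + R * ∑ i, partialDeriv i w y ^ 2 := by
      intro y hy
      have h2 : fderiv ℝ (fun x => w x ^ 2) y (y - x₀) = 2 * w y * fderiv ℝ w y (y - x₀) := by
        rw [fderiv_fun_pow 2 (hw.differentiable one_ne_zero y)]
        simp [mul_assoc]
      have h3 : ∀ i, 2 * w y * ((y - x₀) i * partialDeriv i w y) ≤
          R * w y ^ 2 + R * partialDeriv i w y ^ 2 := by
        intro i
        have h4 : |(y - x₀) i| ≤ R := (PiLp.norm_apply_le (y - x₀) i).trans (hR' y hy)
        have h5 := abs_le.1 h4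
        nlinarith [sq_nonneg (w y + partialDeriv i w y), sq_nonneg (w y - partialDeriv i w y)]
      rw [h2, fderiv_eq_sum_partialDeriv, Finset.mul_sum, Finset.mul_sum]
      have h6 := Finset.sum_le_sum fun i (_ : i ∈ Finset.univ) => h3 i
      rw [Finset.sum_add_distrib] at h6
      simp only [Finset.sum_const, Finset.card_univ, Fintype.card_fin, nsmul_eq_mul] at h6
      linarith
    have hw2 : Continuous (fderiv ℝ fun x => w x ^ 2) := (hw.pow 2).continuous_fderiv one_ne_zero
    refine (setIntegral_mono_on (h.integrableOn_of_continuous (by fun_prop))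
      (h.integrableOn_of_continuous (by fun_prop)) h.isOpen.measurableSet h1).trans ?_
    rw [integral_add (hI1.const_mul _) ((integrable_finsetSum _ fun i _ => hI2 i).const_mul _),
      integral_const_mul, integral_const_mul, integral_finsetSum _ fun i _ => hI2 i, hQ]
    have e1 : 0 ≤ ∫ x in K, w x ^ 2 := integral_nonneg fun x => sq_nonneg _
    have e2 : 0 ≤ ∑ i, ∫ x in K, partialDeriv i w x ^ 2 :=
      Finset.sum_nonneg fun i _ => integral_nonneg fun x => sq_nonneg _
    have e3 : (0 : ℝ) ≤ d := by positivity
    nlinarith [mul_nonneg hR0 e1, mul_nonneg e3 e2, mul_nonneg (mul_nonneg hR0 e3) e2]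
  simp only [hterm] at hrad
  rw [hrad] at hbound
  rw [h.surf_restrict_frontier, integral_finsetSum_measure fun j _ =>
    h.integrableOn_face hd j (by fun_prop : Continuous fun x => w x ^ 2), mul_assoc,
    Finset.sum_mul]
  refine Finset.sum_le_sum fun j _ => ?_
  rw [← div_eq_inv_mul, le_div_iff₀' (hδ j)]
  exact (Finset.single_le_sum (f := fun j => (s j - inner ℝ (n j) x₀) *
    ∫ x in e j, w x ^ 2 ∂(surf d)) (fun j _ => mul_nonneg (hδ j).le (hnn j))
    (Finset.mem_univ j)).trans hbound

/-- The trace inequality for smooth functions. -/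
theorem exists_trace_inequality (h : IsFaceted K e n) (hd : 1 ≤ d) :
    ∃ C : ℝ≥0∞, C ≠ ⊤ ∧ ∀ w : Rd d → ℝ, ContDiff ℝ 1 w →
      eLpNorm w 2 ((surf d).restrict (frontier K)) ≤
        C * (eLpNorm w 2 (volume.restrict K) +
          ∑ i, eLpNorm (partialDeriv i w) 2 (volume.restrict K)) := by
  obtain ⟨C, hC0, hC⟩ := h.exists_trace_inequality_sq hd
  refine ⟨ENNReal.ofReal √C, ENNReal.ofReal_ne_top, fun w hw => ?_⟩
  have hwc := hw.continuous
  rw [← ENNReal.pow_le_pow_left_iff two_ne_zero, eLpNorm_two_sq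
    (h.memLp_frontier_of_continuous hd hwc), mul_pow, ← ENNReal.ofReal_pow (Real.sqrt_nonneg _),
    Real.sq_sqrt hC0]
  refine (ENNReal.ofReal_le_ofReal (hC w hw)).trans ?_
  rw [ENNReal.ofReal_mul hC0]
  gcongr
  rw [ENNReal.ofReal_add (integral_nonneg fun x => sq_nonneg _)
    (Finset.sum_nonneg fun i _ => integral_nonneg fun x => sq_nonneg _),
    ENNReal.ofReal_sum_of_nonneg fun i _ => integral_nonneg fun x => sq_nonneg _,
    ← eLpNorm_two_sq (h.memLp_of_continuous hwc)]
  have hsq : ∀ i, ENNReal.ofReal (∫ x in K, partialDeriv i w x ^ 2) =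
      eLpNorm (partialDeriv i w) 2 (volume.restrict K) ^ 2 := fun i =>
    (eLpNorm_two_sq (h.memLp_of_continuous (continuous_partialDeriv hw i))).symm
  simp_rw [hsq]
  generalize eLpNorm w 2 (volume.restrict K) = a
  generalize hb : (fun i => eLpNorm (partialDeriv i w) 2 (volume.restrict K)) = b
  have hb' : ∀ i, eLpNorm (partialDeriv i w) 2 (volume.restrict K) = b i := fun i => congrFun hb i
  simp_rw [hb']
  have h1 : ∑ i, b i ^ 2 ≤ (∑ i, b i) ^ 2 := by
    rw [sq (∑ i, b i), Finset.sum_mul]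
    refine Finset.sum_le_sum fun i _ => ?_
    rw [sq]
    gcongr
    exact Finset.single_le_sum (f := b) (fun _ _ => zero_le) (Finset.mem_univ i)
  calc a ^ 2 + ∑ i, b i ^ 2 ≤ a ^ 2 + (∑ i, b i) ^ 2 := by gcongr
    _ ≤ (a + ∑ i, b i) ^ 2 := by
      rw [add_sq]
      generalize ∑ i, b i = s
      rw [add_right_comm]
      exact le_self_add

end IsFaceted

/-! ### Calculus of weak derivatives -/

section weak

variable {d : ℕ} {D : Set (Rd d)} {i : Fin d} {v v' g g' : Rd d → ℝ}

theorem MeasureTheory.LocallyIntegrableOn.integrableOn_mul_of_tsupport_subset (hv : LocallyIntegrableOn v D)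
    {ψ : Rd d → ℝ} (hψ : Continuous ψ) (hc : HasCompactSupport ψ) (hs : tsupport ψ ⊆ D) :
    IntegrableOn (fun x => v x * ψ x) D := by
  have h1 : IntegrableOn v (tsupport ψ) := hv.integrableOn_compact_subset hs hc
  have h2 : IntegrableOn (fun x => v x * ψ x) (tsupport ψ) volume :=
    h1.mul_continuousOn hψ.continuousOn hc
  refine Integrable.integrableOn ?_
  rwa [integrableOn_iff_integrable_of_support_subset] at h2
  exact (Function.support_mul_subset_right v ψ).trans (subset_tsupport ψ)

theorem partialDeriv_tsupport_subset (i : Fin d) (φ : Rd d → ℝ) :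
    tsupport (partialDeriv i φ) ⊆ tsupport φ := by
  have := tsupport_fderiv_apply_subset ℝ (f := φ) (EuclideanSpace.single i (1 : ℝ))
  exact this

theorem contDiff_partialDeriv {φ : Rd d → ℝ} (hφ : ContDiff ℝ ∞ φ) (i : Fin d) :
    ContDiff ℝ ∞ (partialDeriv i φ) :=
  (hφ.fderiv_right (m := ∞) (by simp)).clm_apply contDiff_const

theorem hasCompactSupport_partialDeriv {φ : Rd d → ℝ} (hφ : HasCompactSupport φ) (i : Fin d) :
    HasCompactSupport (partialDeriv i φ) :=
  hφ.mono' (subset_closure.trans (partialDeriv_tsupport_subset i φ))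

theorem MeasureTheory.MemLp.locallyIntegrableOn_restrict
    (hv : MemLp v 2 (volume.restrict D)) : LocallyIntegrableOn v D :=
  locallyIntegrableOn_of_locallyIntegrable_restrict (hv.locallyIntegrable one_le_two)

namespace HasWeakPartial

/-- The fundamental lemma of the calculus of variations, applied to `g - g'`. -/
theorem ae_eq (hD : IsOpen D) (h : HasWeakPartial D i v g) (h' : HasWeakPartial D i v g') :
    g =ᵐ[volume.restrict D] g' := by
  rw [EventuallyEq, ae_restrict_iff' hD.measurableSet]
  have := hD.ae_eq_zero_of_integral_contDiff_smul_eq_zero (h.2.1.sub h'.2.1) (fun φ h1 h2 h3 => ?_)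
  · filter_upwards [this] with x hx hxD
    exact sub_eq_zero.1 (hx hxD)
  · have e1 := h.2.2 φ h1 h2 h3
    have e2 := h'.2.2 φ h1 h2 h3
    have hi := h.2.1.integrableOn_mul_of_tsupport_subset h1.continuous h2 h3
    have hi' := h'.2.1.integrableOn_mul_of_tsupport_subset h1.continuous h2 h3
    have e3 : ∫ x in D, φ x • (g - g') x = 0 := by
      simp only [smul_eq_mul, Pi.sub_apply, mul_sub]
      simp only [mul_comm (φ _)]
      rw [integral_sub hi hi']
      linarith
    rw [← e3]
    refine (setIntegral_eq_integral_of_forall_compl_eq_zero fun x hx => ?_).symm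
    rw [image_eq_zero_of_notMem_tsupport fun hx' => hx (h3 hx'), zero_smul]

theorem congr (hv : v =ᵐ[volume.restrict D] v') (hg : g =ᵐ[volume.restrict D] g')
    (h : HasWeakPartial D i v g) : HasWeakPartial D i v' g' := by
  refine ⟨h.1.congr hv, h.2.1.congr hg, fun φ h1 h2 h3 => ?_⟩
  have e1 : ∫ x in D, v x * partialDeriv i φ x = ∫ x in D, v' x * partialDeriv i φ x :=
    integral_congr_ae (hv.mono fun x hx => by simp only [hx])
  have e2 : ∫ x in D, g x * φ x = ∫ x in D, g' x * φ x :=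
    integral_congr_ae (hg.mono fun x hx => by simp only [hx])
  rw [← e1, ← e2]
  exact h.2.2 φ h1 h2 h3

theorem add (h : HasWeakPartial D i v g) (h' : HasWeakPartial D i v' g') :
    HasWeakPartial D i (fun x => v x + v' x) (fun x => g x + g' x) := by
  refine ⟨h.1.add h'.1, h.2.1.add h'.2.1, fun φ h1 h2 h3 => ?_⟩
  have hp := (contDiff_partialDeriv h1 i).continuous
  have hpc := hasCompactSupport_partialDeriv h2 i
  have hps := (partialDeriv_tsupport_subset i φ).trans h3
  simp only [add_mul]
  rw [integral_add (h.1.integrableOn_mul_of_tsupport_subset hp hpc hps)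
    (h'.1.integrableOn_mul_of_tsupport_subset hp hpc hps),
    integral_add (h.2.1.integrableOn_mul_of_tsupport_subset h1.continuous h2 h3)
    (h'.2.1.integrableOn_mul_of_tsupport_subset h1.continuous h2 h3),
    h.2.2 φ h1 h2 h3, h'.2.2 φ h1 h2 h3, neg_add]

theorem const_mul (c : ℝ) (h : HasWeakPartial D i v g) :
    HasWeakPartial D i (fun x => c * v x) (fun x => c * g x) := by
  refine ⟨?_, ?_, fun φ h1 h2 h3 => ?_⟩
  · exact h.1.smul c
  · exact h.2.1.smul c
  · simp only [mul_assoc]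
    rw [integral_const_mul, integral_const_mul, h.2.2 φ h1 h2 h3, mul_neg]

theorem mono {D' : Set (Rd d)} (hD : IsOpen D) (hsub : D' ⊆ D)
    (h : HasWeakPartial D i v g) : HasWeakPartial D' i v g := by
  refine ⟨h.1.mono_set hsub, h.2.1.mono_set hsub, fun φ h1 h2 h3 => ?_⟩
  have h4 := h.2.2 φ h1 h2 (h3.trans hsub)
  have key : ∀ (f ψ : Rd d → ℝ), tsupport ψ ⊆ D' →
      ∫ x in D, f x * ψ x = ∫ x in D', f x * ψ x := by
    intro f ψ hψ
    refine (setIntegral_eq_of_subset_of_forall_sdiff_eq_zero hD.measurableSet hsub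
      fun x hx => ?_)
    rw [image_eq_zero_of_notMem_tsupport fun hx' => hx.2 (hψ hx'), mul_zero]
  rwa [key v _ ((partialDeriv_tsupport_subset i φ).trans h3), key g φ h3] at h4

theorem of_contDiff {w : Rd d → ℝ} (hw : ContDiff ℝ ∞ w) (D : Set (Rd d)) (i : Fin d) :
    HasWeakPartial D i w (partialDeriv i w) := by
  have hp := (contDiff_partialDeriv hw i).continuous
  refine ⟨hw.continuous.locallyIntegrable.locallyIntegrableOn D,
    hp.locallyIntegrable.locallyIntegrableOn D, fun φ h1 h2 h3 => ?_⟩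
  have hφp := (contDiff_partialDeriv h1 i).continuous
  rw [setIntegral_eq_integral_of_forall_compl_eq_zero, setIntegral_eq_integral_of_forall_compl_eq_zero]
  · have hint : ∀ {a b : Rd d → ℝ}, Continuous a → Continuous b → HasCompactSupport b →
        Integrable fun x => a x * b x := fun ha hb hc =>
      (ha.mul hb).integrable_of_hasCompactSupport hc.mul_left
    exact integral_mul_fderiv_eq_neg_fderiv_mul_of_integrable
      (hint hp h1.continuous h2)
      (hint hw.continuous hφp (hasCompactSupport_partialDeriv h2 i))
      (hint hw.continuous h1.continuous h2)
      (fun x _ => hw.differentiable (by simp) x) (fun x _ => h1.differentiable (by simp) x)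
  · intro x hx
    rw [image_eq_zero_of_notMem_tsupport fun hx' => hx (h3 hx'), mul_zero]
  · intro x hx
    rw [image_eq_zero_of_notMem_tsupport
      fun hx' => hx (h3 (partialDeriv_tsupport_subset i φ hx')), mul_zero]

/-- `weakPartial` is an arbitrary choice among almost everywhere equal functions. This lemma is the
way from any explicit weak derivative to the chosen one, and it explains why the rules below are
identities almost everywhere. -/
theorem weakPartial_ae_eq (hD : IsOpen D) (h : HasWeakPartial D i v g) :
    weakPartial D i v =ᵐ[volume.restrict D] g := by
  have hex : ∃ g, HasWeakPartial D i v g := ⟨g, h⟩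
  rw [weakPartial, dif_pos hex]
  exact hex.choose_spec.ae_eq hD h

theorem hasWeakPartial_weakPartial (h : HasWeakPartial D i v g) :
    HasWeakPartial D i v (weakPartial D i v) := by
  have hex : ∃ g, HasWeakPartial D i v g := ⟨g, h⟩
  rw [weakPartial, dif_pos hex]
  exact hex.choose_spec

end HasWeakPartial

theorem weakPartial_congr_ae (hD : IsOpen D) (hv : v =ᵐ[volume.restrict D] v') :
    weakPartial D i v =ᵐ[volume.restrict D] weakPartial D i v' := by
  by_cases h : ∃ g, HasWeakPartial D i v g
  · obtain ⟨g, hg⟩ := h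
    exact (hg.weakPartial_ae_eq hD).trans
      ((hg.congr hv EventuallyEq.rfl).weakPartial_ae_eq hD).symm
  · have h' : ¬ ∃ g, HasWeakPartial D i v' g := by
      rintro ⟨g, hg⟩
      exact h ⟨g, hg.congr hv.symm EventuallyEq.rfl⟩
    rw [weakPartial, weakPartial, dif_neg h, dif_neg h']

namespace MemH1

theorem hasWeakPartial (h : MemH1 D v) (i : Fin d) :
    HasWeakPartial D i v (weakPartial D i v) := by
  obtain ⟨g, hg, -⟩ := h.2 i
  exact hg.hasWeakPartial_weakPartial

theorem memLp_weakPartial (hD : IsOpen D) (h : MemH1 D v) (i : Fin d) :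
    MemLp (weakPartial D i v) 2 (volume.restrict D) := by
  obtain ⟨g, hg, hg2⟩ := h.2 i
  exact hg2.ae_eq (hg.weakPartial_ae_eq hD).symm

theorem congr (hv : v =ᵐ[volume.restrict D] v') (h : MemH1 D v) : MemH1 D v' :=
  ⟨h.1.ae_eq hv, fun i => by
    obtain ⟨g, hg, hg2⟩ := h.2 i
    exact ⟨g, hg.congr hv EventuallyEq.rfl, hg2⟩⟩

theorem add (h : MemH1 D v) (h' : MemH1 D v') : MemH1 D fun x => v x + v' x :=
  ⟨h.1.add h'.1, fun i => by
    obtain ⟨g, hg, hg2⟩ := h.2 i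
    obtain ⟨g', hg', hg2'⟩ := h'.2 i
    exact ⟨_, hg.add hg', hg2.add hg2'⟩⟩

theorem const_mul (c : ℝ) (h : MemH1 D v) : MemH1 D fun x => c * v x :=
  ⟨h.1.const_mul c, fun i => by
    obtain ⟨g, hg, hg2⟩ := h.2 i
    exact ⟨_, hg.const_mul c, hg2.const_mul c⟩⟩

theorem mono {D' : Set (Rd d)} (hD : IsOpen D) (hsub : D' ⊆ D)
    (h : MemH1 D v) : MemH1 D' v :=
  ⟨h.1.mono_measure (Measure.restrict_mono hsub le_rfl), fun i => by
    obtain ⟨g, hg, hg2⟩ := h.2 i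
    exact ⟨_, hg.mono hD hsub, hg2.mono_measure (Measure.restrict_mono hsub le_rfl)⟩⟩

theorem zero : MemH1 D (0 : Rd d → ℝ) :=
  ⟨MemLp.zero, fun i => ⟨0, (HasWeakPartial.of_contDiff (w := fun _ : Rd d => (0 : ℝ))
    contDiff_const D i).congr EventuallyEq.rfl
      (Eventually.of_forall fun x => by simp [partialDeriv]), MemLp.zero⟩⟩

theorem weakPartial_add (hD : IsOpen D) (h : MemH1 D v) (h' : MemH1 D v') (i : Fin d) :
    weakPartial D i (fun x => v x + v' x) =ᵐ[volume.restrict D]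
      fun x => weakPartial D i v x + weakPartial D i v' x :=
  ((h.hasWeakPartial i).add (h'.hasWeakPartial i)).weakPartial_ae_eq hD

theorem weakPartial_const_mul (hD : IsOpen D) (h : MemH1 D v) (c : ℝ) (i : Fin d) :
    weakPartial D i (fun x => c * v x) =ᵐ[volume.restrict D] fun x => c * weakPartial D i v x :=
  ((h.hasWeakPartial i).const_mul c).weakPartial_ae_eq hD

theorem weakPartial_mono {D' : Set (Rd d)} (hD : IsOpen D) (hD' : IsOpen D') (hsub : D' ⊆ D)
    (h : MemH1 D v) (i : Fin d) :
    weakPartial D' i v =ᵐ[volume.restrict D'] weakPartial D i v :=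
  ((h.hasWeakPartial i).mono hD hsub).weakPartial_ae_eq hD'

theorem of_contDiff {w : Rd d → ℝ} (hw : ContDiff ℝ ∞ w) (h0 : MemLp w 2 (volume.restrict D))
    (h1 : ∀ i, MemLp (partialDeriv i w) 2 (volume.restrict D)) : MemH1 D w :=
  ⟨h0, fun i => ⟨_, HasWeakPartial.of_contDiff hw D i, h1 i⟩⟩

end MemH1

theorem weakPartial_of_contDiff (hD : IsOpen D) {w : Rd d → ℝ} (hw : ContDiff ℝ ∞ w)
    (i : Fin d) : weakPartial D i w =ᵐ[volume.restrict D] partialDeriv i w :=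
  (HasWeakPartial.of_contDiff hw D i).weakPartial_ae_eq hD

theorem weakPartial_zero (hD : IsOpen D) (i : Fin d) :
    weakPartial D i (0 : Rd d → ℝ) =ᵐ[volume.restrict D] 0 := by
  have h := weakPartial_of_contDiff (w := fun _ : Rd d => (0 : ℝ)) hD contDiff_const i
  refine h.trans (Eventually.of_forall fun x => ?_)
  simp [partialDeriv]

namespace MemH2

theorem congr (hD : IsOpen D) (hv : v =ᵐ[volume.restrict D] v') (h : MemH2 D v) : MemH2 D v' :=
  ⟨h.1.congr hv, fun i => (h.2 i).congr (weakPartial_congr_ae hD hv)⟩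

theorem add (hD : IsOpen D) (h : MemH2 D v) (h' : MemH2 D v') : MemH2 D fun x => v x + v' x :=
  ⟨h.1.add h'.1, fun i => ((h.2 i).add (h'.2 i)).congr (h.1.weakPartial_add hD h'.1 i).symm⟩

theorem const_mul (hD : IsOpen D) (c : ℝ) (h : MemH2 D v) : MemH2 D fun x => c * v x :=
  ⟨h.1.const_mul c, fun i => ((h.2 i).const_mul c).congr (h.1.weakPartial_const_mul hD c i).symm⟩

theorem mono {D' : Set (Rd d)} (hD : IsOpen D) (hD' : IsOpen D') (hsub : D' ⊆ D)
    (h : MemH2 D v) : MemH2 D' v :=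
  ⟨h.1.mono hD hsub, fun i => ((h.2 i).mono hD hsub).congr
    (h.1.weakPartial_mono hD hD' hsub i).symm⟩

theorem zero (hD : IsOpen D) : MemH2 D (0 : Rd d → ℝ) :=
  ⟨MemH1.zero, fun i => MemH1.zero.congr (weakPartial_zero hD i).symm⟩

theorem sum (hD : IsOpen D) {κ : Type*} (s : Finset κ) {f : κ → Rd d → ℝ}
    (h : ∀ k ∈ s, MemH2 D (f k)) : MemH2 D fun x => ∑ k ∈ s, f k x := by
  classical
  induction s using Finset.induction_on with
  | empty => simpa using! MemH2.zero hD
  | insert a s ha ih =>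
    simp only [Finset.sum_insert ha]
    exact (h a (Finset.mem_insert_self a s)).add hD
      (ih fun k hk => h k (Finset.mem_insert_of_mem hk))

/-- Weak derivatives of second order commute. -/
theorem weakPartial_comm (hD : IsOpen D) (h : MemH2 D v) (k m : Fin d) :
    weakPartial D m (weakPartial D k v) =ᵐ[volume.restrict D]
      weakPartial D k (weakPartial D m v) := by
  refine HasWeakPartial.weakPartial_ae_eq hD ?_
  have hk := h.1.hasWeakPartial k
  have hm := h.1.hasWeakPartial m
  have hkm := (h.2 m).hasWeakPartial k
  refine ⟨hk.2.1, hkm.2.1, fun φ h1 h2 h3 => ?_⟩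
  -- Derivatives of test functions are test functions. Both orders of differentiation are moved onto
  -- `φ`, where they commute, and one derivative at a time is moved back.
  have s1 := hk.2.2 (partialDeriv m φ) (contDiff_partialDeriv h1 m)
    (hasCompactSupport_partialDeriv h2 m) ((partialDeriv_tsupport_subset m φ).trans h3)
  have s2 := hm.2.2 (partialDeriv k φ) (contDiff_partialDeriv h1 k)
    (hasCompactSupport_partialDeriv h2 k) ((partialDeriv_tsupport_subset k φ).trans h3)
  have s3 := hkm.2.2 φ h1 h2 h3
  have hsymm : partialDeriv k (partialDeriv m φ) = partialDeriv m (partialDeriv k φ) := by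
    ext x
    have hdiff : DifferentiableAt ℝ (fderiv ℝ φ) x :=
      (h1.fderiv_right (m := ∞) (by simp)).differentiable (by simp) x
    have hs : IsSymmSndFDerivAt ℝ φ x :=
      (h1.contDiffAt).isSymmSndFDerivAt (by simp only [minSmoothness_of_isRCLikeNormedField]; exact WithTop.coe_le_coe.2 (le_top : (2 : ℕ∞) ≤ ⊤))
    have e : ∀ a b : Fin d, partialDeriv a (partialDeriv b φ) x =
        fderiv ℝ (fderiv ℝ φ) x (EuclideanSpace.single a 1) (EuclideanSpace.single b 1) := by
      intro a b
      have := (hdiff.hasFDerivAt.clm_apply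
        (hasFDerivAt_const (EuclideanSpace.single b (1 : ℝ)) x)).fderiv
      change fderiv ℝ (fun y => fderiv ℝ φ y (EuclideanSpace.single b 1)) x _ = _
      rw [this]
      simp
    rw [e, e]
    exact hs _ _
  rw [hsymm] at s1
  linarith

end MemH2

end weak

/-! ### Density of smooth functions in `H¹` of a bounded open convex set -/

section mollify

variable {d : ℕ}

/-- Convolution with a normed bump function. -/
noncomputable def mollify (k : ContDiffBump (0 : Rd d)) (f : Rd d → ℝ) (x : Rd d) : ℝ :=
  ∫ t, f t * k.normed volume (x - t)

open scoped Convolution in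
theorem mollify_eq_convolution (k : ContDiffBump (0 : Rd d)) (f : Rd d → ℝ) :
    mollify k f = f ⋆[ContinuousLinearMap.mul ℝ ℝ, volume] k.normed volume := rfl

open scoped Convolution in
theorem mollify_eq_normed_convolution (k : ContDiffBump (0 : Rd d)) (f : Rd d → ℝ) :
    mollify k f = k.normed volume ⋆[ContinuousLinearMap.lsmul ℝ ℝ, volume] f := by
  rw [mollify_eq_convolution, ← convolution_flip]
  ext x
  simp only [convolution_def]
  congr 1 with t
  simp [mul_comm]

theorem mollify_apply (k : ContDiffBump (0 : Rd d)) (f : Rd d → ℝ) (x : Rd d) :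
    mollify k f x = ∫ t, k.normed volume t * f (x - t) := by
  rw [mollify_eq_normed_convolution]; rfl

theorem contDiff_mollify (k : ContDiffBump (0 : Rd d)) {f : Rd d → ℝ}
    (hf : LocallyIntegrable f) : ContDiff ℝ ∞ (mollify k f) := by
  rw [mollify_eq_convolution]
  exact k.hasCompactSupport_normed.contDiff_convolution_right _ hf k.contDiff_normed

theorem fderiv_mollify (k : ContDiffBump (0 : Rd d)) {f : Rd d → ℝ}
    (hf : LocallyIntegrable f) (x v : Rd d) :
    fderiv ℝ (mollify k f) x v = ∫ t, f t * fderiv ℝ (k.normed volume) (x - t) v := by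
  rw [mollify_eq_convolution]
  have hk : ContDiff ℝ 1 (k.normed (volume : Measure (Rd d))) := k.contDiff_normed
  rw [(k.hasCompactSupport_normed.hasFDerivAt_convolution_right
    (ContinuousLinearMap.mul ℝ ℝ) hf hk x).fderiv,
    convolution_precompR_apply _ hf (k.hasCompactSupport_normed.fderiv ℝ)
      (hk.continuous_fderiv one_ne_zero)]
  rfl

theorem mollify_sub (k : ContDiffBump (0 : Rd d)) {f g : Rd d → ℝ}
    (hf : LocallyIntegrable f) (hg : LocallyIntegrable g) (x : Rd d) :
    mollify k (f - g) x = mollify k f x - mollify k g x := by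
  have h : ∀ {f : Rd d → ℝ}, LocallyIntegrable f →
      Integrable fun t => f t * k.normed volume (x - t) := fun hf =>
    (k.hasCompactSupport_normed.convolutionExists_right (ContinuousLinearMap.mul ℝ ℝ) hf
      k.continuous_normed x)
  rw [mollify, mollify, mollify, ← integral_sub (h hf) (h hg)]
  simp [sub_mul]

theorem dist_mollify_le (k : ContDiffBump (0 : Rd d)) {f : Rd d → ℝ} {x : Rd d} {ε : ℝ}
    (hf : AEStronglyMeasurable f) (h : ∀ y ∈ Metric.ball x k.rOut, dist (f y) (f x) ≤ ε) :
    dist (mollify k f x) (f x) ≤ ε := by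
  rw [mollify_eq_normed_convolution]
  exact k.dist_normed_convolution_le hf h

/-- Mollification averages translates of `f` against a probability measure. Pointwise the `L¹` norm
for that measure is at most the `L²` norm; Tonelli and translation invariance then remove the
average. -/
theorem eLpNorm_mollify_le (k : ContDiffBump (0 : Rd d)) {f : Rd d → ℝ} (hf : Measurable f) :
    eLpNorm (mollify k f) 2 volume ≤ eLpNorm f 2 volume := by
  set ν : Measure (Rd d) :=
    volume.withDensity fun t => ENNReal.ofReal (k.normed volume t) with hν
  have hkm : Measurable fun t => ENNReal.ofReal (k.normed (volume : Measure (Rd d)) t) :=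
    (k.continuous_normed).measurable.ennreal_ofReal
  have : IsProbabilityMeasure ν := ⟨by
    rw [hν, withDensity_apply _ MeasurableSet.univ, Measure.restrict_univ,
      ← ofReal_integral_eq_lintegral_ofReal k.integrable_normed
        (Eventually.of_forall k.nonneg_normed), k.integral_normed, ENNReal.ofReal_one]⟩
  have hmol : ∀ x, mollify k f x = ∫ t, f (x - t) ∂ν := by
    intro x
    rw [mollify_apply, hν, integral_withDensity_eq_integral_toReal_smul hkm (by simp)]
    congr 1 with t
    rw [ENNReal.toReal_ofReal (k.nonneg_normed t), smul_eq_mul]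
  have hpt : ∀ x, ‖mollify k f x‖ₑ ^ (2 : ℝ) ≤ ∫⁻ t, ‖f (x - t)‖ₑ ^ (2 : ℝ) ∂ν := by
    intro x
    have hm : Measurable fun t => f (x - t) := hf.comp (by fun_prop)
    have h1 : ‖mollify k f x‖ₑ ≤ eLpNorm (fun t => f (x - t)) 2 ν := by
      rw [hmol]
      refine (enorm_integral_le_lintegral_enorm _).trans ?_
      rw [← eLpNorm_one_eq_lintegral_enorm]
      exact eLpNorm_le_eLpNorm_of_exponent_le one_le_two hm.aestronglyMeasurable
    refine (ENNReal.rpow_le_rpow h1 zero_le_two).trans ?_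
    rw [eLpNorm_eq_lintegral_rpow_enorm_toReal two_ne_zero ENNReal.ofNat_ne_top,
      ← ENNReal.rpow_mul]
    simp
  rw [eLpNorm_eq_lintegral_rpow_enorm_toReal two_ne_zero ENNReal.ofNat_ne_top,
    eLpNorm_eq_lintegral_rpow_enorm_toReal two_ne_zero ENNReal.ofNat_ne_top]
  simp only [ENNReal.toReal_ofNat]
  refine ENNReal.rpow_le_rpow ?_ (by norm_num)
  refine (lintegral_mono hpt).trans ?_
  have hm2 : Measurable fun p : Rd d × Rd d => ‖f (p.1 - p.2)‖ₑ ^ (2 : ℝ) :=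
    (hf.comp (by fun_prop)).enorm.pow_const _
  rw [lintegral_lintegral_swap hm2.aemeasurable]
  have : ∀ t, ∫⁻ x, ‖f (x - t)‖ₑ ^ (2 : ℝ) = ∫⁻ x, ‖f x‖ₑ ^ (2 : ℝ) := fun t =>
    lintegral_sub_right_eq_self (fun x => ‖f x‖ₑ ^ (2 : ℝ)) t
  rw [lintegral_congr this, lintegral_const, measure_univ, mul_one]

/-- Shrinking towards `x₀` increases the `L²` norm by a bounded factor. -/
theorem eLpNorm_comp_shrink_le (x₀ : Rd d) {ε : ℝ} (hε : ε ∈ Icc (0 : ℝ) (1 / 2))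
    {f : Rd d → ℝ} (hf : Measurable f) :
    eLpNorm (fun x => f (x + ε • (x₀ - x))) 2 volume ≤ 2 ^ d * eLpNorm f 2 volume := by
  have h1 : (fun x => f (x + ε • (x₀ - x))) =
      (fun y => f (y + ε • x₀)) ∘ fun x => (1 - ε) • x := by
    ext x; simp only [Function.comp]; congr 1; rw [smul_sub, sub_smul, one_smul]; abel
  have hm : Measurable fun y => f (y + ε • x₀) := hf.comp (by fun_prop)
  have hne : (1 - ε) ≠ 0 := by linarith [hε.2]
  rw [h1, ← eLpNorm_map_measure hm.aestronglyMeasurable (by fun_prop),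
    Measure.map_addHaar_smul volume hne, eLpNorm_smul_measure_of_ne_top ENNReal.ofNat_ne_top,
    smul_eq_mul]
  have h2 : eLpNorm (fun y => f (y + ε • x₀)) 2 volume = eLpNorm f 2 volume :=
    eLpNorm_comp_measurePreserving hf.aestronglyMeasurable
      (measurePreserving_add_right volume (ε • x₀))
  rw [h2]
  gcongr
  have h3 : ENNReal.ofReal |((1 - ε) ^ Module.finrank ℝ (Rd d))⁻¹| ≤ 2 ^ d := by
    have : (2 : ℝ≥0∞) ^ d = ENNReal.ofReal (2 ^ d) := by
      rw [ENNReal.ofReal_pow zero_le_two]; simp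
    rw [this]
    refine ENNReal.ofReal_le_ofReal ?_
    rw [finrank_euclideanSpace_fin, ← inv_pow, abs_of_nonneg (by
      have : 0 ≤ 1 - ε := by linarith [hε.2]
      positivity)]
    have h4 : (1 - ε)⁻¹ ≤ 2 := by
      rw [inv_le_comm₀ (by linarith [hε.2]) two_pos]; linarith [hε.2]
    exact pow_le_pow_left₀ (by rw [inv_nonneg]; linarith [hε.2]) h4 d
  -- The change of variables contributes the square root of a factor at most `2 ^ d`; the exponent
  -- `1 / 2` is simply raised to `1`.
  refine (ENNReal.rpow_le_rpow h3 ENNReal.toReal_nonneg).trans ?_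
  refine (ENNReal.rpow_le_rpow_of_exponent_le (one_le_pow₀ one_le_two)
    (?_ : _ ≤ (1 : ℝ))).trans (by simp)
  norm_num

theorem MeasureTheory.MemLp.locallyIntegrable_two {f : Rd d → ℝ} (hf : MemLp f 2 volume) :
    LocallyIntegrable f := hf.locallyIntegrable one_le_two

/-- For continuous `g` of compact support the error is uniformly small and vanishes outside a fixed
ball, so its `L²` norm is small. -/
theorem eLpNorm_mollify_shrink_sub_le_of_continuous (x₀ : Rd d) {g : Rd d → ℝ}
    (hg : Continuous g) (hc : HasCompactSupport g) {η : ℝ≥0∞} (hη : η ≠ 0) :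
    ∃ δ > 0, ∀ (k : ContDiffBump (0 : Rd d)) (ε : ℝ), ε ∈ Icc (0 : ℝ) (1 / 2) → ε < δ →
      k.rOut < δ → eLpNorm (fun x => mollify k g (x + ε • (x₀ - x)) - g x) 2 volume ≤ η := by
  obtain ⟨R₀, hR₀⟩ := hc.isCompact.isBounded.subset_closedBall x₀
  set R := |R₀|
  have hsupp : ∀ y, R < dist y x₀ → g y = 0 := fun y hy => by
    by_contra h
    have := hR₀ (subset_tsupport g h)
    rw [Metric.mem_closedBall] at this
    linarith [le_abs_self R₀]
  set S := Metric.closedBall x₀ (2 * (R + 1))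
  have hSfin : volume S < ⊤ := measure_closedBall_lt_top
  obtain ⟨c, hc0, hcη⟩ : ∃ c : ℝ, 0 < c ∧
      ENNReal.ofReal c * volume S ^ (1 / (2 : ℝ≥0∞).toReal) ≤ η := by
    have h1 : Tendsto (fun c : ℝ => ENNReal.ofReal c * volume S ^ (1 / (2 : ℝ≥0∞).toReal))
        (𝓝[>] 0) (𝓝 (ENNReal.ofReal 0 * volume S ^ (1 / (2 : ℝ≥0∞).toReal))) := by
      refine ENNReal.Tendsto.mul_const ?_ (Or.inr ?_)
      · exact (ENNReal.continuous_ofReal.tendsto 0).mono_left nhdsWithin_le_nhds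
      · exact (ENNReal.rpow_lt_top_of_nonneg (by simp) hSfin.ne).ne
    rw [ENNReal.ofReal_zero, zero_mul] at h1
    obtain ⟨c, h2, h3⟩ := ((h1.eventually (ge_mem_nhds (pos_iff_ne_zero.2 hη))).and
      self_mem_nhdsWithin).exists
    exact ⟨c, h3, h2⟩
  obtain ⟨δ₀, hδ₀, hunif⟩ := Metric.uniformContinuous_iff.1
    (hc.uniformContinuous_of_continuous hg) (c / 2) (half_pos hc0)
  have hM : 0 < 2 * (R + 1) := by have := abs_nonneg R₀; linarith
  -- A kernel of radius below `1` keeps the support in the ball of radius `2 (R + 1)`: a point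
  -- outside it stays farther than `R + 1` from `x₀` after shrinking, as `ε ≤ 1 / 2`. Radius below
  -- `δ₀` and displacement at most `ε · 2 (R + 1) < δ₀` allow uniform continuity to be used twice.
  refine ⟨min (min 1 δ₀) (δ₀ / (2 * (R + 1))), by positivity, fun k ε hε hεδ hk => ?_⟩
  have hk1 : k.rOut < 1 := lt_of_lt_of_le hk ((min_le_left _ _).trans (min_le_left _ _))
  have hk2 : k.rOut < δ₀ := lt_of_lt_of_le hk ((min_le_left _ _).trans (min_le_right _ _))
  have hε2 : ε * (2 * (R + 1)) < δ₀ := by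
    rw [← lt_div_iff₀ hM]; exact lt_of_lt_of_le hεδ (min_le_right _ _)
  have hshrink : ∀ x, dist (x + ε • (x₀ - x)) x₀ = (1 - ε) * dist x x₀ := by
    intro x
    have : x + ε • (x₀ - x) - x₀ = (1 - ε) • (x - x₀) := by
      rw [smul_sub, smul_sub, sub_smul, sub_smul, one_smul, one_smul]; abel
    rw [dist_eq_norm, this, norm_smul, Real.norm_of_nonneg (by linarith [hε.2]), dist_eq_norm]
  have hout : ∀ x, 2 * (R + 1) < dist x x₀ → mollify k g (x + ε • (x₀ - x)) = 0 := by
    intro x hx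
    have h1 : R + 1 < dist (x + ε • (x₀ - x)) x₀ := by
      rw [hshrink]; nlinarith [hε.2, hε.1]
    have h2 : ∀ y ∈ Metric.ball (x + ε • (x₀ - x)) k.rOut, g y = 0 := by
      intro y hy
      refine hsupp y ?_
      have := dist_triangle (x + ε • (x₀ - x)) y x₀
      rw [Metric.mem_ball, dist_comm] at hy
      linarith
    have h3 := dist_mollify_le k (x := x + ε • (x₀ - x)) (ε := 0) hg.aestronglyMeasurable
      (fun y hy => by rw [h2 y hy, h2 _ (Metric.mem_ball_self k.rOut_pos), dist_self])
    rw [h2 _ (Metric.mem_ball_self k.rOut_pos)] at h3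
    exact dist_le_zero.1 h3
  refine le_trans ?_ hcη
  refine eLpNorm_sub_le_of_dist_bdd volume ENNReal.ofNat_ne_top measurableSet_closedBall hc0.le
    (fun x => ?_) ?_ ?_
  · by_cases hx : dist x x₀ ≤ 2 * (R + 1)
    · have h1 : dist (mollify k g (x + ε • (x₀ - x))) (g (x + ε • (x₀ - x))) ≤ c / 2 :=
        dist_mollify_le k hg.aestronglyMeasurable fun y hy =>
          (hunif (lt_trans (Metric.mem_ball.1 hy) hk2)).le
      have h2 : dist (g (x + ε • (x₀ - x))) (g x) ≤ c / 2 := by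
        refine (hunif ?_).le
        rw [dist_eq_norm, add_sub_cancel_left, norm_smul, Real.norm_of_nonneg hε.1,
          ← dist_eq_norm, dist_comm]
        exact lt_of_le_of_lt (mul_le_mul_of_nonneg_left hx hε.1) hε2
      linarith [dist_triangle (mollify k g (x + ε • (x₀ - x))) (g (x + ε • (x₀ - x))) (g x)]
    · rw [not_le] at hx
      rw [hout x hx, hsupp x (by have := abs_nonneg R₀; linarith), dist_self]
      exact hc0.le
  · intro x hx
    by_contra h
    rw [Metric.mem_closedBall, not_le] at h
    exact hx (hout x h)
  · intro x hx
    by_contra h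
    rw [Metric.mem_closedBall, not_le] at h
    exact hx (hsupp x (by have := abs_nonneg R₀; linarith))

/-- The operators are bounded on `L²` uniformly in `m` and converge on the dense set of continuous
functions of compact support, hence on all of `L²`. -/
theorem tendsto_eLpNorm_mollify_shrink (x₀ : Rd d) {f : Rd d → ℝ} (hf : Measurable f)
    (hf2 : MemLp f 2 volume) {k : ℕ → ContDiffBump (0 : Rd d)} {ε : ℕ → ℝ}
    (hε : ∀ m, ε m ∈ Icc (0 : ℝ) (1 / 2)) (hε0 : Tendsto ε atTop (𝓝 0))
    (hk : Tendsto (fun m => (k m).rOut) atTop (𝓝 0)) :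
    Tendsto (fun m => eLpNorm (fun x => mollify (k m) f (x + ε m • (x₀ - x)) - f x) 2 volume)
      atTop (𝓝 0) := by
  rw [ENNReal.tendsto_nhds_zero]
  intro η hη
  -- The share `2 ^ d` pays for the operator applied to `f - g`, and one unit each for the error of
  -- `g` and for `f - g` itself.
  have hη' : η / (2 ^ d + 2) ≠ 0 := (ENNReal.div_pos hη.ne' (by finiteness)).ne'
  obtain ⟨g, hgc, hfg, hg, hg2⟩ :=
    hf2.exists_hasCompactSupport_eLpNorm_sub_le ENNReal.ofNat_ne_top hη'
  obtain ⟨δ, hδ, hδη⟩ := eLpNorm_mollify_shrink_sub_le_of_continuous x₀ hg hgc hη'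
  filter_upwards [hε0.eventually (gt_mem_nhds hδ), hk.eventually (gt_mem_nhds hδ)] with m h1 h2
  have hfgm : Measurable (f - g) := hf.sub hg.measurable
  have hmol : ∀ {u : Rd d → ℝ}, MemLp u 2 volume → Measurable (mollify (k m) u) := fun hu =>
    (contDiff_mollify (k m) hu.locallyIntegrable_two).continuous.measurable
  have hsp : Measurable fun x => x + ε m • (x₀ - x) := by fun_prop
  have e : (fun x => mollify (k m) f (x + ε m • (x₀ - x)) - f x) =
      (fun x => mollify (k m) (f - g) (x + ε m • (x₀ - x))) +
      ((fun x => mollify (k m) g (x + ε m • (x₀ - x)) - g x) - (f - g)) := by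
    ext x
    simp only [Pi.add_apply, Pi.sub_apply]
    rw [mollify_sub (k m) hf2.locallyIntegrable_two hg2.locallyIntegrable_two]
    ring
  have m1 : Measurable fun x => mollify (k m) (f - g) (x + ε m • (x₀ - x)) :=
    (hmol (hf2.sub hg2)).comp hsp
  have m2 : Measurable fun x => mollify (k m) g (x + ε m • (x₀ - x)) - g x :=
    ((hmol hg2).comp hsp).sub hg.measurable
  rw [e]
  refine (eLpNorm_add_le m1.aestronglyMeasurable (m2.sub hfgm).aestronglyMeasurable
    one_le_two).trans ?_
  refine (add_le_add_right (eLpNorm_sub_le m2.aestronglyMeasurable hfgm.aestronglyMeasurable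
    one_le_two) _).trans ?_
  have b1 : eLpNorm (fun x => mollify (k m) (f - g) (x + ε m • (x₀ - x))) 2 volume ≤
      2 ^ d * (η / (2 ^ d + 2)) := by
    refine (eLpNorm_comp_shrink_le x₀ (hε m) (hmol (hf2.sub hg2))).trans ?_
    gcongr
    exact (eLpNorm_mollify_le (k m) hfgm).trans hfg
  refine (add_le_add b1 (add_le_add (hδη (k m) (ε m) (hε m) h1 h2) hfg)).trans ?_
  rw [← two_mul, ← add_mul]
  exact ENNReal.mul_div_le

/-- Where the ball of the kernel fits into `B`, the function `t ↦ k (p - t)` is a test function on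
`B`, so the derivative passes from the kernel to `v`. Extension by zero does no harm there, although
it destroys the weak derivative across the boundary of `B`. -/
theorem partialDeriv_mollify_of_hasWeakPartial {B : Set (Rd d)} {i : Fin d}
    {v g : Rd d → ℝ} (h : HasWeakPartial B i v g) (hv : LocallyIntegrable v)
    (hv0 : ∀ x ∉ B, v x = 0) (hg0 : ∀ x ∉ B, g x = 0) (k : ContDiffBump (0 : Rd d)) {p : Rd d}
    (hp : Metric.closedBall p k.rOut ⊆ B) :
    partialDeriv i (mollify k v) p = mollify k g p := by
  set φ : Rd d → ℝ := fun t => k.normed volume (p - t) with hφ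
  have hφs : ContDiff ℝ ∞ φ := k.contDiff_normed.comp (contDiff_const.sub contDiff_id)
  have hφt : tsupport φ ⊆ Metric.closedBall p k.rOut := by
    refine closure_minimal (fun t ht => ?_) Metric.isClosed_closedBall
    have : p - t ∈ Function.support (k.normed (volume : Measure (Rd d))) := ht
    rw [k.support_normed_eq, mem_ball_zero_iff] at this
    rw [Metric.mem_closedBall, dist_comm, dist_eq_norm]
    exact this.le
  have hφc : HasCompactSupport φ :=
    (isCompact_closedBall p k.rOut).of_isClosed_subset isClosed_closure hφt
  have hder : ∀ t, partialDeriv i φ t =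
      - fderiv ℝ (k.normed volume) (p - t) (EuclideanSpace.single i 1) := by
    intro t
    have h1 : HasFDerivAt (fun t : Rd d => p - t) (-ContinuousLinearMap.id ℝ (Rd d)) t :=
      (hasFDerivAt_id t).const_sub p
    have h2 := ((k.contDiff_normed (n := 1) (μ := volume)).differentiable
      one_ne_zero (p - t)).hasFDerivAt.comp t h1
    rw [partialDeriv]
    change fderiv ℝ (k.normed volume ∘ fun t => p - t) t _ = _
    rw [h2.fderiv]
    simp
  have key := h.2.2 φ hφs hφc (hφt.trans hp)
  rw [setIntegral_eq_integral_of_forall_compl_eq_zero (fun x hx => by rw [hv0 x hx, zero_mul]),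
    setIntegral_eq_integral_of_forall_compl_eq_zero (fun x hx => by rw [hg0 x hx, zero_mul])]
    at key
  rw [partialDeriv, fderiv_mollify k hv]
  simp only [hder, mul_neg, integral_neg, neg_inj] at key
  exact key

/-- Smooth functions are dense in `H¹` of a bounded open convex set. -/
theorem exists_smooth_tendsto_of_memH1 {B : Set (Rd d)} (hB : IsOpen B)
    (hconv : Convex ℝ B) (hne : B.Nonempty) {v : Rd d → ℝ} (hv : MemH1 B v) :
    ∃ w : ℕ → Rd d → ℝ, (∀ n, ContDiff ℝ ∞ (w n)) ∧
      Tendsto (fun n => eLpNorm (fun x => w n x - v x) 2 (volume.restrict B)) atTop (𝓝 0) ∧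
      ∀ i, Tendsto (fun n => eLpNorm (fun x => partialDeriv i (w n) x - weakPartial B i v x) 2
        (volume.restrict B)) atTop (𝓝 0) := by
  have hrep : ∀ {u : Rd d → ℝ}, MemLp u 2 (volume.restrict B) → ∃ u' : Rd d → ℝ,
      Measurable u' ∧ MemLp u' 2 volume ∧ u =ᵐ[volume.restrict B] u' ∧ ∀ x ∉ B, u' x = 0 := by
    intro u hu
    have hae : u =ᵐ[volume.restrict B] B.indicator (hu.1.mk u) :=
      hu.1.ae_eq_mk.trans (indicator_ae_eq_restrict hB.measurableSet).symm
    refine ⟨B.indicator (hu.1.mk u), hu.1.stronglyMeasurable_mk.measurable.indicator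
      hB.measurableSet, ?_, hae, fun x hx => indicator_of_notMem hx _⟩
    rw [memLp_indicator_iff_restrict hB.measurableSet]
    exact hu.ae_eq hu.1.ae_eq_mk
  obtain ⟨x₀, h₀⟩ := hne
  obtain ⟨r, hr, hrB⟩ := Metric.nhds_basis_closedBall.mem_iff.1 (hB.mem_nhds h₀)
  obtain ⟨f, hfm, hf2, hvf, hf0⟩ := hrep hv.1
  choose g hgm hg2 hgae hg0 using fun i => hrep (hv.memLp_weakPartial hB i)
  set ε : ℕ → ℝ := fun m => 1 / ((m : ℝ) + 2) with hεdef
  have hεpos : ∀ m, 0 < ε m := fun m => by positivity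
  have hε : ∀ m, ε m ∈ Icc (0 : ℝ) (1 / 2) := fun m => ⟨(hεpos m).le, by
    rw [hεdef]; exact one_div_le_one_div_of_le two_pos (by
      have : (0 : ℝ) ≤ m := by positivity
      linarith)⟩
  have hε0 : Tendsto ε atTop (𝓝 0) := by
    refine tendsto_const_nhds.div_atTop ?_
    exact tendsto_atTop_add_const_right _ _ tendsto_natCast_atTop_atTop
  -- The kernel radius `ε r` matches the shrinking: `B` contains the ball of radius `r` about `x₀`,
  -- hence by convexity the ball of radius `ε r` about `x + ε (x₀ - x)` for every `x ∈ B`. The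
  -- mollifier therefore sees only values inside `B`.
  let k : ℕ → ContDiffBump (0 : Rd d) := fun m =>
    ⟨ε m * r / 2, ε m * r, by have := hεpos m; positivity, by
      have := mul_pos (hεpos m) hr; linarith⟩
  have hk0 : Tendsto (fun m => (k m).rOut) atTop (𝓝 0) := by
    simpa using hε0.mul_const r
  have hloc : LocallyIntegrable f := hf2.locallyIntegrable_two
  have hsm : ∀ m, ContDiff ℝ ∞ (mollify (k m) f) := fun m => contDiff_mollify (k m) hloc
  have hps : ∀ m, ContDiff ℝ ∞ fun x : Rd d => x + ε m • (x₀ - x) := fun m => by fun_prop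
  refine ⟨fun m x => mollify (k m) f (x + ε m • (x₀ - x)), fun m => (hsm m).comp (hps m), ?_, ?_⟩
  · have h1 := tendsto_eLpNorm_mollify_shrink x₀ hfm hf2 hε hε0 hk0
    refine tendsto_of_tendsto_of_tendsto_of_le_of_le tendsto_const_nhds h1 (fun _ => zero_le)
      fun m => ?_
    have h2 : (fun x => mollify (k m) f (x + ε m • (x₀ - x)) - v x) =ᵐ[volume.restrict B]
        fun x => mollify (k m) f (x + ε m • (x₀ - x)) - f x := by
      filter_upwards [hvf] with x hx; rw [hx]
    rw [eLpNorm_congr_ae h2]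
    exact eLpNorm_mono_measure _ Measure.restrict_le_self
  · intro i
    have h1 := tendsto_eLpNorm_mollify_shrink x₀ (hgm i) (hg2 i) hε hε0 hk0
    have hweak : HasWeakPartial B i f (g i) := (hv.hasWeakPartial i).congr hvf (hgae i)
    have hderiv : ∀ m, ∀ x ∈ B, partialDeriv i
        (fun x => mollify (k m) f (x + ε m • (x₀ - x))) x =
        (1 - ε m) * mollify (k m) (g i) (x + ε m • (x₀ - x)) := by
      intro m x hx
      have hball : Metric.closedBall (x + ε m • (x₀ - x)) (k m).rOut ⊆ B := by
        intro y hy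
        rw [Metric.mem_closedBall, dist_eq_norm] at hy
        have hy2 : ‖y - (x + ε m • (x₀ - x))‖ ≤ ε m * r := hy
        set u := (ε m)⁻¹ • (y - (x + ε m • (x₀ - x))) with hu
        have hur : x₀ + u ∈ B := hrB (by
          rw [Metric.mem_closedBall, dist_eq_norm, add_sub_cancel_left, hu, norm_smul, norm_inv,
            Real.norm_of_nonneg (hεpos m).le, inv_mul_le_iff₀ (hεpos m)]
          exact hy2)
        have := hconv hx hur (a := 1 - ε m) (b := ε m) (by linarith [(hε m).2]) (hεpos m).le
          (by ring)
        convert this using 1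
        rw [smul_add, hu, smul_smul, mul_inv_cancel₀ (hεpos m).ne', one_smul, smul_sub, sub_smul,
          one_smul]
        abel
      rw [← partialDeriv_mollify_of_hasWeakPartial hweak hloc hf0 (hg0 i) (k m) hball]
      have hd : HasFDerivAt (fun x : Rd d => x + ε m • (x₀ - x))
          ((1 - ε m) • ContinuousLinearMap.id ℝ (Rd d)) x := by
        have := (hasFDerivAt_id (𝕜 := ℝ) x).add
          (((hasFDerivAt_id (𝕜 := ℝ) x).const_sub x₀).const_smul (ε m))
        refine this.congr_fderiv ?_
        ext y : 1
        simp [sub_eq_add_neg, add_smul]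
      have h2 := ((hsm m).differentiable (by simp) (x + ε m • (x₀ - x))).hasFDerivAt.comp x hd
      rw [partialDeriv, partialDeriv]
      change fderiv ℝ (mollify (k m) f ∘ fun x : Rd d => x + ε m • (x₀ - x)) x _ = _
      rw [h2.fderiv]
      simp
    -- The chain rule multiplies the mollified derivative by `1 - ε`; the second summand pays for
    -- the missing `ε g`.
    have h3 : Tendsto (fun m => eLpNorm (fun x => mollify (k m) (g i) (x + ε m • (x₀ - x)) - g i x)
        2 volume + ENNReal.ofReal (ε m) * eLpNorm (g i) 2 volume) atTop (𝓝 0) := by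
      have h4 : Tendsto (fun m => ENNReal.ofReal (ε m) * eLpNorm (g i) 2 volume) atTop
          (𝓝 (ENNReal.ofReal 0 * eLpNorm (g i) 2 volume)) :=
        ENNReal.Tendsto.mul_const ((ENNReal.continuous_ofReal.tendsto 0).comp hε0)
          (Or.inr (hg2 i).eLpNorm_ne_top)
      simpa using h1.add h4
    refine tendsto_of_tendsto_of_tendsto_of_le_of_le tendsto_const_nhds h3 (fun _ => zero_le)
      fun m => ?_
    have h2 : (fun x => partialDeriv i (fun x => mollify (k m) f (x + ε m • (x₀ - x))) x -
        weakPartial B i v x) =ᵐ[volume.restrict B]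
        (fun x => (1 - ε m) * (mollify (k m) (g i) (x + ε m • (x₀ - x)) - g i x)) -
          fun x => ε m * g i x := by
      filter_upwards [hgae i, ae_restrict_mem hB.measurableSet] with x hx hxB
      simp only [Pi.sub_apply]
      rw [hx, hderiv m x hxB]; ring
    have hmm : Measurable fun x => mollify (k m) (g i) (x + ε m • (x₀ - x)) - g i x :=
      ((contDiff_mollify (k m) (hg2 i).locallyIntegrable_two).continuous.measurable.comp
        (by fun_prop)).sub (hgm i)
    simp only
    rw [eLpNorm_congr_ae h2]
    refine (eLpNorm_mono_measure _ Measure.restrict_le_self).trans ?_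
    refine (eLpNorm_sub_le (hmm.const_mul _).aestronglyMeasurable
      ((hgm i).const_mul _).aestronglyMeasurable one_le_two).trans ?_
    refine add_le_add ?_ ?_
    · refine eLpNorm_mono fun x => ?_
      rw [norm_mul]
      refine mul_le_of_le_one_left (norm_nonneg _) ?_
      rw [Real.norm_of_nonneg (by linarith [(hε m).2])]
      linarith [(hε m).1]
    · have : (fun x => ε m * g i x) = ε m • g i := rfl
      rw [this, eLpNorm_const_smul, Real.enorm_of_nonneg (hε m).1]

end mollify

/-! ### Traces -/

section TendstoL2

variable {α : Type*} [MeasurableSpace α] {μ ν : Measure α} {F G : ℕ → α → ℝ} {f g : α → ℝ}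

/-- Convergence in `L²(μ)`. -/
def TendstoL2 (μ : Measure α) (F : ℕ → α → ℝ) (f : α → ℝ) : Prop :=
  Tendsto (fun k => eLpNorm (fun x => F k x - f x) 2 μ) atTop (𝓝 0)

namespace TendstoL2

theorem mono_measure (h : TendstoL2 μ F f) (hν : ν ≤ μ) : TendstoL2 ν F f :=
  tendsto_of_tendsto_of_tendsto_of_le_of_le tendsto_const_nhds h (fun _ => zero_le)
    fun _ => eLpNorm_mono_measure _ hν

theorem congr (h : TendstoL2 μ F f) (hF : ∀ k, F k =ᵐ[μ] G k) (hf : f =ᵐ[μ] g) :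
    TendstoL2 μ G g := by
  refine Tendsto.congr (fun k => eLpNorm_congr_ae ?_) h
  filter_upwards [hF k, hf] with x h1 h2
  rw [h1, h2]

theorem add (hF : ∀ k, MemLp (F k) 2 μ) (hG : ∀ k, MemLp (G k) 2 μ) (hf : MemLp f 2 μ)
    (hg : MemLp g 2 μ) (h : TendstoL2 μ F f) (h' : TendstoL2 μ G g) :
    TendstoL2 μ (fun k x => F k x + G k x) fun x => f x + g x := by
  have := Tendsto.add h h'
  rw [add_zero] at this
  refine tendsto_of_tendsto_of_tendsto_of_le_of_le tendsto_const_nhds this (fun _ => zero_le)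
    fun k => ?_
  have e : (fun x => F k x + G k x - (f x + g x)) =
      (fun x => F k x - f x) + fun x => G k x - g x := by
    ext x; simp only [Pi.add_apply]; ring
  simp only
  rw [e]
  exact eLpNorm_add_le ((hF k).sub hf).1 ((hG k).sub hg).1 one_le_two

theorem const_mul (c : ℝ) (h : TendstoL2 μ F f) :
    TendstoL2 μ (fun k x => c * F k x) fun x => c * f x := by
  have h1 := ENNReal.Tendsto.const_mul h (Or.inr (enorm_ne_top (x := c)))
  rw [mul_zero] at h1
  refine Tendsto.congr (fun k => ?_) h1
  rw [← eLpNorm_const_smul]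
  congr 1
  ext x
  simp [mul_sub]

theorem unique (hF : ∀ k, MemLp (F k) 2 μ) (hf : MemLp f 2 μ) (hg : MemLp g 2 μ)
    (h : TendstoL2 μ F f) (h' : TendstoL2 μ F g) : f =ᵐ[μ] g := by
  have h1 := (Lp.tendsto_Lp_iff_tendsto_eLpNorm'' F hF f hf).2 h
  have h2 := (Lp.tendsto_Lp_iff_tendsto_eLpNorm'' F hF g hg).2 h'
  have h3 := tendsto_nhds_unique h1 h2
  exact (MemLp.toLp_eq_toLp_iff hf hg).1 h3

theorem tendsto_integral_mul (hF : ∀ k, MemLp (F k) 2 μ) (hG : ∀ k, MemLp (G k) 2 μ)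
    (hf : MemLp f 2 μ) (hg : MemLp g 2 μ) (h : TendstoL2 μ F f) (h' : TendstoL2 μ G g) :
    Tendsto (fun k => ∫ x, F k x * G k x ∂μ) atTop (𝓝 (∫ x, f x * g x ∂μ)) :=
  _root_.tendsto_integral_mul hf hg hF hG h h'

theorem tendsto_integral_sq (hF : ∀ k, MemLp (F k) 2 μ)
    (hf : MemLp f 2 μ) (h : TendstoL2 μ F f) :
    Tendsto (fun k => ∫ x, F k x ^ 2 ∂μ) atTop (𝓝 (∫ x, f x ^ 2 ∂μ)) := by
  simp_rw [sq]
  exact h.tendsto_integral_mul hF hF hf hf h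

end TendstoL2

end TendstoL2

theorem MeasureTheory.MemLp.ae_eq_zero_of_integral_sq_le {α : Type*} [MeasurableSpace α]
    {μ : Measure α} {f : α → ℝ} (hf : MemLp f 2 μ) (h : ∫ x, f x ^ 2 ∂μ ≤ 0) : f =ᵐ[μ] 0 := by
  have h0 : ∫ x, f x ^ 2 ∂μ = 0 := le_antisymm h (integral_nonneg fun x => sq_nonneg _)
  rw [integral_eq_zero_iff_of_nonneg (fun x => sq_nonneg _) hf.integrable_sq] at h0
  filter_upwards [h0] with x hx
  simpa using hx

section partialDeriv

variable {d : ℕ} {v w : Rd d → ℝ}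

theorem partialDeriv_add (hv : ContDiff ℝ ∞ v) (hw : ContDiff ℝ ∞ w) (i : Fin d) (x : Rd d) :
    partialDeriv i (fun y => v y + w y) x = partialDeriv i v x + partialDeriv i w x := by
  rw [partialDeriv, fderiv_fun_add (hv.differentiable (by simp) x)
    (hw.differentiable (by simp) x)]
  rfl

theorem partialDeriv_const_mul (hv : ContDiff ℝ ∞ v) (c : ℝ) (i : Fin d) (x : Rd d) :
    partialDeriv i (fun y => c * v y) x = c * partialDeriv i v x := by
  rw [partialDeriv, fderiv_const_mul (hv.differentiable (by simp) x)]
  rfl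

theorem partialDeriv_mul (hv : ContDiff ℝ ∞ v) (hw : ContDiff ℝ ∞ w) (i : Fin d) (x : Rd d) :
    partialDeriv i (fun y => v y * w y) x = v x * partialDeriv i w x + w x * partialDeriv i v x := by
  rw [partialDeriv, fderiv_fun_mul (hv.differentiable (by simp) x)
    (hw.differentiable (by simp) x)]
  rfl

theorem partialDeriv_sub (hv : ContDiff ℝ ∞ v) (hw : ContDiff ℝ ∞ w) (i : Fin d) (x : Rd d) :
    partialDeriv i (fun y => v y - w y) x = partialDeriv i v x - partialDeriv i w x := by
  rw [partialDeriv, fderiv_fun_sub (hv.differentiable (by simp) x)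
    (hw.differentiable (by simp) x)]
  rfl

end partialDeriv

namespace IsFaceted

variable {d : ℕ} {ι : Type*} [Fintype ι] {K : Set (Rd d)} {e : ι → Set (Rd d)} {n : ι → Rd d}
  {v v' T T' : Rd d → ℝ}

omit [Fintype ι] in
theorem memLp_contDiff (h : IsFaceted K e n) {w : Rd d → ℝ} (hw : ContDiff ℝ ∞ w) :
    MemLp w 2 (volume.restrict K) := h.memLp_of_continuous hw.continuous

omit [Fintype ι] in
theorem memLp_partialDeriv (h : IsFaceted K e n) {w : Rd d → ℝ} (hw : ContDiff ℝ ∞ w)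
    (i : Fin d) : MemLp (partialDeriv i w) 2 (volume.restrict K) :=
  h.memLp_of_continuous (contDiff_partialDeriv hw i).continuous

theorem memLp_frontier (h : IsFaceted K e n) (hd : 1 ≤ d) {w : Rd d → ℝ}
    (hw : ContDiff ℝ ∞ w) : MemLp w 2 ((surf d).restrict (frontier K)) :=
  h.memLp_frontier_of_continuous hd hw.continuous

theorem isTrace_add (h : IsFaceted K e n) (hd : 1 ≤ d) (hv : MemH1 K v) (hv' : MemH1 K v')
    (hT : IsTrace K v T) (hT' : IsTrace K v' T') :
    IsTrace K (fun x => v x + v' x) fun x => T x + T' x := by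
  obtain ⟨hT2, w, hw, h0, h1, h2⟩ := hT
  obtain ⟨hT2', w', hw', h0', h1', h2'⟩ := hT'
  refine ⟨hT2.add hT2', fun m x => w m x + w' m x, fun m => (hw m).add (hw' m), ?_, fun i => ?_, ?_⟩
  · exact TendstoL2.add (fun m => h.memLp_contDiff (hw m)) (fun m => h.memLp_contDiff (hw' m))
      hv.1 hv'.1 h0 h0'
  · refine TendstoL2.congr (TendstoL2.add (fun m => h.memLp_partialDeriv (hw m) i)
      (fun m => h.memLp_partialDeriv (hw' m) i) (hv.memLp_weakPartial h.isOpen i)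
      (hv'.memLp_weakPartial h.isOpen i) (h1 i) (h1' i))
      (fun m => Eventually.of_forall fun x => ?_) (hv.weakPartial_add h.isOpen hv' i).symm
    exact (partialDeriv_add (hw m) (hw' m) i x).symm
  · exact TendstoL2.add (fun m => h.memLp_frontier hd (hw m))
      (fun m => h.memLp_frontier hd (hw' m)) hT2 hT2' h2 h2'

omit [Fintype ι] in
theorem isTrace_const_mul (h : IsFaceted K e n) (hv : MemH1 K v) (c : ℝ) (hT : IsTrace K v T) :
    IsTrace K (fun x => c * v x) fun x => c * T x := by
  obtain ⟨hT2, w, hw, h0, h1, h2⟩ := hT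
  refine ⟨hT2.const_mul c, fun m x => c * w m x, fun m => contDiff_const.mul (hw m),
    TendstoL2.const_mul c h0, fun i => ?_, TendstoL2.const_mul c h2⟩
  refine TendstoL2.congr (TendstoL2.const_mul c (h1 i))
    (fun m => Eventually.of_forall fun x => ?_) (hv.weakPartial_const_mul h.isOpen c i).symm
  exact (partialDeriv_const_mul (hw m) c i x).symm

omit [Fintype ι] in
theorem isTrace_congr (h : IsFaceted K e n) (hv : v =ᵐ[volume.restrict K] v')
    (hT : IsTrace K v T) : IsTrace K v' T := by
  obtain ⟨hT2, w, hw, h0, h1, h2⟩ := hT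
  exact ⟨hT2, w, hw, TendstoL2.congr h0 (fun _ => EventuallyEq.rfl) hv, fun i =>
    TendstoL2.congr (h1 i) (fun _ => EventuallyEq.rfl) (weakPartial_congr_ae h.isOpen hv), h2⟩

theorem exists_trace_bound (h : IsFaceted K e n) (hd : 1 ≤ d) :
    ∃ C : ℝ, 0 ≤ C ∧ ∀ v T : Rd d → ℝ, MemH1 K v → IsTrace K v T →
      ∫ x in frontier K, T x ^ 2 ∂(surf d) ≤
        C * ((∫ x in K, v x ^ 2) + ∑ i, ∫ x in K, weakPartial K i v x ^ 2) := by
  obtain ⟨C, hC0, hC⟩ := h.exists_trace_inequality_sq hd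
  refine ⟨C, hC0, fun v T hv hT => ?_⟩
  obtain ⟨hT2, w, hw, h0, h1, h2⟩ := hT
  have t2 := TendstoL2.tendsto_integral_sq (fun m => h.memLp_frontier hd (hw m)) hT2 h2
  have t0 := TendstoL2.tendsto_integral_sq (fun m => h.memLp_contDiff (hw m)) hv.1 h0
  have t1 := fun i => TendstoL2.tendsto_integral_sq (fun m => h.memLp_partialDeriv (hw m) i)
    (hv.memLp_weakPartial h.isOpen i) (h1 i)
  exact le_of_tendsto_of_tendsto' t2
    ((t0.add (tendsto_finsetSum _ fun i _ => t1 i)).const_mul C)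
    fun m => hC (w m) ((hw m).of_le (by simp))

/-- The two traces may come from different approximating sequences. Their difference is a trace of
zero, which the trace bound forces to vanish. -/
theorem isTrace_unique (h : IsFaceted K e n) (hd : 1 ≤ d) (hv : MemH1 K v)
    (hT : IsTrace K v T) (hT' : IsTrace K v T') :
    T =ᵐ[(surf d).restrict (frontier K)] T' := by
  obtain ⟨C, -, hC⟩ := h.exists_trace_bound hd
  have h1 := h.isTrace_add hd hv (hv.const_mul (-1)) hT (h.isTrace_const_mul hv (-1) hT')
  have h0 : (fun x => v x + -1 * v x) = 0 := by ext x; simp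
  rw [h0] at h1
  have h2 := hC _ _ MemH1.zero h1
  have h3 : ∀ i, ∫ x in K, weakPartial K i (0 : Rd d → ℝ) x ^ 2 = 0 := by
    intro i
    rw [integral_congr_ae (g := fun _ => (0 : ℝ)), integral_zero]
    filter_upwards [weakPartial_zero h.isOpen i] with x hx
    simp [hx]
  simp only [h3, Pi.zero_apply] at h2
  have h4 := h1.1.ae_eq_zero_of_integral_sq_le (h2.trans (by simp))
  filter_upwards [h4] with x hx
  simp only [Pi.zero_apply] at hx
  linarith

theorem tendsto_frontier_zero (h : IsFaceted K e n) (hd : 1 ≤ d) {y : ℕ → Rd d → ℝ}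
    (hy : ∀ m, ContDiff ℝ ∞ (y m))
    (h0 : Tendsto (fun m => eLpNorm (y m) 2 (volume.restrict K)) atTop (𝓝 0))
    (h1 : ∀ i, Tendsto (fun m => eLpNorm (partialDeriv i (y m)) 2 (volume.restrict K)) atTop (𝓝 0)) :
    Tendsto (fun m => eLpNorm (y m) 2 ((surf d).restrict (frontier K))) atTop (𝓝 0) := by
  obtain ⟨C, hC0, hC⟩ := h.exists_trace_inequality hd
  have h2 := ENNReal.Tendsto.const_mul (h0.add (tendsto_finsetSum Finset.univ fun i _ => h1 i))
    (Or.inr hC0)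
  simp only [Finset.sum_const_zero, add_zero, mul_zero] at h2
  exact tendsto_of_tendsto_of_tendsto_of_le_of_le tendsto_const_nhds h2 (fun _ => zero_le)
    fun m => hC (y m) ((hy m).of_le (by simp))

/-- Existence of traces. -/
theorem exists_isTrace (h : IsFaceted K e n) (hd : 1 ≤ d) (hv : MemH1 K v) :
    ∃ T, IsTrace K v T := by
  obtain ⟨w, hw, h0, h1⟩ := exists_smooth_tendsto_of_memH1 h.isOpen h.convex h.nonempty hv
  obtain ⟨C, hC0, hC⟩ := h.exists_trace_inequality hd
  have hwf := fun m => h.memLp_frontier hd (hw m)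
  set δ : ℕ → ℝ≥0∞ := fun m => eLpNorm (fun x => w m x - v x) 2 (volume.restrict K) +
    ∑ i, eLpNorm (fun x => partialDeriv i (w m) x - weakPartial K i v x) 2 (volume.restrict K)
    with hδ
  have hδ0 : Tendsto (fun m => C * δ m) atTop (𝓝 0) := by
    have := ENNReal.Tendsto.const_mul (h0.add (tendsto_finsetSum Finset.univ fun i _ => h1 i))
      (Or.inr hC0)
    simpa using this
  have htri : ∀ {F G f : Rd d → ℝ}, MemLp F 2 (volume.restrict K) → MemLp G 2 (volume.restrict K) →
      MemLp f 2 (volume.restrict K) → eLpNorm (fun x => F x - G x) 2 (volume.restrict K) ≤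
        eLpNorm (fun x => F x - f x) 2 (volume.restrict K) +
        eLpNorm (fun x => G x - f x) 2 (volume.restrict K) := by
    intro F G f hF hG hf
    have e : (fun x => F x - G x) = (fun x => F x - f x) - fun x => G x - f x := by
      ext x; simp
    rw [e]
    exact eLpNorm_sub_le (hF.sub hf).1 (hG.sub hf).1 one_le_two
  -- By the trace inequality for differences, boundary values of smooth functions converging in
  -- $H^1(K)$ form a Cauchy sequence in $L^2(\partial K)$; its limit is the trace.
  have hdist : ∀ m m', edist ((hwf m).toLp (w m)) ((hwf m').toLp (w m')) ≤ C * δ m + C * δ m' := by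
    intro m m'
    rw [Lp.edist_toLp_toLp, ← mul_add]
    refine (hC (w m - w m') (((hw m).sub (hw m')).of_le (by simp))).trans ?_
    refine mul_le_mul' le_rfl ?_
    have e1 : ∀ i, partialDeriv i (w m - w m') =
        fun x => partialDeriv i (w m) x - partialDeriv i (w m') x := fun i =>
      funext fun x => partialDeriv_sub (hw m) (hw m') i x
    simp only [e1, hδ]
    rw [add_add_add_comm, ← Finset.sum_add_distrib]
    refine add_le_add (htri (h.memLp_contDiff (hw m)) (h.memLp_contDiff (hw m')) hv.1)
      (Finset.sum_le_sum fun i _ => htri (h.memLp_partialDeriv (hw m) i)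
        (h.memLp_partialDeriv (hw m') i) (hv.memLp_weakPartial h.isOpen i))
  have hcauchy : CauchySeq fun m => (hwf m).toLp (w m) := by
    rw [EMetric.cauchySeq_iff]
    intro ε hε
    obtain ⟨N, hN⟩ := eventually_atTop.1 (hδ0.eventually (gt_mem_nhds (ENNReal.half_pos hε.ne')))
    refine ⟨N, fun m hm m' hm' => (hdist m m').trans_lt ?_⟩
    exact (ENNReal.add_lt_add (hN m hm) (hN m' hm')).trans_eq (ENNReal.add_halves ε)
  obtain ⟨L, hL⟩ := cauchySeq_tendsto_of_complete hcauchy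
  refine ⟨L, Lp.memLp L, w, hw, h0, h1, ?_⟩
  have hL' := hL
  rw [← Lp.toLp_coeFn L (Lp.memLp L)] at hL'
  exact (Lp.tendsto_Lp_iff_tendsto_eLpNorm'' w hwf L (Lp.memLp L)).1 hL'

theorem isTrace_trace (h : IsFaceted K e n) (hd : 1 ≤ d) (hv : MemH1 K v) :
    IsTrace K v (trace K v) := by
  have hex := h.exists_isTrace hd hv
  rw [trace, dif_pos hex]
  exact hex.choose_spec

theorem trace_eq_of_isTrace (h : IsFaceted K e n) (hd : 1 ≤ d) (hv : MemH1 K v)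
    (hT : IsTrace K v T) : trace K v =ᵐ[(surf d).restrict (frontier K)] T :=
  h.isTrace_unique hd hv (h.isTrace_trace hd hv) hT

theorem trace_congr (h : IsFaceted K e n) (hd : 1 ≤ d) (hv : MemH1 K v)
    (hvv : v =ᵐ[volume.restrict K] v') :
    trace K v =ᵐ[(surf d).restrict (frontier K)] trace K v' :=
  h.trace_eq_of_isTrace hd hv (h.isTrace_congr hvv.symm (h.isTrace_trace hd (hv.congr hvv)))

theorem trace_add (h : IsFaceted K e n) (hd : 1 ≤ d) (hv : MemH1 K v) (hv' : MemH1 K v') :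
    trace K (fun x => v x + v' x) =ᵐ[(surf d).restrict (frontier K)]
      fun x => trace K v x + trace K v' x :=
  h.trace_eq_of_isTrace hd (hv.add hv')
    (h.isTrace_add hd hv hv' (h.isTrace_trace hd hv) (h.isTrace_trace hd hv'))

theorem trace_const_mul (h : IsFaceted K e n) (hd : 1 ≤ d) (hv : MemH1 K v) (c : ℝ) :
    trace K (fun x => c * v x) =ᵐ[(surf d).restrict (frontier K)] fun x => c * trace K v x :=
  h.trace_eq_of_isTrace hd (hv.const_mul c)
    (h.isTrace_const_mul hv c (h.isTrace_trace hd hv))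

theorem memLp_trace (h : IsFaceted K e n) (hd : 1 ≤ d) (hv : MemH1 K v) :
    MemLp (trace K v) 2 ((surf d).restrict (frontier K)) := (h.isTrace_trace hd hv).1

/-- Green's formula in `H¹`. -/
theorem green (h : IsFaceted K e n) (hd : 1 ≤ d) {p q : Rd d → ℝ} (hp : MemH1 K p)
    (hq : MemH1 K q) (i : Fin d) :
    (∫ x in K, p x * weakPartial K i q x) + ∫ x in K, weakPartial K i p x * q x =
      ∑ j, n j i * ∫ x in e j, trace K p x * trace K q x ∂(surf d) := by
  obtain ⟨hP, w, hw, w0, w1, w2⟩ := h.isTrace_trace hd hp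
  obtain ⟨hQ, z, hz, z0, z1, z2⟩ := h.isTrace_trace hd hq
  have hle : ∀ j, (surf d).restrict (e j) ≤ (surf d).restrict (frontier K) := fun j =>
    Measure.restrict_mono (h.face_subset j) le_rfl
  have t1 := TendstoL2.tendsto_integral_mul (fun m => h.memLp_contDiff (hw m))
    (fun m => h.memLp_partialDeriv (hz m) i) hp.1 (hq.memLp_weakPartial h.isOpen i) w0 (z1 i)
  have t2 := TendstoL2.tendsto_integral_mul (fun m => h.memLp_partialDeriv (hw m) i)
    (fun m => h.memLp_contDiff (hz m)) (hp.memLp_weakPartial h.isOpen i) hq.1 (w1 i) z0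
  have t3 := fun j => TendstoL2.tendsto_integral_mul
    (fun m => (h.memLp_frontier hd (hw m)).mono_measure (hle j))
    (fun m => (h.memLp_frontier hd (hz m)).mono_measure (hle j)) (hP.mono_measure (hle j))
    (hQ.mono_measure (hle j)) (TendstoL2.mono_measure w2 (hle j))
    (TendstoL2.mono_measure z2 (hle j))
  -- For the smooth approximations the formula is the divergence theorem for their product. Every
  -- integral is an `L²` pairing and passes to the limit.
  refine tendsto_nhds_unique (t1.add t2) ?_
  refine Tendsto.congr (fun m => ?_)
    (tendsto_finsetSum Finset.univ fun j _ => (t3 j).const_mul (n j i))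
  have hdiv := h.divergence hd (((hw m).mul (hz m)).of_le (by simp)) (EuclideanSpace.single i 1)
  have hi1 : IntegrableOn (fun x => w m x * partialDeriv i (z m) x) K :=
    h.integrableOn_of_continuous ((hw m).continuous.mul (contDiff_partialDeriv (hz m) i).continuous)
  have hi2 : IntegrableOn (fun x => partialDeriv i (w m) x * z m x) K :=
    h.integrableOn_of_continuous ((contDiff_partialDeriv (hw m) i).continuous.mul (hz m).continuous)
  rw [← integral_add hi1 hi2]
  simp only [EuclideanSpace.inner_single_right, one_mul, conj_trivial] at hdiv
  rw [← hdiv]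
  congr 1 with x
  have := partialDeriv_mul (hw m) (hz m) i x
  rw [partialDeriv] at this
  rw [this]; ring

end IsFaceted

/-! ### Traces of functions on a larger domain -/

namespace TendstoL2

variable {α : Type*} [MeasurableSpace α] {μ : Measure α} {F G : ℕ → α → ℝ} {f : α → ℝ}

theorem tendsto_sub_of_same (hF : ∀ k, AEStronglyMeasurable (F k) μ)
    (hG : ∀ k, AEStronglyMeasurable (G k) μ) (hf : AEStronglyMeasurable f μ)
    (h : TendstoL2 μ F f) (h' : TendstoL2 μ G f) :
    Tendsto (fun k => eLpNorm (fun x => F k x - G k x) 2 μ) atTop (𝓝 0) := by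
  have := Tendsto.add h h'
  rw [add_zero] at this
  refine tendsto_of_tendsto_of_tendsto_of_le_of_le tendsto_const_nhds this (fun _ => zero_le)
    fun k => ?_
  have e : (fun x => F k x - G k x) = (fun x => F k x - f x) - fun x => G k x - f x := by
    ext x; simp
  simp only
  rw [e]
  exact eLpNorm_sub_le ((hF k).sub hf) ((hG k).sub hf) one_le_two

theorem of_tendsto_sub (hF : ∀ k, AEStronglyMeasurable (F k) μ)
    (hG : ∀ k, AEStronglyMeasurable (G k) μ) (hf : AEStronglyMeasurable f μ)
    (h : Tendsto (fun k => eLpNorm (fun x => F k x - G k x) 2 μ) atTop (𝓝 0))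
    (h' : TendstoL2 μ G f) : TendstoL2 μ F f := by
  have := Tendsto.add h h'
  rw [add_zero] at this
  refine tendsto_of_tendsto_of_tendsto_of_le_of_le tendsto_const_nhds this (fun _ => zero_le)
    fun k => ?_
  have e : (fun x => F k x - f x) = (fun x => F k x - G k x) + fun x => G k x - f x := by
    ext x; simp
  simp only
  rw [e]
  exact eLpNorm_add_le ((hF k).sub (hG k)) ((hG k).sub hf) one_le_two

end TendstoL2

namespace IsFaceted

variable {d : ℕ} {ι : Type*} [Fintype ι] {K : Set (Rd d)} {e : ι → Set (Rd d)} {n : ι → Rd d}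
  {Ω : Set (Rd d)} {u : Rd d → ℝ}

/-- Smooth functions which converge in `H¹(K)` near a ball converge to the trace on the part of
the boundary in that ball. -/
theorem tendsto_trace_local (h : IsFaceted K e n) (hd : 1 ≤ d) (hu : MemH1 K u) {x : Rd d}
    {r : ℝ} (hr : 0 < r) {w : ℕ → Rd d → ℝ} (hw : ∀ m, ContDiff ℝ ∞ (w m))
    (w0 : TendstoL2 (volume.restrict (K ∩ Metric.ball x r)) w u)
    (w1 : ∀ i, TendstoL2 (volume.restrict (K ∩ Metric.ball x r))
      (fun m => partialDeriv i (w m)) (weakPartial K i u)) :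
    TendstoL2 ((surf d).restrict (frontier K ∩ Metric.ball x (r / 2))) w (trace K u) := by
  obtain ⟨hT, z, hz, z0, z1, z2⟩ := h.isTrace_trace hd hu
  set B := Metric.ball x r with hB
  have hBm : MeasurableSet B := Metric.isOpen_ball.measurableSet
  have hle : volume.restrict (K ∩ B) ≤ volume.restrict K :=
    Measure.restrict_mono inter_subset_left le_rfl
  -- The cutoff is `1` on the ball of radius `r / 2` and vanishes beyond `3 r / 4`. The difference
  -- `D` of the given and the global approximations tends to zero in $H^1$ only near the ball; `χ D`
  -- does so on all of `K`, where the trace inequality applies.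
  let χ : ContDiffBump x := ⟨r / 2, 3 * r / 4, by positivity, by linarith⟩
  have hχ : ContDiff ℝ ∞ χ := χ.contDiff
  have hχB : ∀ y ∉ B, χ y = 0 := fun y hy => χ.zero_of_le_dist (by
    rw [hB, Metric.mem_ball, not_lt] at hy
    change 3 * r / 4 ≤ _
    linarith)
  have hχtB : tsupport χ ⊆ B := by
    rw [χ.tsupport_eq]
    exact Metric.closedBall_subset_ball (by change 3 * r / 4 < r; linarith)
  have hχ'B : ∀ i, ∀ y ∉ B, partialDeriv i χ y = 0 := fun i y hy =>
    image_eq_zero_of_notMem_tsupport fun hy' => hy (hχtB (partialDeriv_tsupport_subset i χ hy'))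
  have hbound : ∀ i, ∃ M : ℝ, ∀ y, ‖partialDeriv i χ y‖ ≤ M := fun i =>
    (hasCompactSupport_partialDeriv χ.hasCompactSupport i).exists_bound_of_continuous
      (contDiff_partialDeriv hχ i).continuous
  set D : ℕ → Rd d → ℝ := fun m y => w m y - z m y with hDdef
  have hDs : ∀ m, ContDiff ℝ ∞ (D m) := fun m => (hw m).sub (hz m)
  have hmeas : ∀ {f : Rd d → ℝ} {μ : Measure (Rd d)}, ContDiff ℝ ∞ f → AEStronglyMeasurable f μ :=
    fun hf => hf.continuous.aestronglyMeasurable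
  have hD0 : Tendsto (fun m => eLpNorm (D m) 2 (volume.restrict (K ∩ B))) atTop (𝓝 0) :=
    TendstoL2.tendsto_sub_of_same (fun m => hmeas (hw m)) (fun m => hmeas (hz m))
      (hu.1.mono_measure hle).1 w0 (TendstoL2.mono_measure z0 hle)
  have hD1 : ∀ i, Tendsto (fun m => eLpNorm (partialDeriv i (D m)) 2 (volume.restrict (K ∩ B)))
      atTop (𝓝 0) := by
    intro i
    have := TendstoL2.tendsto_sub_of_same (fun m => hmeas (contDiff_partialDeriv (hw m) i))
      (fun m => hmeas (contDiff_partialDeriv (hz m) i))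
      ((hu.memLp_weakPartial h.isOpen i).mono_measure hle).1 (w1 i)
      (TendstoL2.mono_measure (z1 i) hle)
    refine Tendsto.congr (fun m => ?_) this
    congr 1
    ext y
    exact (partialDeriv_sub (hw m) (hz m) i y).symm
  have hcut : ∀ {f : Rd d → ℝ}, (∀ y ∉ B, f y = 0) →
      eLpNorm f 2 (volume.restrict K) = eLpNorm f 2 (volume.restrict (K ∩ B)) := by
    intro f hf
    have : f = B.indicator f := by
      ext y
      by_cases hy : y ∈ B
      · rw [indicator_of_mem hy]
      · rw [indicator_of_notMem hy, hf y hy]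
    conv_lhs => rw [this]
    rw [eLpNorm_indicator_eq_eLpNorm_restrict hBm, Measure.restrict_restrict hBm, inter_comm]
  have hmul : ∀ {f g : Rd d → ℝ} {M : ℝ}, (∀ y, ‖f y‖ ≤ M) →
      eLpNorm (fun y => f y * g y) 2 (volume.restrict (K ∩ B)) ≤
        ENNReal.ofReal M * eLpNorm g 2 (volume.restrict (K ∩ B)) := by
    intro f g M hM
    refine eLpNorm_le_mul_eLpNorm_of_ae_le_mul (Eventually.of_forall fun y => ?_) 2
    rw [norm_mul]
    exact mul_le_mul_of_nonneg_right (hM y) (norm_nonneg _)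
  have hχ1 : ∀ y, ‖χ y‖ ≤ 1 := fun y => by
    rw [Real.norm_of_nonneg χ.nonneg]; exact χ.le_one
  have hlim : ∀ {a : ℕ → ℝ≥0∞} (M : ℝ), Tendsto a atTop (𝓝 0) →
      Tendsto (fun m => ENNReal.ofReal M * a m) atTop (𝓝 0) := by
    intro a M ha
    have := ENNReal.Tendsto.const_mul ha (Or.inr (ENNReal.ofReal_ne_top (r := M)))
    rwa [mul_zero] at this
  have hy := h.tendsto_frontier_zero hd (y := fun m y => χ y * D m y)
    (fun m => hχ.mul (hDs m)) ?_ ?_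
  · refine TendstoL2.of_tendsto_sub (fun m => hmeas (hw m)) (fun m => hmeas (hz m))
      (hT.mono_measure (Measure.restrict_mono inter_subset_left le_rfl)).1 ?_
      (TendstoL2.mono_measure z2 (Measure.restrict_mono inter_subset_left le_rfl))
    refine tendsto_of_tendsto_of_tendsto_of_le_of_le tendsto_const_nhds hy (fun _ => zero_le)
      fun m => ?_
    simp only
    have hfm : MeasurableSet (frontier K ∩ Metric.ball x (r / 2)) :=
      isClosed_frontier.measurableSet.inter Metric.isOpen_ball.measurableSet
    have e1 : (fun y => w m y - z m y) =ᵐ[(surf d).restrict (frontier K ∩ Metric.ball x (r / 2))]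
        fun y => χ y * D m y := by
      filter_upwards [ae_restrict_mem hfm] with y hy
      rw [χ.one_of_mem_closedBall (Metric.ball_subset_closedBall hy.2), one_mul]
    rw [eLpNorm_congr_ae e1]
    exact eLpNorm_mono_measure _ (Measure.restrict_mono inter_subset_left le_rfl)
  · refine tendsto_of_tendsto_of_tendsto_of_le_of_le tendsto_const_nhds (hlim 1 hD0)
      (fun _ => zero_le) fun m => ?_
    simp only
    rw [hcut fun y hy => by rw [hχB y hy, zero_mul]]
    exact hmul hχ1
  · intro i
    obtain ⟨M, hM⟩ := hbound i
    have h0 := (hlim 1 (hD1 i)).add (hlim M hD0)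
    rw [add_zero] at h0
    refine tendsto_of_tendsto_of_tendsto_of_le_of_le tendsto_const_nhds h0
      (fun _ => zero_le) fun m => ?_
    simp only
    have e1 : partialDeriv i (fun y => χ y * D m y) =
        (fun y => χ y * partialDeriv i (D m) y) + fun y => partialDeriv i χ y * D m y := by
      ext y
      rw [partialDeriv_mul hχ (hDs m), Pi.add_apply, mul_comm (D m y)]
    rw [e1, hcut fun y hy => by
      rw [Pi.add_apply, hχB y hy, hχ'B i y hy, zero_mul, zero_mul, add_zero]]
    exact (eLpNorm_add_le (hmeas (hχ.mul (contDiff_partialDeriv (hDs m) i)))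
      (hmeas ((contDiff_partialDeriv hχ i).mul (hDs m))) one_le_two).trans
      (add_le_add (hmul hχ1) (hmul hM))

/-- The traces of an `H¹` function from the two sides of an interior face coincide. -/
theorem trace_eq_of_interior {K' : Set (Rd d)} {e' : ι → Set (Rd d)} {n' : ι → Rd d} (h : IsFaceted K e n) (h' : IsFaceted K' e' n') (hd : 1 ≤ d)
    (hΩ : IsOpen Ω) (hK : K ⊆ Ω) (hK' : K' ⊆ Ω) (hu : MemH1 Ω u) {s : Set (Rd d)}
    (hsΩ : s ⊆ Ω) (hs : s ⊆ frontier K) (hs' : s ⊆ frontier K') (hsm : MeasurableSet s) :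
    trace K u =ᵐ[(surf d).restrict s] trace K' u := by
  rw [EventuallyEq, ae_restrict_iff' hsm, ae_iff]
  refine measure_null_of_locally_null _ fun x hx => ?_
  have hxs : x ∈ s := by
    by_contra hxs
    exact hx fun h => absurd h hxs
  obtain ⟨r, hr, hrΩ⟩ := Metric.isOpen_iff.1 hΩ x (hsΩ hxs)
  have hBo : IsOpen (Metric.ball x r) := Metric.isOpen_ball
  -- The ball lies in `Ω` and reaches into both elements. One sequence approximating `u` on the ball
  -- converges to both traces, so they coincide near `x`.
  obtain ⟨w, hw, w0, w1⟩ := exists_smooth_tendsto_of_memH1 hBo (convex_ball x r)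
    ⟨x, Metric.mem_ball_self hr⟩ (hu.mono hΩ hrΩ)
  have main : ∀ {K : Set (Rd d)} {e : ι → Set (Rd d)} {n : ι → Rd d},
      IsFaceted K e n → K ⊆ Ω →
      TendstoL2 ((surf d).restrict (frontier K ∩ Metric.ball x (r / 2))) w (trace K u) := by
    intro K e n h hK
    have hle : volume.restrict (K ∩ Metric.ball x r) ≤ volume.restrict (Metric.ball x r) :=
      Measure.restrict_mono inter_subset_right le_rfl
    refine h.tendsto_trace_local hd (hu.mono hΩ hK) hr hw (TendstoL2.mono_measure w0 hle)
      fun i => ?_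
    refine TendstoL2.congr (TendstoL2.mono_measure (w1 i) hle) (fun _ => EventuallyEq.rfl) ?_
    have a1 := ae_restrict_of_ae_restrict_of_subset (inter_subset_right (s := K))
      (hu.weakPartial_mono hΩ hBo hrΩ i)
    have a2 := ae_restrict_of_ae_restrict_of_subset (inter_subset_left (t := Metric.ball x r))
      (hu.weakPartial_mono hΩ h.isOpen hK i)
    filter_upwards [a1, a2] with y h1 h2
    rw [h1, h2]
  have hsub : (surf d).restrict (s ∩ Metric.ball x (r / 2)) ≤
      (surf d).restrict (frontier K ∩ Metric.ball x (r / 2)) :=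
    Measure.restrict_mono (inter_subset_inter_left _ hs) le_rfl
  have hsub' : (surf d).restrict (s ∩ Metric.ball x (r / 2)) ≤
      (surf d).restrict (frontier K' ∩ Metric.ball x (r / 2)) :=
    Measure.restrict_mono (inter_subset_inter_left _ hs') le_rfl
  have hfr : (surf d).restrict (s ∩ Metric.ball x (r / 2)) ≤ (surf d).restrict (frontier K) :=
    Measure.restrict_mono (inter_subset_left.trans hs) le_rfl
  have hfr' : (surf d).restrict (s ∩ Metric.ball x (r / 2)) ≤ (surf d).restrict (frontier K') :=
    Measure.restrict_mono (inter_subset_left.trans hs') le_rfl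
  have heq := TendstoL2.unique (fun m => (h.memLp_frontier hd (hw m)).mono_measure hfr)
    ((h.memLp_trace hd (hu.mono hΩ hK)).mono_measure hfr)
    ((h'.memLp_trace hd (hu.mono hΩ hK')).mono_measure hfr')
    (TendstoL2.mono_measure (main h hK) hsub) (TendstoL2.mono_measure (main h' hK') hsub')
  rw [EventuallyEq, ae_restrict_iff' (hsm.inter Metric.isOpen_ball.measurableSet), ae_iff] at heq
  refine ⟨_, inter_mem_nhdsWithin _ (Metric.ball_mem_nhds x (half_pos hr)), ?_⟩
  refine measure_mono_null ?_ heq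
  rintro y ⟨hy, hyB⟩ hcon
  exact hy fun hys => hcon ⟨hys, hyB⟩

/-- On a boundary face the trace from the element is the trace from the domain. -/
theorem trace_eq_of_boundary (h : IsFaceted K e n) (hd : 1 ≤ d)
    (hΩ : IsOpen Ω) (hK : K ⊆ Ω) (hu : MemH1 Ω u) {g : Rd d → ℝ} (hg : IsTrace Ω u g)
    {s : Set (Rd d)} (hsΩ : s ⊆ frontier Ω) (hs : s ⊆ frontier K) :
    trace K u =ᵐ[(surf d).restrict s] g := by
  obtain ⟨hg2, w, hw, w0, w1, w2⟩ := hg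
  obtain ⟨hT, z, hz, z0, z1, z2⟩ := h.isTrace_trace hd (hu.mono hΩ hK)
  have hle : volume.restrict K ≤ volume.restrict Ω := Measure.restrict_mono hK le_rfl
  have hmeas : ∀ {f : Rd d → ℝ} {μ : Measure (Rd d)}, ContDiff ℝ ∞ f → AEStronglyMeasurable f μ :=
    fun hf => hf.continuous.aestronglyMeasurable
  -- The sequence `w` realizing `g` on the frontier of `Ω` also approximates `u` in $H^1(K)$. Its
  -- boundary values thus converge to the trace from `K` as well as to `g`. No trace theorem for `Ω`
  -- is needed.
  have hy := h.tendsto_frontier_zero hd (y := fun m y => w m y - z m y)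
    (fun m => (hw m).sub (hz m))
    (TendstoL2.tendsto_sub_of_same (fun m => hmeas (hw m)) (fun m => hmeas (hz m))
      (hu.mono hΩ hK).1.1 (TendstoL2.mono_measure w0 hle) z0) fun i => ?_
  · have h1 : TendstoL2 ((surf d).restrict (frontier K)) w (trace K u) :=
      TendstoL2.of_tendsto_sub (fun m => hmeas (hw m)) (fun m => hmeas (hz m)) hT.1 hy z2
    have hsf : (surf d).restrict s ≤ (surf d).restrict (frontier K) :=
      Measure.restrict_mono hs le_rfl
    have hsΩ' : (surf d).restrict s ≤ (surf d).restrict (frontier Ω) :=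
      Measure.restrict_mono hsΩ le_rfl
    exact TendstoL2.unique (fun m => (h.memLp_frontier hd (hw m)).mono_measure hsf)
      (hT.mono_measure hsf) (hg2.mono_measure hsΩ') (TendstoL2.mono_measure h1 hsf)
      (TendstoL2.mono_measure w2 hsΩ')
  · have h1 : TendstoL2 (volume.restrict K) (fun m => partialDeriv i (w m)) (weakPartial K i u) :=
      TendstoL2.congr (TendstoL2.mono_measure (w1 i) hle) (fun _ => EventuallyEq.rfl)
        (hu.weakPartial_mono hΩ h.isOpen hK i).symm
    refine Tendsto.congr (fun m => ?_) (TendstoL2.tendsto_sub_of_same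
      (fun m => hmeas (contDiff_partialDeriv (hw m) i))
      (fun m => hmeas (contDiff_partialDeriv (hz m) i))
      ((hu.mono hΩ hK).memLp_weakPartial h.isOpen i).1 h1 (z1 i))
    congr 1
    ext y
    exact (partialDeriv_sub (hw m) (hz m) i y).symm

end IsFaceted

/-! ### Linear operators with values in `L²` -/

/-- `P` is, up to null sets, a linear operator from `W` to `L²(μ)`. -/
structure IsL2Linear {X α : Type*} [AddCommGroup X] [Module ℝ X] [MeasurableSpace α]
    (W : Submodule ℝ X) (μ : Measure α) (P : X → α → ℝ) : Prop where
  memLp : ∀ v ∈ W, MemLp (P v) 2 μ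
  map_add : ∀ u ∈ W, ∀ v ∈ W, P (u + v) =ᵐ[μ] fun x => P u x + P v x
  map_smul : ∀ c : ℝ, ∀ v ∈ W, P (c • v) =ᵐ[μ] fun x => c * P v x

namespace IsL2Linear

variable {X α : Type*} [AddCommGroup X] [Module ℝ X] [MeasurableSpace α]
  {W : Submodule ℝ X} {μ : Measure α} {P Q : X → α → ℝ}

/-- The linear map to the space of classes of square integrable functions. -/
noncomputable def toLin (h : IsL2Linear W μ P) : W →ₗ[ℝ] Lp ℝ 2 μ where
  toFun v := (h.memLp v v.2).toLp (P v)
  map_add' u v := by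
    rw [← MemLp.toLp_add, MemLp.toLp_eq_toLp_iff]
    exact h.map_add u u.2 v v.2
  map_smul' c v := by
    rw [RingHom.id_apply, ← MemLp.toLp_const_smul, MemLp.toLp_eq_toLp_iff]
    exact h.map_smul c v v.2

theorem inner_toLin (h : IsL2Linear W μ P) (hQ : IsL2Linear W μ Q) (u v : W) :
    inner ℝ (h.toLin u) (hQ.toLin v) = ∫ x, P u x * Q v x ∂μ := by
  rw [real_inner_comm, integral_mul_eq_inner_toLp (h.memLp u u.2) (hQ.memLp v v.2)]
  rfl

theorem norm_toLin_sq (h : IsL2Linear W μ P) (v : W) :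
    ‖h.toLin v‖ ^ 2 = ∫ x, P v x ^ 2 ∂μ := norm_toLp_two_sq (h.memLp v v.2)

theorem toLin_eq_zero_iff (h : IsL2Linear W μ P) (v : W) :
    h.toLin v = 0 ↔ P v =ᵐ[μ] 0 := by
  rw [← MemLp.toLp_eq_toLp_iff (h.memLp v v.2) MemLp.zero, MemLp.toLp_zero]
  rfl

theorem add (h : IsL2Linear W μ P) (hQ : IsL2Linear W μ Q) :
    IsL2Linear W μ fun v x => P v x + Q v x where
  memLp v hv := (h.memLp v hv).add (hQ.memLp v hv)
  map_add u hu v hv := by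
    filter_upwards [h.map_add u hu v hv, hQ.map_add u hu v hv] with x h1 h2
    rw [h1, h2]; ring
  map_smul c v hv := by
    filter_upwards [h.map_smul c v hv, hQ.map_smul c v hv] with x h1 h2
    rw [h1, h2]; ring

theorem const_mul (h : IsL2Linear W μ P) (a : ℝ) : IsL2Linear W μ fun v x => a * P v x where
  memLp v hv := (h.memLp v hv).const_mul a
  map_add u hu v hv := by
    filter_upwards [h.map_add u hu v hv] with x h1
    rw [h1]; ring
  map_smul c v hv := by
    filter_upwards [h.map_smul c v hv] with x h1
    rw [h1]; ring

theorem sub (h : IsL2Linear W μ P) (hQ : IsL2Linear W μ Q) :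
    IsL2Linear W μ fun v x => P v x - Q v x := by
  have := h.add (hQ.const_mul (-1))
  simpa [sub_eq_add_neg] using this

theorem sum {κ : Type*} (s : Finset κ) {P : κ → X → α → ℝ}
    (h : ∀ k ∈ s, IsL2Linear W μ (P k)) : IsL2Linear W μ fun v x => ∑ k ∈ s, P k v x where
  memLp v hv := memLp_finsetSum s fun k hk => (h k hk).memLp v hv
  map_add u hu v hv := by
    have := (Finset.eventually_all s).2 fun k hk => (h k hk).map_add u hu v hv
    filter_upwards [this] with x hx
    rw [← Finset.sum_add_distrib]
    exact Finset.sum_congr rfl fun k hk => hx k hk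
  map_smul c v hv := by
    have := (Finset.eventually_all s).2 fun k hk => (h k hk).map_smul c v hv
    filter_upwards [this] with x hx
    rw [Finset.mul_sum]
    exact Finset.sum_congr rfl fun k hk => hx k hk

theorem mono_measure {ν : Measure α} (h : IsL2Linear W μ P) (hν : ν ≤ μ) : IsL2Linear W ν P where
  memLp v hv := (h.memLp v hv).mono_measure hν
  map_add u hu v hv := ae_mono hν (h.map_add u hu v hv)
  map_smul c v hv := ae_mono hν (h.map_smul c v hv)

theorem mono {W' : Submodule ℝ X} (h : IsL2Linear W μ P) (hW : W' ≤ W) : IsL2Linear W' μ P where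
  memLp v hv := h.memLp v (hW hv)
  map_add u hu v hv := h.map_add u (hW hu) v (hW hv)
  map_smul c v hv := h.map_smul c v (hW hv)

end IsL2Linear

/-- The space `H²(D)` as a space of functions. -/
def h2Submodule {d : ℕ} {D : Set (Rd d)} (hD : IsOpen D) : Submodule ℝ (Rd d → ℝ) where
  carrier := {v | MemH2 D v}
  add_mem' h h' := h.add hD h'
  zero_mem' := MemH2.zero hD
  smul_mem' c _ h := h.const_mul hD c

theorem isL2Linear_weakPartial {d : ℕ} {D : Set (Rd d)} (hD : IsOpen D) (k : Fin d) :
    IsL2Linear (h2Submodule hD) (volume.restrict D) fun v => weakPartial D k v where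
  memLp _ hv := hv.1.memLp_weakPartial hD k
  map_add _ hu _ hv := hu.1.weakPartial_add hD hv.1 k
  map_smul c _ hv := hv.1.weakPartial_const_mul hD c k

theorem isL2Linear_weakPartial_weakPartial {d : ℕ} {D : Set (Rd d)} (hD : IsOpen D) (k m : Fin d) :
    IsL2Linear (h2Submodule hD) (volume.restrict D)
      fun v => weakPartial D m (weakPartial D k v) where
  memLp _ hv := (hv.2 k).memLp_weakPartial hD m
  map_add _ hu _ hv := (weakPartial_congr_ae hD (hu.1.weakPartial_add hD hv.1 k)).trans
    ((hu.2 k).weakPartial_add hD (hv.2 k) m)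
  map_smul c _ hv := (weakPartial_congr_ae hD (hv.1.weakPartial_const_mul hD c k)).trans
    ((hv.2 k).weakPartial_const_mul hD c m)

namespace IsFaceted

variable {d : ℕ} {ι : Type*} [Fintype ι] {K : Set (Rd d)} {e : ι → Set (Rd d)} {n : ι → Rd d}

theorem isL2Linear_trace (h : IsFaceted K e n) (hd : 1 ≤ d) :
    IsL2Linear (h2Submodule h.isOpen) ((surf d).restrict (frontier K)) (trace K) where
  memLp _ hv := h.memLp_trace hd hv.1
  map_add _ hu _ hv := h.trace_add hd hu.1 hv.1
  map_smul c _ hv := h.trace_const_mul hd hv.1 c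

theorem isL2Linear_trace_weakPartial (h : IsFaceted K e n) (hd : 1 ≤ d) (k : Fin d) :
    IsL2Linear (h2Submodule h.isOpen) ((surf d).restrict (frontier K))
      fun v => trace K (weakPartial K k v) where
  memLp _ hv := h.memLp_trace hd (hv.2 k)
  map_add _ hu _ hv :=
    ((h.trace_congr hd (((h2Submodule h.isOpen).add_mem hu hv).2 k)
      (hu.1.weakPartial_add h.isOpen hv.1 k))).trans (h.trace_add hd (hu.2 k) (hv.2 k))
  map_smul c _ hv :=
    ((h.trace_congr hd (((h2Submodule h.isOpen).smul_mem c hv).2 k)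
      (hv.1.weakPartial_const_mul h.isOpen c k))).trans (h.trace_const_mul hd (hv.2 k) c)

end IsFaceted

/-! ### Meshes -/

namespace Mesh

variable {d : ℕ} {Ω : Set (Rd d)} (T : Mesh d Ω)

open Classical in
/-- The face `e`, if it belongs to the element `i`. -/
noncomputable def elemFace (i : Fin T.numElems) (e : Fin T.numFaces) : Set (Rd d) :=
  if T.plus e = i ∨ T.minus e = some i then T.face e else ∅

/-- The unit normal on the face `e`, outward from the element `i`. -/
noncomputable def elemNormal (i : Fin T.numElems) (e : Fin T.numFaces) : Rd d :=
  if T.plus e = i then T.normal e else -T.normal e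

theorem isOpen_elem (i : Fin T.numElems) : IsOpen (T.elem i) := by
  obtain ⟨-, -, m, a, b, h⟩ := T.elem_polytope i
  rw [h, ofPred_forall]
  exact isOpen_iInter_of_finite fun k => isOpen_lt (by fun_prop) (by fun_prop)

/-- A frontier point satisfies all weak inequalities of the polytope and violates a strict one, so
it lies on one of the hyperplanes. -/
theorem isFaceted (i : Fin T.numElems) : IsFaceted (T.elem i) (T.elemFace i) (T.elemNormal i) where
  isOpen := T.isOpen_elem i
  convex := by
    obtain ⟨-, -, m, a, b, h⟩ := T.elem_polytope i
    rw [h, ofPred_forall]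
    exact convex_iInter fun k => convex_halfSpace_lt (innerₛₗ ℝ (a k)).isLinear (b k)
  isBounded := (T.elem_polytope i).2.1
  nonempty := (T.elem_polytope i).1
  flat := by
    obtain ⟨-, -, m, a, b, h⟩ := T.elem_polytope i
    refine ⟨m, a, b, fun k y hy => ?_, fun x hx => ?_⟩
    · rw [h] at hy; exact hy k
    · rw [(T.isOpen_elem i).frontier_eq] at hx
      have h1 : ∀ k, inner ℝ (a k) x ≤ b k := by
        intro k
        have hcl : IsClosed {x : Rd d | inner ℝ (a k) x ≤ b k} :=
          isClosed_le (by fun_prop) (by fun_prop)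
        refine closure_minimal (fun y hy => ?_) hcl hx.1
        rw [h] at hy
        exact (hy k).le
      have h2 : ¬ ∀ k, inner ℝ (a k) x < b k := fun h3 => hx.2 (by rw [h]; exact h3)
      push Not at h2
      obtain ⟨k, hk⟩ := h2
      exact ⟨k, le_antisymm (h1 k) hk⟩
  face_measurable e := by
    unfold elemFace; split_ifs
    · exact T.face_measurable e
    · exact MeasurableSet.empty
  face_disjoint e e' hee := by
    have hsub : ∀ e, T.elemFace i e ⊆ T.face e := fun e => by
      unfold elemFace; split_ifs
      · exact Subset.rfl
      · exact empty_subset _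
    exact (T.face_disjoint hee).mono (hsub e) (hsub e')
  face_subset e := by
    unfold elemFace; split_ifs with h
    · rcases h with h | h
      · rw [← h]; exact T.face_plus e
      · exact (T.face_interior e i h).2.1
    · exact empty_subset _
  normal_unit e := by
    unfold elemNormal; split_ifs
    · exact T.normal_unit e
    · rw [norm_neg]; exact T.normal_unit e
  normal_outward e x hx y hy := by
    unfold elemFace at hx
    unfold elemNormal
    split_ifs at hx with h
    · split_ifs with h'
      · subst h'; exact T.normal_plus e x hx y hy
      · rw [inner_neg_left, neg_nonpos]
        exact T.normal_minus e i (h.resolve_left h') x hx y hy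
    · exact absurd hx (notMem_empty x)
  face_cover := by
    have h : ⋃ e, T.elemFace i e = ⋃ e ∈ {e | T.plus e = i ∨ T.minus e = some i}, T.face e := by
      refine iUnion_congr fun e => ?_
      by_cases h : T.plus e = i ∨ T.minus e = some i <;> simp [elemFace, h]
    rw [h]
    exact T.face_cover i

/-- The functions which belong to `H²` on every element. -/
def brokenH2 : Submodule ℝ (Rd d → ℝ) := ⨅ i, h2Submodule (T.isOpen_elem i)

theorem mem_brokenH2 {v : Rd d → ℝ} : v ∈ T.brokenH2 ↔ ∀ i, MemH2 (T.elem i) v := by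
  simp [brokenH2, Submodule.mem_iInf]; rfl

theorem brokenH2_le (i : Fin T.numElems) : T.brokenH2 ≤ h2Submodule (T.isOpen_elem i) :=
  iInf_le _ i

/-- The scalar jump on the face `e`, in the direction of the normal of `e`. -/
noncomputable def scalarJump (e : Fin T.numFaces) (v : Rd d → ℝ) (x : Rd d) : ℝ :=
  match T.minus e with
  | none => trace (T.elem (T.plus e)) v x
  | some j => trace (T.elem (T.plus e)) v x - trace (T.elem j) v x

/-- The trace of the derivative of `v` on the element `i` in the normal direction of `e`. -/
noncomputable def normalTrace (e : Fin T.numFaces) (i : Fin T.numElems) (v : Rd d → ℝ)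
    (x : Rd d) : ℝ :=
  ∑ k, T.normal e k * trace (T.elem i) (weakPartial (T.elem i) k v) x

/-- The average of the normal derivative on the face `e`. -/
noncomputable def avgFlux (e : Fin T.numFaces) (v : Rd d → ℝ) (x : Rd d) : ℝ :=
  match T.minus e with
  | none => T.normalTrace e (T.plus e) v x
  | some j => (1 / 2) * (T.normalTrace e (T.plus e) v x + T.normalTrace e j v x)

theorem inner_traceGrad_normal (e : Fin T.numFaces) (i : Fin T.numElems) (v : Rd d → ℝ)
    (x : Rd d) : inner ℝ (traceGrad (T.elem i) v x) (T.normal e) = T.normalTrace e i v x := by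
  simp [traceGrad, normalTrace, PiLp.inner_apply]

/-- Jumps are always normal, so only the normal component of a gradient ever meets them. The face
terms of $a_h$ become products of scalar functions. -/
theorem jump_eq (e : Fin T.numFaces) (v : Rd d → ℝ) (x : Rd d) :
    T.jump e v x = T.scalarJump e v x • T.normal e := by
  unfold jump scalarJump
  rcases T.minus e with _ | j
  · rfl
  · simp only
    rw [smul_neg, sub_smul, sub_eq_add_neg]

theorem inner_jump_jump (e : Fin T.numFaces) (u v : Rd d → ℝ) (x : Rd d) :
    inner ℝ (T.jump e u x) (T.jump e v x) = T.scalarJump e u x * T.scalarJump e v x := by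
  rw [jump_eq, jump_eq, real_inner_smul_left, inner_smul_right, real_inner_self_eq_norm_sq,
    T.normal_unit]
  ring

theorem norm_jump_sq (e : Fin T.numFaces) (v : Rd d → ℝ) (x : Rd d) :
    ‖T.jump e v x‖ ^ 2 = T.scalarJump e v x ^ 2 := by
  rw [← real_inner_self_eq_norm_sq, inner_jump_jump, sq]

theorem inner_avgGrad_jump (e : Fin T.numFaces) (u v : Rd d → ℝ) (x : Rd d) :
    inner ℝ (T.avgGrad e u x) (T.jump e v x) = T.avgFlux e u x * T.scalarJump e v x := by
  rw [jump_eq, inner_smul_right, mul_comm]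
  congr 1
  unfold avgGrad avgFlux
  rcases T.minus e with _ | j
  · rw [inner_traceGrad_normal]
  · simp only
    rw [real_inner_smul_left, inner_add_left, inner_traceGrad_normal, inner_traceGrad_normal]

theorem face_subset_frontier_plus (e : Fin T.numFaces) :
    (surf d).restrict (T.face e) ≤ (surf d).restrict (frontier (T.elem (T.plus e))) :=
  Measure.restrict_mono (T.face_plus e) le_rfl

theorem face_subset_frontier_minus {e : Fin T.numFaces} {j : Fin T.numElems}
    (h : T.minus e = some j) :
    (surf d).restrict (T.face e) ≤ (surf d).restrict (frontier (T.elem j)) :=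
  Measure.restrict_mono (T.face_interior e j h).2.1 le_rfl

theorem isL2Linear_grad (i : Fin T.numElems) (k : Fin d) :
    IsL2Linear T.brokenH2 (volume.restrict (T.elem i)) fun v => weakPartial (T.elem i) k v :=
  (isL2Linear_weakPartial (T.isOpen_elem i) k).mono (T.brokenH2_le i)

theorem isL2Linear_hess (i : Fin T.numElems) (k m : Fin d) :
    IsL2Linear T.brokenH2 (volume.restrict (T.elem i))
      fun v => weakPartial (T.elem i) m (weakPartial (T.elem i) k v) :=
  (isL2Linear_weakPartial_weakPartial (T.isOpen_elem i) k m).mono (T.brokenH2_le i)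

theorem isL2Linear_scalarJump (hd : 1 ≤ d) (e : Fin T.numFaces) :
    IsL2Linear T.brokenH2 ((surf d).restrict (T.face e)) (T.scalarJump e) := by
  have hplus := ((T.isFaceted (T.plus e)).isL2Linear_trace hd).mono (T.brokenH2_le _)
    |>.mono_measure (T.face_subset_frontier_plus e)
  unfold scalarJump
  rcases h : T.minus e with _ | j
  · exact hplus
  · exact hplus.sub (((T.isFaceted j).isL2Linear_trace hd).mono (T.brokenH2_le _)
      |>.mono_measure (T.face_subset_frontier_minus h))

theorem isL2Linear_normalTrace (hd : 1 ≤ d) (e : Fin T.numFaces) (i : Fin T.numElems) :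
    IsL2Linear T.brokenH2 ((surf d).restrict (frontier (T.elem i))) (T.normalTrace e i) :=
  IsL2Linear.sum Finset.univ fun k _ =>
    (((T.isFaceted i).isL2Linear_trace_weakPartial hd k).mono (T.brokenH2_le i)).const_mul
      (T.normal e k)

theorem isL2Linear_avgFlux (hd : 1 ≤ d) (e : Fin T.numFaces) :
    IsL2Linear T.brokenH2 ((surf d).restrict (T.face e)) (T.avgFlux e) := by
  have hplus := (T.isL2Linear_normalTrace hd e (T.plus e)).mono_measure
    (T.face_subset_frontier_plus e)
  unfold avgFlux
  rcases h : T.minus e with _ | j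
  · exact hplus
  · exact (hplus.add ((T.isL2Linear_normalTrace hd e j).mono_measure
      (T.face_subset_frontier_minus h))).const_mul _

/-- The interior penalty form, with scalar fluxes and jumps. -/
theorem ah_eq (hE ηE : Fin T.numFaces → ℝ) (hd : 1 ≤ d) (u v : T.brokenH2) :
    T.ah hE ηE u v =
      (∑ i, ∑ k, inner ℝ ((T.isL2Linear_grad i k).toLin u) ((T.isL2Linear_grad i k).toLin v))
      - (∑ e, inner ℝ ((T.isL2Linear_avgFlux hd e).toLin u)
          ((T.isL2Linear_scalarJump hd e).toLin v))
      - (∑ e, inner ℝ ((T.isL2Linear_scalarJump hd e).toLin u)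
          ((T.isL2Linear_avgFlux hd e).toLin v))
      + ∑ e, ηE e * (hE e)⁻¹ * inner ℝ ((T.isL2Linear_scalarJump hd e).toLin u)
          ((T.isL2Linear_scalarJump hd e).toLin v) := by
  simp only [IsL2Linear.inner_toLin]
  unfold ah
  congr 1
  · congr 1
    · congr 1
      · refine Finset.sum_congr rfl fun i _ => ?_
        have hint : ∀ k, Integrable (fun x => weakPartial (T.elem i) k u x *
            weakPartial (T.elem i) k v x) (volume.restrict (T.elem i)) := fun k =>
          ((T.isL2Linear_grad i k).memLp u u.2).integrable_mul
            ((T.isL2Linear_grad i k).memLp v v.2)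
        rw [← integral_finsetSum _ fun k _ => hint k]
        congr 1 with x
        simp [weakGrad, PiLp.inner_apply, mul_comm]
      · simp only [inner_avgGrad_jump]
    · refine Finset.sum_congr rfl fun e _ => ?_
      congr 1 with x
      rw [real_inner_comm, inner_avgGrad_jump, mul_comm]
  · refine Finset.sum_congr rfl fun e _ => ?_
    rw [← integral_const_mul]
    simp only [inner_jump_jump]

theorem h1Sq_eq (v : T.brokenH2) :
    T.h1Sq v = ∑ i, ∑ k, ‖(T.isL2Linear_grad i k).toLin v‖ ^ 2 := by
  simp only [IsL2Linear.norm_toLin_sq]; rfl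

theorem jumpSq_eq (hd : 1 ≤ d) (hE : Fin T.numFaces → ℝ) (v : T.brokenH2) :
    T.jumpSq hE v = ∑ e, (hE e)⁻¹ * ‖(T.isL2Linear_scalarJump hd e).toLin v‖ ^ 2 := by
  simp only [IsL2Linear.norm_toLin_sq, jumpSq, norm_jump_sq]

theorem h2Sq_eq (v : T.brokenH2) :
    T.h2Sq v = ∑ i, Metric.diam (T.elem i) ^ 2 *
      ∑ k, ∑ m ∈ Finset.univ.filter (fun m => k ≤ m), ‖(T.isL2Linear_hess i k m).toLin v‖ ^ 2 := by
  simp only [IsL2Linear.norm_toLin_sq]; rfl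

end Mesh

/-! ### Quadratic functionals -/

/-- `q` is the square of a Hilbert seminorm. -/
def IsSqSeminorm {W : Type*} [AddCommGroup W] [Module ℝ W] (q : W → ℝ) : Prop :=
  ∃ b : W → W → ℝ, (∀ v, 0 ≤ q v) ∧ ∀ u v, ∀ t : ℝ, q (u + t • v) = q u + 2 * t * b u v + t ^ 2 * q v

namespace IsSqSeminorm

variable {W : Type*} [AddCommGroup W] [Module ℝ W]

theorem norm_sq {Y : Type*} [NormedAddCommGroup Y] [InnerProductSpace ℝ Y] (L : W →ₗ[ℝ] Y) :
    IsSqSeminorm fun v => ‖L v‖ ^ 2 :=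
  ⟨fun u v => inner ℝ (L u) (L v), fun v => sq_nonneg _, fun u v t => by
    beta_reduce
    rw [map_add, map_smul, norm_add_sq_real, inner_smul_right, norm_smul, mul_pow,
      Real.norm_eq_abs, sq_abs]
    ring⟩

theorem add {p q : W → ℝ} (hp : IsSqSeminorm p) (hq : IsSqSeminorm q) :
    IsSqSeminorm fun v => p v + q v := by
  obtain ⟨b, hb, hb'⟩ := hp
  obtain ⟨c, hc, hc'⟩ := hq
  exact ⟨fun u v => b u v + c u v, fun v => add_nonneg (hb v) (hc v), fun u v t => by
    beta_reduce
    rw [hb', hc']; ring⟩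

theorem const_mul {q : W → ℝ} (hq : IsSqSeminorm q) {a : ℝ} (ha : 0 ≤ a) :
    IsSqSeminorm fun v => a * q v := by
  obtain ⟨c, hc, hc'⟩ := hq
  exact ⟨fun u v => a * c u v, fun v => mul_nonneg ha (hc v), fun u v t => by
    beta_reduce
    rw [hc']; ring⟩

theorem sum {κ : Type*} (s : Finset κ) {q : κ → W → ℝ} (h : ∀ k, IsSqSeminorm (q k)) :
    IsSqSeminorm fun v => ∑ k ∈ s, q k v := by
  choose b hb hb' using h
  refine ⟨fun u v => ∑ k ∈ s, b k u v, fun v => Finset.sum_nonneg fun k _ => hb k v,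
    fun u v t => ?_⟩
  simp only [hb', Finset.sum_add_distrib, Finset.mul_sum]

/-- Minkowski's inequality by the discriminant: `q (u + t • v)` is a nonnegative quadratic
polynomial in `t`, which gives the Cauchy-Schwarz inequality for `b`. -/
theorem sqrt_sub_le {q : W → ℝ} (hq : IsSqSeminorm q) (u v : W) :
    √(q (u - v)) ≤ √(q u) + √(q v) := by
  obtain ⟨b, hb, hb'⟩ := hq
  have h1 : (2 * b u v) ^ 2 - 4 * q v * q u ≤ 0 := by
    refine discrim_le_zero fun t => ?_
    have := hb (u + t • v)
    rw [hb'] at this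
    linarith
  have h2 : b u v ^ 2 ≤ (√(q u) * √(q v)) ^ 2 := by
    rw [mul_pow, Real.sq_sqrt (hb u), Real.sq_sqrt (hb v)]; linarith
  have h3 := abs_le_of_sq_le_sq' h2 (by positivity)
  have h4 := hb' u v (-1)
  rw [neg_one_smul, ← sub_eq_add_neg] at h4
  refine Real.sqrt_le_iff.2 ⟨by positivity, ?_⟩
  rw [h4, add_sq, Real.sq_sqrt (hb u), Real.sq_sqrt (hb v)]
  linarith [h3.1]

end IsSqSeminorm

/-- A linear operator on a finite dimensional space is bounded by any operator with a smaller
kernel. -/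
theorem LinearMap.exists_norm_le_of_ker_le {E X Y : Type*} [AddCommGroup E] [Module ℝ E]
    [FiniteDimensional ℝ E] [NormedAddCommGroup X] [NormedSpace ℝ X] [NormedAddCommGroup Y]
    [NormedSpace ℝ Y] (L : E →ₗ[ℝ] X) (L' : E →ₗ[ℝ] Y) (h : ∀ x, L x = 0 → L' x = 0) :
    ∃ C, 0 ≤ C ∧ ∀ x, ‖L' x‖ ≤ C * ‖L x‖ := by
  -- `L'` factors through the range of `L`: the vector `x - s (L x)` is in the kernel of `L`, so
  -- `L'` kills it. The factor `L' ∘ s` is continuous because the range is finite dimensional.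
  obtain ⟨s, hs⟩ := L.rangeRestrict.exists_rightInverse_of_surjective L.range_rangeRestrict
  have hfin : FiniteDimensional ℝ (LinearMap.range L) := inferInstance
  let g := LinearMap.toContinuousLinearMap (L' ∘ₗ s)
  refine ⟨‖g‖, g.opNorm_nonneg, fun x => ?_⟩
  have h1 : L (s (L.rangeRestrict x)) = L x :=
    congrArg Subtype.val (LinearMap.congr_fun hs (L.rangeRestrict x))
  have h2 : L' x = g (L.rangeRestrict x) := by
    have := h (x - s (L.rangeRestrict x)) (by rw [map_sub, h1, sub_self])
    rw [map_sub, sub_eq_zero] at this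
    exact this
  rw [h2]
  exact g.le_opNorm _

/-! ### Operators dominated by a quadratic functional -/

/-- The square of the `L²(μ)` norm of `P` is bounded by a multiple of `q` on `W`. -/
def IsDominated {X α : Type*} [AddCommGroup X] [Module ℝ X] [MeasurableSpace α]
    (W : Submodule ℝ X) (μ : Measure α) (P : X → α → ℝ) (q : X → ℝ) : Prop :=
  ∃ C, 0 ≤ C ∧ ∀ v ∈ W, ∫ x, P v x ^ 2 ∂μ ≤ C * q v

namespace IsDominated

variable {X α : Type*} [AddCommGroup X] [Module ℝ X] [MeasurableSpace α]
  {W : Submodule ℝ X} {μ : Measure α} {P Q : X → α → ℝ} {q : X → ℝ}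

theorem add (hP : IsL2Linear W μ P) (hQ : IsL2Linear W μ Q) (h : IsDominated W μ P q)
    (h' : IsDominated W μ Q q) : IsDominated W μ (fun v x => P v x + Q v x) q := by
  obtain ⟨C, hC, hCP⟩ := h
  obtain ⟨C', hC', hCQ⟩ := h'
  refine ⟨2 * C + 2 * C', by positivity, fun v hv => ?_⟩
  have hi := ((hP.memLp v hv).integrable_sq).const_mul 2
  have hi' := ((hQ.memLp v hv).integrable_sq).const_mul 2
  calc ∫ x, (P v x + Q v x) ^ 2 ∂μ ≤ ∫ x, (2 * P v x ^ 2 + 2 * Q v x ^ 2) ∂μ := by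
        refine integral_mono ((hP.memLp v hv).add (hQ.memLp v hv)).integrable_sq (hi.add hi')
          fun x => ?_
        simp only
        nlinarith [sq_nonneg (P v x - Q v x)]
    _ = 2 * ∫ x, P v x ^ 2 ∂μ + 2 * ∫ x, Q v x ^ 2 ∂μ := by
        rw [integral_add hi hi', integral_const_mul, integral_const_mul]
    _ ≤ _ := by linarith [hCP v hv, hCQ v hv]

theorem const_mul (h : IsDominated W μ P q) (a : ℝ) : IsDominated W μ (fun v x => a * P v x) q := by
  obtain ⟨C, hC, hCP⟩ := h
  refine ⟨a ^ 2 * C, by positivity, fun v hv => ?_⟩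
  simp only [mul_pow]
  rw [integral_const_mul, mul_assoc]
  exact mul_le_mul_of_nonneg_left (hCP v hv) (sq_nonneg a)

theorem sum {κ : Type*} (s : Finset κ) {P : κ → X → α → ℝ}
    (hP : ∀ k, IsL2Linear W μ (P k)) (h : ∀ k, IsDominated W μ (P k) q) :
    IsDominated W μ (fun v x => ∑ k ∈ s, P k v x) q := by
  classical
  induction s using Finset.induction_on with
  | empty => exact ⟨0, le_rfl, fun v _ => by simp⟩
  | insert k s hk ih =>
    simp only [Finset.sum_insert hk]
    exact add (hP k) (IsL2Linear.sum s fun k _ => hP k) (h k) ih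

theorem mono_measure {ν : Measure α} (hP : IsL2Linear W μ P) (h : IsDominated W μ P q)
    (hν : ν ≤ μ) : IsDominated W ν P q := by
  obtain ⟨C, hC, hCP⟩ := h
  exact ⟨C, hC, fun v hv => (integral_mono_measure hν (ae_of_all _ fun x => sq_nonneg _)
    (hP.memLp v hv).integrable_sq).trans (hCP v hv)⟩

end IsDominated

/-! ### The norm, bounds of the fluxes, and boundedness of $a_h$. -/

namespace Mesh

variable {d : ℕ} {Ω : Set (Rd d)} (T : Mesh d Ω)

theorem h1Sq_nonneg (v : Rd d → ℝ) : 0 ≤ T.h1Sq v :=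
  Finset.sum_nonneg fun _ _ => Finset.sum_nonneg fun _ _ => integral_nonneg fun _ => sq_nonneg _

theorem jumpSq_nonneg {hE : Fin T.numFaces → ℝ} (hE_pos : ∀ e, 0 < hE e) (v : Rd d → ℝ) :
    0 ≤ T.jumpSq hE v :=
  Finset.sum_nonneg fun e _ => mul_nonneg (inv_nonneg.2 (hE_pos e).le)
    (integral_nonneg fun _ => sq_nonneg _)

theorem h2Sq_nonneg (v : Rd d → ℝ) : 0 ≤ T.h2Sq v :=
  Finset.sum_nonneg fun _ _ => mul_nonneg (sq_nonneg _) (Finset.sum_nonneg fun _ _ =>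
    Finset.sum_nonneg fun _ _ => integral_nonneg fun _ => sq_nonneg _)

theorem normStar_nonneg (hE : Fin T.numFaces → ℝ) (v : Rd d → ℝ) : 0 ≤ T.normStar hE v :=
  Real.sqrt_nonneg _

theorem normStar_sq {hE : Fin T.numFaces → ℝ} (hE_pos : ∀ e, 0 < hE e) (v : Rd d → ℝ) :
    T.normStar hE v ^ 2 = T.h1Sq v + T.jumpSq hE v + T.h2Sq v :=
  Real.sq_sqrt (add_nonneg (add_nonneg (T.h1Sq_nonneg v) (T.jumpSq_nonneg hE_pos v))
    (T.h2Sq_nonneg v))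

theorem normStar_sub_le {hE : Fin T.numFaces → ℝ} (hE_pos : ∀ e, 0 < hE e) (hd : 1 ≤ d)
    (u v : T.brokenH2) :
    T.normStar hE ((u : Rd d → ℝ) - v) ≤ T.normStar hE u + T.normStar hE v := by
  have h : IsSqSeminorm fun v : T.brokenH2 => T.h1Sq v + T.jumpSq hE v + T.h2Sq v := by
    simp only [h1Sq_eq, T.jumpSq_eq hd, h2Sq_eq]
    refine IsSqSeminorm.add (IsSqSeminorm.add ?_ ?_) ?_
    · exact IsSqSeminorm.sum _ fun i => IsSqSeminorm.sum _ fun k => IsSqSeminorm.norm_sq _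
    · exact IsSqSeminorm.sum _ fun e =>
        (IsSqSeminorm.norm_sq _).const_mul (inv_nonneg.2 (hE_pos e).le)
    · exact IsSqSeminorm.sum _ fun i => IsSqSeminorm.const_mul
        (IsSqSeminorm.sum _ fun k => IsSqSeminorm.sum _ fun m => IsSqSeminorm.norm_sq _)
        (sq_nonneg _)
  exact h.sqrt_sub_le u v

/-- In dimension at least one a nonempty open set has more than one point. This permits division by
$h_K^2$. -/
theorem diam_elem_pos (hd : 1 ≤ d) (i : Fin T.numElems) : 0 < Metric.diam (T.elem i) := by
  have : NeZero d := ⟨by omega⟩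
  obtain ⟨⟨x, hx⟩, hb, -⟩ := T.elem_polytope i
  have hnt : (T.elem i).Nontrivial :=
    infinite_of_mem_nhds x ((T.isOpen_elem i).mem_nhds hx) |>.nontrivial
  exact Metric.diam_pos hnt hb

theorem integral_grad_sq_le (i : Fin T.numElems) (k : Fin d) (v : Rd d → ℝ) :
    ∫ x in T.elem i, weakPartial (T.elem i) k v x ^ 2 ≤ T.h1Sq v := by
  have h0 : ∀ i k, 0 ≤ ∫ x in T.elem i, weakPartial (T.elem i) k v x ^ 2 := fun _ _ =>
    integral_nonneg fun _ => sq_nonneg _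
  refine le_trans ?_ (Finset.single_le_sum (fun i _ => Finset.sum_nonneg fun k _ => h0 i k)
    (Finset.mem_univ i))
  exact Finset.single_le_sum (f := fun k => ∫ x in T.elem i, weakPartial (T.elem i) k v x ^ 2)
    (fun k _ => h0 i k) (Finset.mem_univ k)

/-- The norm counts each mixed derivative once, for `k ≤ m`. The other order is recovered from the
symmetry of second weak derivatives. -/
theorem integral_hess_sq_le (hd : 1 ≤ d) (i : Fin T.numElems) (k m : Fin d) {v : Rd d → ℝ}
    (hv : v ∈ T.brokenH2) :
    ∫ x in T.elem i, weakPartial (T.elem i) m (weakPartial (T.elem i) k v) x ^ 2 ≤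
      (Metric.diam (T.elem i) ^ 2)⁻¹ * T.h2Sq v := by
  wlog hkm : k ≤ m generalizing k m
  · have hcomm := ((T.mem_brokenH2.1 hv i).weakPartial_comm (T.isOpen_elem i) k m)
    refine le_trans (le_of_eq ?_) (this m k (le_of_not_ge hkm))
    refine integral_congr_ae ?_
    filter_upwards [hcomm] with x hx
    rw [hx]
  have h0 : ∀ i k m, 0 ≤ ∫ x in T.elem i,
      weakPartial (T.elem i) m (weakPartial (T.elem i) k v) x ^ 2 := fun _ _ _ =>
    integral_nonneg fun _ => sq_nonneg _
  have hdi := T.diam_elem_pos hd i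
  rw [inv_mul_eq_div, le_div_iff₀ (by positivity), mul_comm]
  refine le_trans ?_ (Finset.single_le_sum (fun i _ => mul_nonneg (sq_nonneg _)
    (Finset.sum_nonneg fun k _ => Finset.sum_nonneg fun m _ => h0 i k m)) (Finset.mem_univ i))
  refine mul_le_mul_of_nonneg_left ?_ (sq_nonneg _)
  refine le_trans ?_ (Finset.single_le_sum
    (fun k _ => Finset.sum_nonneg fun m _ => h0 i k m) (Finset.mem_univ k))
  exact Finset.single_le_sum (f := fun m => ∫ x in T.elem i,
      weakPartial (T.elem i) m (weakPartial (T.elem i) k v) x ^ 2)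
    (fun m _ => h0 i k m) (Finset.mem_filter.2 ⟨Finset.mem_univ m, hkm⟩)

/-- The trace inequality for each $\partial_kv$: its $L^2$ norm is part of $|v|_{1,h}$, and its
derivatives are second derivatives of `v`, controlled after division by $h_K^2$. -/
theorem isDominated_normalTrace (hd : 1 ≤ d) (e : Fin T.numFaces) (i : Fin T.numElems) :
    IsDominated T.brokenH2 ((surf d).restrict (frontier (T.elem i))) (T.normalTrace e i)
      fun v => T.h1Sq v + T.h2Sq v := by
  refine IsDominated.sum Finset.univ (fun k =>
    (((T.isFaceted i).isL2Linear_trace_weakPartial hd k).mono (T.brokenH2_le i)).const_mul _)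
    fun k => IsDominated.const_mul ?_ _
  obtain ⟨C, hC, hCT⟩ := (T.isFaceted i).exists_trace_bound hd
  set δ := (Metric.diam (T.elem i) ^ 2)⁻¹
  have hδ : 0 ≤ δ := by positivity
  refine ⟨C * (1 + d * δ), by positivity, fun v hv => ?_⟩
  have hv' := T.mem_brokenH2.1 hv i
  refine (hCT _ _ (hv'.2 k) ((T.isFaceted i).isTrace_trace hd (hv'.2 k))).trans ?_
  rw [mul_assoc]
  refine mul_le_mul_of_nonneg_left ?_ hC
  have h1 := T.integral_grad_sq_le i k v
  have h2 := Finset.sum_le_sum fun m (_ : m ∈ Finset.univ) => T.integral_hess_sq_le hd i k m hv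
  rw [Finset.sum_const, Finset.card_univ, Fintype.card_fin, nsmul_eq_mul, ← mul_assoc] at h2
  have h3 := T.h1Sq_nonneg v
  have h4 := T.h2Sq_nonneg v
  have h5 : 0 ≤ d * δ := by positivity
  nlinarith [mul_nonneg h5 h3]

theorem isDominated_avgFlux (hd : 1 ≤ d) (e : Fin T.numFaces) :
    IsDominated T.brokenH2 ((surf d).restrict (T.face e)) (T.avgFlux e)
      fun v => T.h1Sq v + T.h2Sq v := by
  have hlin := T.isL2Linear_normalTrace hd e
  have hdom := T.isDominated_normalTrace hd e
  have hplus := T.face_subset_frontier_plus e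
  unfold avgFlux
  rcases h : T.minus e with _ | j
  · exact (hdom _).mono_measure (hlin _) hplus
  · have hminus := T.face_subset_frontier_minus h
    exact (IsDominated.add ((hlin _).mono_measure hplus) ((hlin _).mono_measure hminus)
      ((hdom _).mono_measure (hlin _) hplus) ((hdom _).mono_measure (hlin _) hminus)).const_mul _

/-- The averaged normal derivatives are bounded by the norms of the first and second
derivatives. -/
theorem exists_norm_avgFlux_sq_le (hd : 1 ≤ d) :
    ∃ C, 0 ≤ C ∧ ∀ e, ∀ v : T.brokenH2,
      ‖(T.isL2Linear_avgFlux hd e).toLin v‖ ^ 2 ≤ C * (T.h1Sq v + T.h2Sq v) := by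
  choose C hC hCF using T.isDominated_avgFlux hd
  refine ⟨∑ e, C e, Finset.sum_nonneg fun e _ => hC e, fun e v => ?_⟩
  rw [IsL2Linear.norm_toLin_sq]
  exact (hCF e v v.2).trans (mul_le_mul_of_nonneg_right
    (Finset.single_le_sum (fun e _ => hC e) (Finset.mem_univ e))
    (add_nonneg (T.h1Sq_nonneg _) (T.h2Sq_nonneg _)))

/-- The interior penalty form is bounded on the functions which belong to `H²` on every element. -/
theorem exists_ah_le {hE ηE : Fin T.numFaces → ℝ} (hE_pos : ∀ e, 0 < hE e)
    (hη : ∀ e, 0 < ηE e) (hd : 1 ≤ d) :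
    ∃ C, ∀ u v : T.brokenH2, T.ah hE ηE u v ≤ C * T.normStar hE u * T.normStar hE v := by
  obtain ⟨C, hC, hCF⟩ := T.exists_norm_avgFlux_sq_le hd
  set N : T.brokenH2 → ℝ := fun v => T.normStar hE v
  have hN : ∀ v, 0 ≤ N v := fun v => T.normStar_nonneg hE v
  have hNsq : ∀ v : T.brokenH2, N v ^ 2 = T.h1Sq v + T.jumpSq hE v + T.h2Sq v :=
    fun v => T.normStar_sq hE_pos v
  have hD : ∀ i k v, ‖(T.isL2Linear_grad i k).toLin v‖ ≤ N v := fun i k v => by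
    refine abs_le_of_sq_le_sq' ?_ (hN v) |>.2
    rw [IsL2Linear.norm_toLin_sq, hNsq]
    linarith [T.integral_grad_sq_le i k v, T.jumpSq_nonneg hE_pos v, T.h2Sq_nonneg v]
  have hF : ∀ e v, ‖(T.isL2Linear_avgFlux hd e).toLin v‖ ≤ √C * N v := fun e v => by
    refine abs_le_of_sq_le_sq' ?_ (mul_nonneg (Real.sqrt_nonneg C) (hN v)) |>.2
    rw [mul_pow, Real.sq_sqrt hC, hNsq]
    exact (hCF e v).trans (mul_le_mul_of_nonneg_left
      (by linarith [T.jumpSq_nonneg hE_pos v]) hC)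
  have hJ : ∀ e v, ‖(T.isL2Linear_scalarJump hd e).toLin v‖ ≤ √(hE e) * N v := fun e v => by
    refine abs_le_of_sq_le_sq' ?_ (mul_nonneg (Real.sqrt_nonneg _) (hN v)) |>.2
    rw [mul_pow, Real.sq_sqrt (hE_pos e).le, ← inv_mul_le_iff₀ (hE_pos e), hNsq,
      T.jumpSq_eq hd]
    have := Finset.single_le_sum (f := fun e => (hE e)⁻¹ *
      ‖(T.isL2Linear_scalarJump hd e).toLin v‖ ^ 2) (fun e _ =>
        mul_nonneg (inv_nonneg.2 (hE_pos e).le) (sq_nonneg _)) (Finset.mem_univ e)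
    linarith [T.h1Sq_nonneg v, T.h2Sq_nonneg v]
  have key : ∀ {Y : Type} [NormedAddCommGroup Y] [InnerProductSpace ℝ Y] (x y : Y)
      (a b : ℝ) (u v : T.brokenH2), 0 ≤ a → ‖x‖ ≤ a * N u → ‖y‖ ≤ b * N v →
      |inner ℝ x y| ≤ a * b * (N u * N v) := by
    intro Y _ _ x y a b u v ha hx hy
    calc |inner ℝ x y| ≤ ‖x‖ * ‖y‖ := abs_real_inner_le_norm x y
      _ ≤ (a * N u) * (b * N v) :=
        mul_le_mul hx hy (norm_nonneg _) (mul_nonneg ha (hN u))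
      _ = _ := by ring
  -- One summand per term of the form, by Cauchy-Schwarz: relative to the norm, a gradient component
  -- costs `1`, a flux `√C` and a jump `√(hE e)`.
  refine ⟨(∑ _i : Fin T.numElems, ∑ _k : Fin d, (1 * 1 : ℝ)) + (∑ e, √C * √(hE e))
    + (∑ e, √(hE e) * √C) + ∑ e, ηE e * (hE e)⁻¹ * (√(hE e) * √(hE e)), fun u v => ?_⟩
  rw [T.ah_eq hE ηE hd]
  rw [mul_assoc, add_mul, add_mul, add_mul]
  have h1 : ∑ i, ∑ k, inner ℝ ((T.isL2Linear_grad i k).toLin u) ((T.isL2Linear_grad i k).toLin v)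
      ≤ (∑ _i : Fin T.numElems, ∑ _k : Fin d, (1 * 1 : ℝ)) * (N u * N v) := by
    simp only [Finset.sum_mul]
    exact Finset.sum_le_sum fun i _ => Finset.sum_le_sum fun k _ =>
      le_of_abs_le (key _ _ 1 1 u v zero_le_one (by simpa using hD i k u) (by simpa using hD i k v))
  have h2 : -∑ e, inner ℝ ((T.isL2Linear_avgFlux hd e).toLin u)
      ((T.isL2Linear_scalarJump hd e).toLin v) ≤ (∑ e, √C * √(hE e)) * (N u * N v) := by
    rw [← Finset.sum_neg_distrib, Finset.sum_mul]
    exact Finset.sum_le_sum fun e _ => (neg_le_abs _).trans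
      (key _ _ _ _ u v (Real.sqrt_nonneg _) (hF e u) (hJ e v))
  have h3 : -∑ e, inner ℝ ((T.isL2Linear_scalarJump hd e).toLin u)
      ((T.isL2Linear_avgFlux hd e).toLin v) ≤ (∑ e, √(hE e) * √C) * (N u * N v) := by
    rw [← Finset.sum_neg_distrib, Finset.sum_mul]
    exact Finset.sum_le_sum fun e _ => (neg_le_abs _).trans
      (key _ _ _ _ u v (Real.sqrt_nonneg _) (hJ e u) (hF e v))
  have h4 : ∑ e, ηE e * (hE e)⁻¹ * inner ℝ ((T.isL2Linear_scalarJump hd e).toLin u)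
      ((T.isL2Linear_scalarJump hd e).toLin v) ≤
      (∑ e, ηE e * (hE e)⁻¹ * (√(hE e) * √(hE e))) * (N u * N v) := by
    rw [Finset.sum_mul]
    refine Finset.sum_le_sum fun e _ => ?_
    rw [mul_assoc (ηE e * (hE e)⁻¹)]
    exact mul_le_mul_of_nonneg_left (le_of_abs_le
      (key _ _ _ _ u v (Real.sqrt_nonneg _) (hJ e u) (hJ e v)))
      (mul_nonneg (hη e).le (inv_nonneg.2 (hE_pos e).le))
  rw [sub_eq_add_neg, sub_eq_add_neg]
  exact add_le_add (add_le_add (add_le_add h1 h2) h3) h4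

end Mesh

/-! ### The inverse inequality and coercivity on $V_h$. -/

/-- On a finite dimensional space of functions of class `H²` the second derivatives are bounded by
the first ones. -/
theorem exists_integral_hess_sq_le {d M : ℕ} {D : Set (Rd d)} (hD : IsOpen D)
    {ψ : Fin M → Rd d → ℝ} (hψ : ∀ j, MemH2 D (ψ j)) (k m : Fin d) :
    ∃ C, 0 ≤ C ∧ ∀ (α : Fin M → ℝ) (v : Rd d → ℝ),
      v =ᵐ[volume.restrict D] (fun x => ∑ j, α j * ψ j x) →
      ∫ x in D, weakPartial D m (weakPartial D k v) x ^ 2 ≤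
        C * ∑ k, ∫ x in D, weakPartial D k v x ^ 2 := by
  -- The argument runs on the coefficient vectors, so the network functions may be linearly
  -- dependent.
  let Ψ : (Fin M → ℝ) →ₗ[ℝ] h2Submodule hD :=
    Fintype.linearCombination ℝ (fun j => (⟨ψ j, hψ j⟩ : h2Submodule hD))
  have hΨ : ∀ α, (Ψ α : Rd d → ℝ) = fun x => ∑ j, α j * ψ j x := fun α => by
    ext x
    simp [Ψ, Fintype.linearCombination_apply, Finset.sum_apply]
  let L : (Fin M → ℝ) →ₗ[ℝ] (Fin d → Lp ℝ 2 (volume.restrict D)) :=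
    LinearMap.pi fun k => (isL2Linear_weakPartial hD k).toLin ∘ₗ Ψ
  let L' : (Fin M → ℝ) →ₗ[ℝ] Lp ℝ 2 (volume.restrict D) :=
    (isL2Linear_weakPartial_weakPartial hD k m).toLin ∘ₗ Ψ
  -- The gradient is only a seminorm, as the span may contain constants. It is enough that a
  -- vanishing gradient forces vanishing second derivatives.
  obtain ⟨C, hC, hCL⟩ := L.exists_norm_le_of_ker_le L' (fun α hα => by
    have h1 : (isL2Linear_weakPartial hD k).toLin (Ψ α) = 0 := congrFun hα k
    rw [IsL2Linear.toLin_eq_zero_iff] at h1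
    change (isL2Linear_weakPartial_weakPartial hD k m).toLin (Ψ α) = 0
    rw [IsL2Linear.toLin_eq_zero_iff]
    exact (weakPartial_congr_ae hD h1).trans (weakPartial_zero hD m))
  refine ⟨C ^ 2, by positivity, fun α v hv => ?_⟩
  have hvk : ∀ k, weakPartial D k v =ᵐ[volume.restrict D] weakPartial D k (Ψ α) := fun k =>
    weakPartial_congr_ae hD (by rw [hΨ]; exact hv)
  have e1 : ∫ x in D, weakPartial D m (weakPartial D k v) x ^ 2 = ‖L' α‖ ^ 2 := by
    rw [LinearMap.comp_apply, IsL2Linear.norm_toLin_sq]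
    refine integral_congr_ae ?_
    filter_upwards [weakPartial_congr_ae (i := m) hD (hvk k)] with x hx
    rw [hx]
  have e2 : ∀ k, ∫ x in D, weakPartial D k v x ^ 2 = ‖L α k‖ ^ 2 := fun k => by
    rw [LinearMap.pi_apply, LinearMap.comp_apply, IsL2Linear.norm_toLin_sq]
    refine integral_congr_ae ?_
    filter_upwards [hvk k] with x hx
    rw [hx]
  have h3 : ‖L α‖ ^ 2 ≤ ∑ k, ‖L α k‖ ^ 2 := by
    have h0 : 0 ≤ ∑ k, ‖L α k‖ ^ 2 := Finset.sum_nonneg fun _ _ => sq_nonneg _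
    rw [← Real.le_sqrt (norm_nonneg _) h0]
    refine (pi_norm_le_iff_of_nonneg (Real.sqrt_nonneg _)).2 fun k => ?_
    exact Real.le_sqrt_of_sq_le (Finset.single_le_sum (f := fun k => ‖L α k‖ ^ 2)
      (fun _ _ => sq_nonneg _) (Finset.mem_univ k))
  rw [e1]
  simp only [e2]
  calc ‖L' α‖ ^ 2 ≤ (C * ‖L α‖) ^ 2 := pow_le_pow_left₀ (norm_nonneg _) (hCL α) 2
    _ = C ^ 2 * ‖L α‖ ^ 2 := mul_pow _ _ _
    _ ≤ _ := mul_le_mul_of_nonneg_left h3 (sq_nonneg C)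

namespace Mesh

variable {d : ℕ} {Ω : Set (Rd d)} (T : Mesh d Ω) {M : ℕ} {Θ : Type*}
  (φ : Fin T.numElems → Θ → Rd d → ℝ) (θ : Fin T.numElems → Fin M → Θ)

/-- `V_h` as a vector space. -/
def lrnnSubmodule : Submodule ℝ (Rd d → ℝ) where
  carrier := T.lrnnSpace φ θ
  add_mem' := by
    rintro u v ⟨hu, hu'⟩ ⟨hv, hv'⟩
    refine ⟨hu.add hv, fun i => ?_⟩
    obtain ⟨_, ⟨α, rfl⟩, hα⟩ := hu' i
    obtain ⟨_, ⟨β, rfl⟩, hβ⟩ := hv' i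
    refine ⟨_, ⟨α + β, rfl⟩, ?_⟩
    filter_upwards [hα, hβ] with x h1 h2
    simp only [Pi.add_apply, h1, h2, add_mul, Finset.sum_add_distrib]
  zero_mem' := ⟨MemLp.zero, fun i => ⟨_, ⟨0, rfl⟩, ae_of_all _ fun x => by simp⟩⟩
  smul_mem' := by
    rintro c v ⟨hv, hv'⟩
    refine ⟨hv.const_smul c, fun i => ?_⟩
    obtain ⟨_, ⟨β, rfl⟩, hβ⟩ := hv' i
    refine ⟨_, ⟨c • β, rfl⟩, ?_⟩
    filter_upwards [hβ] with x h2
    simp only [Pi.smul_apply, h2, smul_eq_mul, Finset.mul_sum, mul_assoc]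

variable {φ θ}

theorem lrnnSubmodule_le_brokenH2 (hφ : ∀ i j, MemH2 (T.elem i) (φ i (θ i j))) :
    T.lrnnSubmodule φ θ ≤ T.brokenH2 := by
  rintro v ⟨-, hv⟩
  refine T.mem_brokenH2.2 fun i => ?_
  obtain ⟨_, ⟨α, rfl⟩, hα⟩ := hv i
  have hO := T.isOpen_elem i
  have h : MemH2 (T.elem i) fun x => ∑ j, α j * φ i (θ i j) x :=
    MemH2.sum hO Finset.univ fun j _ => (hφ i j).const_mul hO (α j)
  exact h.congr hO hα.symm

theorem memH2_mem_brokenH2 (hΩ : IsOpen Ω) {u : Rd d → ℝ} (hu : MemH2 Ω u) : u ∈ T.brokenH2 :=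
  T.mem_brokenH2.2 fun i => hu.mono hΩ (T.isOpen_elem i) (T.elem_subset i)

theorem sumSpace_subset_brokenH2 (hΩ : IsOpen Ω)
    (hφ : ∀ i j, MemH2 (T.elem i) (φ i (θ i j))) {v : Rd d → ℝ}
    (hv : v ∈ sumSpace Ω (T.lrnnSpace φ θ)) : v ∈ T.brokenH2 := by
  obtain ⟨w, hw, z, hz, rfl⟩ := hv
  exact T.brokenH2.add_mem (T.lrnnSubmodule_le_brokenH2 hφ hw) (T.memH2_mem_brokenH2 hΩ hz)

/-- The inverse inequality on `V_h`. -/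
theorem exists_h2Sq_le (hφ : ∀ i j, MemH2 (T.elem i) (φ i (θ i j))) :
    ∃ C, 0 ≤ C ∧ ∀ v ∈ T.lrnnSpace φ θ, T.h2Sq v ≤ C * T.h1Sq v := by
  choose C hC hCh using fun i k m => exists_integral_hess_sq_le (T.isOpen_elem i) (hφ i) k m
  set A : Fin T.numElems → ℝ := fun i => Metric.diam (T.elem i) ^ 2 *
    ∑ k, ∑ m ∈ Finset.univ.filter (fun m => k ≤ m), C i k m
  have hA : ∀ i, 0 ≤ A i := fun i => mul_nonneg (sq_nonneg _) (Finset.sum_nonneg fun k _ =>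
    Finset.sum_nonneg fun m _ => hC i k m)
  refine ⟨∑ i, A i, Finset.sum_nonneg fun i _ => hA i, fun v hv => ?_⟩
  unfold h2Sq
  rw [Finset.sum_mul]
  refine Finset.sum_le_sum fun i _ => ?_
  obtain ⟨_, ⟨α, rfl⟩, hα⟩ := hv.2 i
  have h1 : ∑ k, ∫ x in T.elem i, weakPartial (T.elem i) k v x ^ 2 ≤ T.h1Sq v :=
    Finset.single_le_sum (f := fun i => ∑ k, ∫ x in T.elem i, weakPartial (T.elem i) k v x ^ 2)
      (fun _ _ => Finset.sum_nonneg fun _ _ => integral_nonneg fun _ => sq_nonneg _)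
      (Finset.mem_univ i)
  rw [mul_assoc, Finset.sum_mul]
  refine mul_le_mul_of_nonneg_left (Finset.sum_le_sum fun k _ => ?_) (sq_nonneg _)
  rw [Finset.sum_mul]
  exact Finset.sum_le_sum fun m _ => (hCh i k m α v hα).trans
    (mul_le_mul_of_nonneg_left h1 (hC i k m))

/-- The interior penalty form is coercive on `V_h` for large penalty parameters. -/
theorem exists_stability {hE : Fin T.numFaces → ℝ} (hE_pos : ∀ e, 0 < hE e) (hd : 1 ≤ d)
    (hφ : ∀ i j, MemH2 (T.elem i) (φ i (θ i j))) :
    ∃ η₀ : ℝ, 0 < η₀ ∧ ∀ ηE : Fin T.numFaces → ℝ, (∀ e, η₀ ≤ ηE e) →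
      ∃ Cs, T.IsStabilityConst hE ηE (T.lrnnSpace φ θ) Cs := by
  obtain ⟨C₂, hC₂, hinv⟩ := T.exists_h2Sq_le hφ
  obtain ⟨C, hC, hCF⟩ := T.exists_norm_avgFlux_sq_le hd
  have hS : 0 ≤ ∑ e, hE e := Finset.sum_nonneg fun e _ => (hE_pos e).le
  -- The product bounds the total cost of the flux terms in $|v|_{1,h}^2$; the `1` only keeps `B`
  -- positive.
  set B : ℝ := (∑ e, hE e) * (C * (1 + C₂)) + 1 with hB
  have hBpos : 0 < B := by positivity
  -- Of the penalty, `2 B` pays for the jumps from Young's inequality and `1 / 2` remains. Half of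
  -- the gradient term remains too, and since second derivatives cost at most `C₂` times the
  -- gradient, dividing by `1 + C₂` recovers the full norm.
  refine ⟨2 * B + 1 / 2, by positivity, fun ηE hη => ⟨1 / (2 * (1 + C₂)), by positivity,
    fun v hv => ?_⟩⟩
  lift v to T.brokenH2 using T.lrnnSubmodule_le_brokenH2 hφ hv
  rw [T.normStar_sq hE_pos, T.ah_eq hE ηE hd]
  have h1 := hinv v hv
  have hh1 := T.h1Sq_nonneg v
  have hhJ := T.jumpSq_nonneg hE_pos (v : Rd d → ℝ)
  -- Young's inequality with weight `hE e / (2 * B)`. The weight makes the gradient coefficients sum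
  -- to at most `1 / 2` and gives the jumps their natural factor `(hE e)⁻¹`.
  have key : ∀ e, 2 * inner ℝ ((T.isL2Linear_avgFlux hd e).toLin v)
      ((T.isL2Linear_scalarJump hd e).toLin v) ≤ hE e * (C * (1 + C₂)) / (2 * B) * T.h1Sq v +
        2 * B * ((hE e)⁻¹ * ‖(T.isL2Linear_scalarJump hd e).toLin v‖ ^ 2) := by
    intro e
    have hF := hCF e v
    set F := (T.isL2Linear_avgFlux hd e).toLin v
    set J := (T.isL2Linear_scalarJump hd e).toLin v
    have hh := hE_pos e
    have hF' : ‖F‖ ^ 2 ≤ C * (1 + C₂) * T.h1Sq v := hF.trans (by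
      rw [mul_assoc]
      exact mul_le_mul_of_nonneg_left (by linarith) hC)
    have hs : 0 ≤ hE e / (2 * B) := by positivity
    have h2 := mul_le_mul_of_nonneg_left hF' hs
    have h3 : 2 * (‖F‖ * ‖J‖) ≤ hE e / (2 * B) * ‖F‖ ^ 2 + 2 * B * ((hE e)⁻¹ * ‖J‖ ^ 2) := by
      have h4 : hE e / (2 * B) * ‖F‖ ^ 2 + 2 * B * ((hE e)⁻¹ * ‖J‖ ^ 2) - 2 * (‖F‖ * ‖J‖) =
          hE e / (2 * B) * (‖F‖ - 2 * B / hE e * ‖J‖) ^ 2 := by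
        field_simp; ring
      have h5 : 0 ≤ hE e / (2 * B) * (‖F‖ - 2 * B / hE e * ‖J‖) ^ 2 :=
        mul_nonneg hs (sq_nonneg _)
      linarith
    have h6 := real_inner_le_norm F J
    calc 2 * inner ℝ F J ≤ 2 * (‖F‖ * ‖J‖) := by linarith
      _ ≤ _ := h3
      _ ≤ _ := by
        refine add_le_add (h2.trans (le_of_eq ?_)) le_rfl
        ring
  have hsum := Finset.sum_le_sum fun e (_ : e ∈ Finset.univ) => key e
  rw [Finset.sum_add_distrib, ← Finset.sum_mul, ← Finset.sum_div, ← Finset.sum_mul,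
    ← Finset.mul_sum, ← Finset.mul_sum, ← T.jumpSq_eq hd] at hsum
  have hpen : (2 * B + 1 / 2) * T.jumpSq hE v ≤ ∑ e, ηE e * (hE e)⁻¹ *
      inner ℝ ((T.isL2Linear_scalarJump hd e).toLin v)
        ((T.isL2Linear_scalarJump hd e).toLin v) := by
    rw [T.jumpSq_eq hd, Finset.mul_sum]
    refine Finset.sum_le_sum fun e _ => ?_
    rw [real_inner_self_eq_norm_sq, mul_assoc]
    exact mul_le_mul_of_nonneg_right (hη e)
      (mul_nonneg (inv_nonneg.2 (hE_pos e).le) (sq_nonneg _))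
  have hhalf : (∑ e, hE e) * (C * (1 + C₂)) / (2 * B) ≤ 1 / 2 := by
    rw [div_le_iff₀ (by positivity)]
    linarith
  have hhalf' := mul_le_mul_of_nonneg_right hhalf hh1
  have hcomm : ∑ e, inner ℝ ((T.isL2Linear_scalarJump hd e).toLin v)
      ((T.isL2Linear_avgFlux hd e).toLin v) = ∑ e, inner ℝ ((T.isL2Linear_avgFlux hd e).toLin v)
      ((T.isL2Linear_scalarJump hd e).toLin v) :=
    Finset.sum_congr rfl fun e _ => real_inner_comm _ _
  have hgrad : ∑ i, ∑ k, inner ℝ ((T.isL2Linear_grad i k).toLin v)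
      ((T.isL2Linear_grad i k).toLin v) = T.h1Sq v := by
    simp only [real_inner_self_eq_norm_sq, T.h1Sq_eq]
  have hN : 1 / (2 * (1 + C₂)) * (T.h1Sq v + T.jumpSq hE v + T.h2Sq v) ≤
      1 / 2 * (T.h1Sq v + T.jumpSq hE v) := by
    rw [div_mul_eq_mul_div, div_le_iff₀ (by positivity)]
    nlinarith [mul_nonneg hC₂ hhJ]
  rw [hcomm, hgrad]
  linarith

end Mesh

/-! ### Consistency of the scheme. -/

/-- Test functions have trace zero. -/
theorem memH1g_zero_of_contDiff {d : ℕ} {Ω : Set (Rd d)} (hΩ : IsOpen Ω) {w : Rd d → ℝ}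
    (hw : ContDiff ℝ ∞ w) (hc : HasCompactSupport w) (hs : tsupport w ⊆ Ω) : MemH1g Ω 0 w := by
  have hmem : MemH1 Ω w := MemH1.of_contDiff hw
    ((hw.continuous.memLp_of_hasCompactSupport hc).mono_measure Measure.restrict_le_self)
    fun i => (((contDiff_partialDeriv hw i).continuous.memLp_of_hasCompactSupport
      (hasCompactSupport_partialDeriv hc i))).mono_measure Measure.restrict_le_self
  refine ⟨hmem, MemLp.zero, fun _ => w, fun _ => hw, ?_, fun i => ?_, ?_⟩
  · simp
  · have h : (fun x => partialDeriv i w x - weakPartial Ω i w x) =ᵐ[volume.restrict Ω] 0 := by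
      filter_upwards [weakPartial_of_contDiff hΩ hw i] with x hx
      simp [hx]
    simp only [eLpNorm_congr_ae h, eLpNorm_zero, tendsto_const_nhds]
  · have h : (fun x => w x - (0 : Rd d → ℝ) x) =ᵐ[(surf d).restrict (frontier Ω)] 0 := by
      refine ae_restrict_of_forall_mem isClosed_frontier.measurableSet fun x hx => ?_
      have : x ∉ tsupport w := fun hx' => by
        rw [hΩ.frontier_eq] at hx
        exact hx.2 (hs hx')
      simp [image_eq_zero_of_notMem_tsupport this]
    simp only [eLpNorm_congr_ae h, eLpNorm_zero, tendsto_const_nhds]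

/-- A weak solution of class `H²` solves the differential equation almost everywhere. -/
theorem IsWeakSolution.laplacian_ae {d : ℕ} {Ω : Set (Rd d)} (hΩ : IsOpen Ω) {f g u : Rd d → ℝ}
    (hf : MemLp f 2 (volume.restrict Ω)) (hu : MemH2 Ω u) (h : IsWeakSolution Ω f g u) :
    ∀ᵐ x ∂volume.restrict Ω, f x + ∑ k, weakPartial Ω k (weakPartial Ω k u) x = 0 := by
  have hl : ∀ k, MemLp (weakPartial Ω k (weakPartial Ω k u)) 2 (volume.restrict Ω) := fun k =>
    (hu.2 k).memLp_weakPartial hΩ k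
  have hF : MemLp (fun x => f x + ∑ k, weakPartial Ω k (weakPartial Ω k u) x) 2
      (volume.restrict Ω) := hf.add (memLp_finsetSum _ fun k _ => hl k)
  rw [ae_restrict_iff' hΩ.measurableSet]
  refine hΩ.ae_eq_zero_of_integral_contDiff_smul_eq_zero hF.locallyIntegrableOn_restrict
    fun w hw hc hs => ?_
  have hw2 : ∀ {ψ : Rd d → ℝ}, ContDiff ℝ ∞ ψ → HasCompactSupport ψ →
      MemLp ψ 2 (volume.restrict Ω) := fun hψ hψc =>
    (hψ.continuous.memLp_of_hasCompactSupport hψc).mono_measure Measure.restrict_le_self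
  have hint : ∀ {p ψ : Rd d → ℝ}, MemLp p 2 (volume.restrict Ω) → MemLp ψ 2 (volume.restrict Ω) →
      IntegrableOn (fun x => p x * ψ x) Ω := fun hp hψ => hp.integrable_mul hψ
  have e1 : ∫ x in Ω, inner ℝ (weakGrad Ω u x) (weakGrad Ω w x) =
      ∑ k, ∫ x in Ω, weakPartial Ω k u x * partialDeriv k w x := by
    rw [← integral_finsetSum _ fun k _ => hint (hu.1.memLp_weakPartial hΩ k)
      (hw2 (contDiff_partialDeriv hw k) (hasCompactSupport_partialDeriv hc k))]
    have hall := ae_all_iff.2 fun k => weakPartial_of_contDiff hΩ hw k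
    refine integral_congr_ae ?_
    filter_upwards [hall] with x hx
    simp [weakGrad, PiLp.inner_apply, hx, mul_comm]
  have e2 : ∀ k, ∫ x in Ω, weakPartial Ω k u x * partialDeriv k w x =
      -∫ x in Ω, weakPartial Ω k (weakPartial Ω k u) x * w x := fun k =>
    ((hu.2 k).hasWeakPartial k).2.2 w hw hc hs
  -- Smooth compactly supported test functions suffice: moving the gradient onto `u` and using the
  -- fundamental lemma gives $f+\Delta u=0$.
  have e3 := h.2 w (memH1g_zero_of_contDiff hΩ hw hc hs)
  rw [e1, Finset.sum_congr rfl fun k _ => e2 k, Finset.sum_neg_distrib] at e3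
  rw [← setIntegral_eq_integral_of_forall_compl_eq_zero (s := Ω) fun x hx => by
    rw [image_eq_zero_of_notMem_tsupport fun hx' => hx (hs hx'), zero_smul]]
  have e4 : ∀ x, w x • (f x + ∑ k, weakPartial Ω k (weakPartial Ω k u) x) =
      f x * w x + ∑ k, weakPartial Ω k (weakPartial Ω k u) x * w x := fun x => by
    rw [smul_eq_mul, mul_add, Finset.mul_sum, mul_comm]
    simp only [mul_comm (w x)]
  simp only [e4]
  rw [integral_add (hint hf (hw2 hw hc))
    (integrable_finsetSum _ fun k _ => hint (hl k) (hw2 hw hc)),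
    integral_finsetSum _ fun k _ => hint (hl k) (hw2 hw hc)]
  linarith

namespace Mesh

variable {d : ℕ} {Ω : Set (Rd d)} (T : Mesh d Ω)

/-- The closed elements cover `Ω`, and the boundary of a convex set has volume zero. -/
theorem volume_diff_iUnion_elem : volume (Ω \ ⋃ i, T.elem i) = 0 := by
  refine measure_mono_null (t := ⋃ i, frontier (T.elem i)) ?_ (measure_iUnion_null fun i =>
    (T.isFaceted i).convex.addHaar_frontier volume)
  rintro x ⟨hx, hx'⟩
  have h1 : x ∈ ⋃ i, closure (T.elem i) := T.elem_cover ▸ subset_closure hx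
  obtain ⟨i, hi⟩ := mem_iUnion.1 h1
  refine mem_iUnion.2 ⟨i, ?_⟩
  rw [(T.isOpen_elem i).frontier_eq]
  exact ⟨hi, fun h => hx' (mem_iUnion.2 ⟨i, h⟩)⟩

theorem integral_eq_sum_elem {p : Rd d → ℝ} (hp : IntegrableOn p Ω) :
    ∫ x in Ω, p x = ∑ i, ∫ x in T.elem i, p x := by
  rw [← integral_iUnion_fintype (fun i => (T.isOpen_elem i).measurableSet) T.elem_disjoint
    fun i => hp.mono_set (T.elem_subset i)]
  refine setIntegral_congr_set ?_
  refine (ae_eq_set.2 ⟨T.volume_diff_iUnion_elem, ?_⟩)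
  rw [sdiff_eq_empty.2 (iUnion_subset T.elem_subset), measure_empty]

/-- Green's formula on one element for a function whose Laplacian is `-f`. -/
theorem sum_integral_grad_mul_grad (hΩ : IsOpen Ω) (hd : 1 ≤ d) {f g u v : Rd d → ℝ}
    (hf : MemLp f 2 (volume.restrict Ω)) (hu : MemH2 Ω u) (h : IsWeakSolution Ω f g u)
    (hv : v ∈ T.brokenH2) (i : Fin T.numElems) :
    ∑ k, ∫ x in T.elem i, weakPartial (T.elem i) k u x * weakPartial (T.elem i) k v x =
      (∫ x in T.elem i, f x * v x) + ∑ e, ∫ x in T.elemFace i e,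
        (∑ k, T.elemNormal i e k * trace (T.elem i) (weakPartial (T.elem i) k u) x) *
          trace (T.elem i) v x ∂(surf d) := by
  set K := T.elem i
  have hK : IsOpen K := T.isOpen_elem i
  have hKΩ : K ⊆ Ω := T.elem_subset i
  have hF : IsFaceted K (T.elemFace i) (T.elemNormal i) := T.isFaceted i
  have hu' : MemH2 K u := hu.mono hΩ hK hKΩ
  have hv' : MemH2 K v := T.mem_brokenH2.1 hv i
  -- Green's formula for $\partial_ku$ and `v`, summed over `k`: the second derivatives add up to
  -- the Laplacian, that is, to $-f$.
  have hgreen := fun k => hF.green hd (hu'.2 k) hv'.1 k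
  have hint : ∀ {p : Rd d → ℝ}, MemLp p 2 (volume.restrict K) →
      IntegrableOn (fun x => p x * v x) K := fun hp => hp.integrable_mul hv'.1.1
  have hlap : ∀ᵐ x ∂volume.restrict K, f x + ∑ k, weakPartial K k (weakPartial K k u) x = 0 := by
    have h1 : ∀ k, weakPartial K k (weakPartial K k u) =ᵐ[volume.restrict K]
        weakPartial Ω k (weakPartial Ω k u) := fun k =>
      (weakPartial_congr_ae hK (hu.1.weakPartial_mono hΩ hK hKΩ k)).trans
        ((hu.2 k).weakPartial_mono hΩ hK hKΩ k)
    filter_upwards [ae_all_iff.2 h1, ae_restrict_of_ae_restrict_of_subset hKΩ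
      (h.laplacian_ae hΩ hf hu)] with x h2 h3
    simp only [h2, h3]
  have e1 : (∫ x in K, f x * v x) + ∑ k, ∫ x in K, weakPartial K k (weakPartial K k u) x * v x
      = 0 := by
    have hl := fun k => hint ((hu'.2 k).memLp_weakPartial hK k)
    rw [← integral_finsetSum _ fun k _ => hl k, ← integral_add
      (hint (hf.mono_measure (Measure.restrict_mono hKΩ le_rfl)))
      (integrable_finsetSum _ fun k _ => hl k)]
    refine (integral_congr_ae ?_).trans (integral_zero _ _)
    filter_upwards [hlap] with x hx
    rw [← Finset.sum_mul, ← add_mul, hx, zero_mul]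
  have e2 : ∀ e, ∫ x in T.elemFace i e, (∑ k, T.elemNormal i e k *
      trace K (weakPartial K k u) x) * trace K v x ∂(surf d) =
      ∑ k, T.elemNormal i e k * ∫ x in T.elemFace i e,
        trace K (weakPartial K k u) x * trace K v x ∂(surf d) := fun e => by
    have hr : (surf d).restrict (T.elemFace i e) ≤ (surf d).restrict (frontier K) :=
      Measure.restrict_mono (hF.face_subset e) le_rfl
    have hti : ∀ k, IntegrableOn (fun x => trace K (weakPartial K k u) x * trace K v x)
        (T.elemFace i e) (surf d) := fun k =>
      ((hF.memLp_trace hd (hu'.2 k)).mono_measure hr).integrable_mul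
        ((hF.memLp_trace hd hv'.1).mono_measure hr)
    simp only [Finset.sum_mul, mul_assoc]
    rw [integral_finsetSum _ fun k _ => (hti k).const_mul _]
    simp only [integral_const_mul]
  simp only [e2]
  rw [Finset.sum_comm, ← Finset.sum_congr rfl fun k _ => hgreen k, Finset.sum_add_distrib]
  linarith

/-- The contributions of the two sides of a face. -/
theorem sum_elemFace_integral (e : Fin T.numFaces) (p : Fin T.numElems → Fin d → Rd d → ℝ)
    (q : Fin T.numElems → Rd d → ℝ) :
    ∑ i, ∫ x in T.elemFace i e, (∑ k, T.elemNormal i e k * p i k x) * q i x ∂(surf d) =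
      (∫ x in T.face e, (∑ k, T.normal e k * p (T.plus e) k x) * q (T.plus e) x ∂(surf d)) -
        match T.minus e with
        | none => 0
        | some j => ∫ x in T.face e, (∑ k, T.normal e k * p j k x) * q j x ∂(surf d) := by
  set G : Fin T.numElems → ℝ := fun i =>
    ∫ x in T.face e, (∑ k, T.normal e k * p i k x) * q i x ∂(surf d) with hG
  have key : ∀ i, ∫ x in T.elemFace i e, (∑ k, T.elemNormal i e k * p i k x) * q i x ∂(surf d) =
      (if T.plus e = i then G i else 0) - if T.minus e = some i then G i else 0 := by
    intro i
    by_cases h1 : T.plus e = i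
    · have h2 : T.minus e ≠ some i := fun h2 => (T.face_interior e i h2).1 h1.symm
      simp [elemFace, elemNormal, h1, h2, hG]
    · by_cases h2 : T.minus e = some i
      · simp [elemFace, elemNormal, h1, h2, hG, integral_neg]
      · simp [elemFace, h1, h2]
  simp only [key, Finset.sum_sub_distrib]
  rw [Finset.sum_ite_eq]
  rcases h : T.minus e with _ | j
  · simp [hG]
  · simp [hG]

/-- The scheme is consistent. -/
theorem ah_eq_lh (hΩ : IsOpen Ω) (hd : 1 ≤ d) (hE ηE : Fin T.numFaces → ℝ) {f g u v : Rd d → ℝ}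
    (hf : MemLp f 2 (volume.restrict Ω)) (hu : MemH2 Ω u) (h : IsWeakSolution Ω f g u)
    (hv : v ∈ T.brokenH2) (hv2 : MemLp v 2 (volume.restrict Ω)) :
    T.ah hE ηE u v = T.lh hE ηE f g v := by
  have huB := T.memH2_mem_brokenH2 hΩ hu
  have htr : ∀ e j, T.minus e = some j → ∀ {w : Rd d → ℝ}, MemH1 Ω w →
      trace (T.elem (T.plus e)) w =ᵐ[(surf d).restrict (T.face e)] trace (T.elem j) w :=
    fun e j hj w hw => (T.isFaceted (T.plus e)).trace_eq_of_interior (T.isFaceted j) hd hΩ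
      (T.elem_subset _) (T.elem_subset _) hw (T.face_interior e j hj).2.2 (T.face_plus e)
      (T.face_interior e j hj).2.1 (T.face_measurable e)
  have hgr : ∀ i k, trace (T.elem i) (weakPartial (T.elem i) k u)
      =ᵐ[(surf d).restrict (frontier (T.elem i))] trace (T.elem i) (weakPartial Ω k u) :=
    fun i k => (T.isFaceted i).trace_congr hd ((T.mem_brokenH2.1 huB i).2 k)
      (hu.1.weakPartial_mono hΩ (T.isOpen_elem i) (T.elem_subset i) k)
  have hflux : ∀ e j, T.minus e = some j →
      T.normalTrace e (T.plus e) u =ᵐ[(surf d).restrict (T.face e)] T.normalTrace e j u := by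
    intro e j hj
    filter_upwards [ae_all_iff.2 fun k => htr e j hj (hu.2 k),
      ae_mono (T.face_subset_frontier_plus e) (ae_all_iff.2 (hgr (T.plus e))),
      ae_mono (T.face_subset_frontier_minus hj) (ae_all_iff.2 (hgr j))] with x h1 h2 h3
    simp only [normalTrace, h1, h2, h3]
  have hbd : ∀ e, T.minus e = none →
      trace (T.elem (T.plus e)) u =ᵐ[(surf d).restrict (T.face e)] g := fun e he =>
    (T.isFaceted (T.plus e)).trace_eq_of_boundary hd hΩ (T.elem_subset _) hu.1 h.1.2
      (T.face_boundary e he) (T.face_plus e)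
  -- The exact solution jumps only on the boundary faces, by `g`. The symmetrizing and penalty terms
  -- of $a_h$ thus become the boundary terms of $l$.
  have hjump : ∀ e, T.scalarJump e u =ᵐ[(surf d).restrict (T.face e)]
      if T.minus e = none then g else 0 := by
    intro e
    unfold scalarJump
    rcases he : T.minus e with _ | j
    · simpa using hbd e he
    · filter_upwards [htr e j he hu.1] with x hx
      simp [hx]
  -- On an interior face both sides carry the same flux of `u`, so the two contributions combine
  -- into flux times jump of `v`. This is cancelled by the first face term of $a_h$.
  have hface : ∀ e, ∑ i, ∫ x in T.elemFace i e,
      (∑ k, T.elemNormal i e k * trace (T.elem i) (weakPartial (T.elem i) k u) x) *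
        trace (T.elem i) v x ∂(surf d) =
      ∫ x in T.face e, T.avgFlux e u x * T.scalarJump e v x ∂(surf d) := by
    intro e
    rw [T.sum_elemFace_integral e (fun i k => trace (T.elem i) (weakPartial (T.elem i) k u))
      (fun i => trace (T.elem i) v)]
    have hm : ∀ i, (surf d).restrict (T.face e) ≤ (surf d).restrict (frontier (T.elem i)) →
        IntegrableOn (fun x => T.normalTrace e i u x * trace (T.elem i) v x) (T.face e)
          (surf d) := fun i hi =>
      (((T.isL2Linear_normalTrace hd e i).memLp u huB).mono_measure hi).integrable_mul
        (((T.isFaceted i).memLp_trace hd (T.mem_brokenH2.1 hv i).1).mono_measure hi)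
    have hp := T.face_subset_frontier_plus e
    unfold avgFlux scalarJump
    rcases he : T.minus e with _ | j
    · simp only [sub_zero]; rfl
    · have hmi := T.face_subset_frontier_minus he
      refine (integral_sub (hm _ hp) (hm j hmi)).symm.trans (integral_congr_ae ?_)
      filter_upwards [hflux e j he] with x hx
      simp only [hx]
      ring
  have hah := T.ah_eq hE ηE hd ⟨u, huB⟩ ⟨v, hv⟩
  simp only [IsL2Linear.inner_toLin] at hah
  have hfv : IntegrableOn (fun x => f x * v x) Ω := hf.integrable_mul hv2
  rw [hah, lh, boundaryFaces, Finset.sum_filter, Finset.sum_filter,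
    Finset.sum_congr rfl fun i _ => T.sum_integral_grad_mul_grad hΩ hd hf hu h hv i,
    Finset.sum_add_distrib, ← T.integral_eq_sum_elem hfv, Finset.sum_comm,
    Finset.sum_congr rfl fun e _ => hface e, add_sub_cancel_right]
  congr 1
  · congr 1
    refine Finset.sum_congr rfl fun e _ => ?_
    split_ifs with he
    · refine integral_congr_ae ?_
      filter_upwards [hjump e] with x hx
      rw [hx, if_pos he, real_inner_comm, inner_traceGrad_normal]
      simp only [avgFlux, he]
    · refine (integral_congr_ae ?_).trans (integral_zero _ _)
      filter_upwards [hjump e] with x hx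
      rw [hx, if_neg he, Pi.zero_apply, zero_mul]
  · refine Finset.sum_congr rfl fun e _ => ?_
    split_ifs with he
    · rw [← integral_const_mul]
      refine integral_congr_ae ?_
      filter_upwards [hjump e] with x hx
      rw [hx, if_pos he]
      simp only [scalarJump, he]
    · rw [integral_eq_zero_of_ae, mul_zero]
      filter_upwards [hjump e] with x hx
      rw [hx, if_neg he, Pi.zero_apply, zero_mul]

end Mesh

/-! ### Céa's argument. -/

namespace Mesh

variable {d : ℕ} {Ω : Set (Rd d)} (T : Mesh d Ω)

theorem ah_sub_left (hE ηE : Fin T.numFaces → ℝ) (hd : 1 ≤ d) (u u' v : T.brokenH2) :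
    T.ah hE ηE ((u : Rd d → ℝ) - u') v = T.ah hE ηE u v - T.ah hE ηE u' v := by
  have h := T.ah_eq hE ηE hd (u - u') v
  rw [Submodule.coe_sub] at h
  rw [h, T.ah_eq hE ηE hd u v, T.ah_eq hE ηE hd u' v]
  simp only [map_sub, inner_sub_left, Finset.sum_sub_distrib, mul_sub]
  ring

variable {M : ℕ} {Θ : Type*} {φ : Fin T.numElems → Θ → Rd d → ℝ} {θ : Fin T.numElems → Fin M → Θ}

/-- The Céa-type inequality for the interior penalty scheme, with one element of `V_h`. -/
theorem normStar_sub_le_of_isDiscreteSolution (hd : 1 ≤ d) (hΩ : IsOpen Ω)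
    {hE ηE : Fin T.numFaces → ℝ} (hE_pos : ∀ e, 0 < hE e)
    (hφ : ∀ i j, MemH2 (T.elem i) (φ i (θ i j))) {Cb Cs : ℝ}
    (hCb : T.IsBoundednessConst hE ηE (T.lrnnSpace φ θ) Cb) (hCb0 : 0 ≤ Cb)
    (hCs : T.IsStabilityConst hE ηE (T.lrnnSpace φ θ) Cs) {f g u uh vh : Rd d → ℝ}
    (hf : MemLp f 2 (volume.restrict Ω)) (hu : MemH2 Ω u) (h : IsWeakSolution Ω f g u)
    (huh : T.IsDiscreteSolution hE ηE (T.lrnnSpace φ θ) f g uh) (hvh : vh ∈ T.lrnnSpace φ θ) :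
    T.normStar hE (u - uh) ≤ (1 + Cb / Cs) * T.normStar hE (u - vh) := by
  set V := T.lrnnSubmodule φ θ
  have hV : V ≤ T.brokenH2 := T.lrnnSubmodule_le_brokenH2 hφ
  have hvV : vh ∈ V := hvh
  have hξ : uh - vh ∈ V := V.sub_mem huh.1 hvV
  have huB := T.memH2_mem_brokenH2 hΩ hu
  have hξs : uh - vh ∈ sumSpace Ω (T.lrnnSpace φ θ) :=
    ⟨uh - vh, hξ, 0, MemH2.zero hΩ, (add_zero _).symm⟩
  have hus : u - vh ∈ sumSpace Ω (T.lrnnSpace φ θ) :=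
    ⟨-vh, V.neg_mem hvV, u, hu, by rw [sub_eq_add_neg, add_comm]⟩
  -- Galerkin orthogonality, tested with the difference of two elements of $V_h$.
  have hcons : T.ah hE ηE u (uh - vh) = T.ah hE ηE uh (uh - vh) :=
    (T.ah_eq_lh hΩ hd hE ηE hf hu h (hV hξ) hξ.1).trans (huh.2 _ hξ).symm
  have e1 := T.ah_sub_left hE ηE hd ⟨u, huB⟩ ⟨vh, hV hvV⟩ ⟨uh - vh, hV hξ⟩
  have e2 := T.ah_sub_left hE ηE hd ⟨uh, hV huh.1⟩ ⟨vh, hV hvV⟩ ⟨uh - vh, hV hξ⟩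
  have h1 := hCs.2 _ hξ
  have h2 := hCb _ hus _ hξs
  have h3 := T.normStar_sub_le hE_pos hd ⟨u - vh, T.brokenH2.sub_mem huB (hV hvV)⟩
    ⟨uh - vh, hV hξ⟩
  simp only [sub_sub_sub_cancel_right] at e1 e2 h3
  rw [e1, hcons, ← e2] at h2
  set N := T.normStar hE (uh - vh)
  set N' := T.normStar hE (u - vh)
  have hN : 0 ≤ N := T.normStar_nonneg _ _
  have hCspos := hCs.1
  have h4 : Cs * N ≤ Cb * N' := by
    -- Cancelling a factor `N` needs `N ≠ 0`. If `N = 0` the bound reads `0 ≤ Cb * N'`, and here the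
    -- sign of `Cb` matters.
    rcases hN.eq_or_lt with h0 | h0
    · rw [← h0, mul_zero]
      exact mul_nonneg hCb0 (T.normStar_nonneg _ _)
    · refine le_of_mul_le_mul_right ?_ h0
      nlinarith
  have h5 : N ≤ Cb / Cs * N' := by
    rw [div_mul_eq_mul_div, le_div_iff₀ hCspos]; linarith
  linarith

/-- A negative boundedness constant is possible only if the norm vanishes. -/
theorem IsBoundednessConst.normStar_eq_zero (hd : 1 ≤ d) (hΩ : IsOpen Ω)
    {hE ηE : Fin T.numFaces → ℝ} (hφ : ∀ i j, MemH2 (T.elem i) (φ i (θ i j))) {Cb : ℝ}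
    (hCb : T.IsBoundednessConst hE ηE (T.lrnnSpace φ θ) Cb) (hneg : Cb < 0) {w : Rd d → ℝ}
    (hw : w ∈ sumSpace Ω (T.lrnnSpace φ θ)) : T.normStar hE w = 0 := by
  have hwB := T.sumSpace_subset_brokenH2 hΩ hφ hw
  have hw' : -w ∈ sumSpace Ω (T.lrnnSpace φ θ) := by
    obtain ⟨v, hv, z, hz, rfl⟩ := hw
    exact ⟨-v, (T.lrnnSubmodule φ θ).neg_mem hv, -z, (h2Submodule hΩ).neg_mem hz, neg_add v z⟩
  -- Boundedness for the pairs `(w, w)` and `(-w, w)` bounds both $a_h(w,w)$ and its negative by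
  -- $C_b\|w\|_*^2$; hence $0\le C_b\|w\|_*^2$.
  have h1 := hCb _ hw _ hw
  have h2 := hCb _ hw' _ hw
  have h3 : T.ah hE ηE (-w) w = -T.ah hE ηE w w := by
    have h := T.ah_eq hE ηE hd (-⟨w, hwB⟩) ⟨w, hwB⟩
    rw [Submodule.coe_neg] at h
    rw [h, T.ah_eq hE ηE hd ⟨w, hwB⟩ ⟨w, hwB⟩]
    simp only [map_neg, inner_neg_left, Finset.sum_neg_distrib, mul_neg]
    ring
  have h4 : T.normStar hE (-w) = T.normStar hE w := by
    have e1 := T.h1Sq_eq (-⟨w, hwB⟩)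
    have e2 := T.jumpSq_eq hd hE (-⟨w, hwB⟩)
    have e3 := T.h2Sq_eq (-⟨w, hwB⟩)
    simp only [map_neg, norm_neg, Submodule.coe_neg] at e1 e2 e3
    rw [← T.h1Sq_eq ⟨w, hwB⟩] at e1
    rw [← T.jumpSq_eq hd hE ⟨w, hwB⟩] at e2
    rw [← T.h2Sq_eq ⟨w, hwB⟩] at e3
    rw [normStar, e1, e2, e3, normStar]
  rw [h3, h4] at h2
  have h5 : 0 ≤ Cb * T.normStar hE w ^ 2 := by linarith
  have h6 : T.normStar hE w ^ 2 ≤ 0 := nonpos_of_mul_nonneg_right h5 hneg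
  exact pow_eq_zero_iff two_ne_zero |>.1 (le_antisymm h6 (sq_nonneg _))

end Mesh

/-- A boundedness constant may be negative as defined, and then `1 + Cb / Cs` may be negative, so
the factor cannot be moved inside the infimum. In that case the norm vanishes on $V(h)$ and both
sides are zero. -/
theorem mainTheorem1 {d : ℕ} (hd : 1 ≤ d) {Ω : Set (Rd d)} (hΩ : IsOpen Ω) (T : Mesh d Ω)
    (hE : Fin T.numFaces → ℝ) (hE_pos : ∀ e, 0 < hE e)
    {M : ℕ} {Θ : Type*} (φ : Fin T.numElems → Θ → Rd d → ℝ) (θ : Fin T.numElems → Fin M → Θ)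
    (hφ : ∀ i j, MemH2 (T.elem i) (φ i (θ i j))) :
    -- `a_h` has a boundedness constant, for all positive penalty parameters
    (∀ ηE : Fin T.numFaces → ℝ, (∀ e, 0 < ηE e) →
      ∃ Cb, T.IsBoundednessConst hE ηE (T.lrnnSpace φ θ) Cb) ∧
    -- `a_h` has a stability constant, if the penalty parameters are large enough
    (∃ η₀ : ℝ, 0 < η₀ ∧ ∀ ηE : Fin T.numFaces → ℝ, (∀ e, η₀ ≤ ηE e) →
      ∃ Cs, T.IsStabilityConst hE ηE (T.lrnnSpace φ θ) Cs) ∧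
    -- the Céa-type inequality, with all boundedness and stability constants
    (∀ ηE : Fin T.numFaces → ℝ, (∀ e, 0 < ηE e) →
      ∀ Cb Cs : ℝ, T.IsBoundednessConst hE ηE (T.lrnnSpace φ θ) Cb →
        T.IsStabilityConst hE ηE (T.lrnnSpace φ θ) Cs →
      ∀ f g u uh : Rd d → ℝ, MemLp f 2 (volume.restrict Ω) →
        MemH2 Ω u → IsWeakSolution Ω f g u →
        T.IsDiscreteSolution hE ηE (T.lrnnSpace φ θ) f g uh →
        T.normStar hE (u - uh) ≤
          (1 + Cb / Cs) * ⨅ vh : T.lrnnSpace φ θ, T.normStar hE (u - (vh : Rd d → ℝ))) := by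
  refine ⟨fun ηE hη => ?_, T.exists_stability hE_pos hd hφ, ?_⟩
  · obtain ⟨C, hC⟩ := T.exists_ah_le hE_pos hη hd
    exact ⟨C, fun u hu v hv => hC ⟨u, T.sumSpace_subset_brokenH2 hΩ hφ hu⟩
      ⟨v, T.sumSpace_subset_brokenH2 hΩ hφ hv⟩⟩
  · intro ηE _ Cb Cs hCb hCs f g u uh hf hu h huh
    -- The real infimum of an empty family would be the default value `0`; the discrete solution
    -- shows that the family is not empty.
    have : Nonempty (T.lrnnSpace φ θ) := ⟨⟨uh, huh.1⟩⟩
    rcases le_or_gt 0 Cb with hCb0 | hneg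
    · rw [Real.mul_iInf_of_nonneg (add_nonneg zero_le_one (div_nonneg hCb0 hCs.1.le))]
      exact le_ciInf fun vh => T.normStar_sub_le_of_isDiscreteSolution hd hΩ hE_pos hφ hCb hCb0 hCs
        hf hu h huh vh.2
    · have h0 : ∀ v ∈ T.lrnnSpace φ θ, T.normStar hE (u - v) = 0 := fun v hv =>
        Mesh.IsBoundednessConst.normStar_eq_zero T hd hΩ hφ hCb hneg
          ⟨-v, (T.lrnnSubmodule φ θ).neg_mem hv, u, hu, by rw [sub_eq_add_neg, add_comm]⟩
      rw [h0 uh huh.1, iInf_congr fun vh : T.lrnnSpace φ θ => h0 vh vh.2, ciInf_const, mul_zero]
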